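/- **Setting.** Let $n:\mathbb N\to\mathbb N$ with $n(\lambda)=\omega(\log\lambda)$. A $(\lambda,n)$-*pseudorandom state generator (PRSG) implementation* $G$ assigns to each $\lambda$ and key $k\in\{0,1\}^\lambda$ a pure $n(\lambda)$-qubit state $|\phi_k\rangle$; for $m:\mathbb N\to\mathbb N$, a *classically accessible* $(\lambda,m,n)$-*pseudorandom function-like state generator (PRFSG) implementation* $G$ assigns to each $\lambda$, $k\in\{0,1\}^\lambda$ and $x\in\{0,1\}^{m(\lambda)}$ a pure $n(\lambda)$-qubit state $|\phi_{k,x}\rangle$. A family of distinguishers *breaks* $G$ if there is no negligible function that bounds, for all $\lambda$, its advantage in telling apart (real) copies of $|\phi_k\rangle$, respectively answers $|\phi_{k,x}\rangle$ to adaptive classical queries $x$, for a uniform $k\in\{0,1\}^\lambda$, from (ideal) copies of one Haar random $n(\lambda)$-qubit state, respectively answers $|\varphi_x\rangle$ with independent Haar random states $|\varphi_x\rangle$ for $x\in\{0,1\}^{m(\lambda)}$. A *QCCC interactive bit commitment* is a protocol between a committer with input a bit $b$ and a receiver, who compute quantumly, share no entanglement and exchange classical messages only, in a commit phase followed by a reveal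 phase, at whose end the receiver outputs $\mu\in\{0,1,\bot\}$. It is *complete* if $\Pr[\mu=b]\ge 1-\mathrm{negl}(\lambda)$ for uniform $b$ and honest parties. A computationally unbounded malicious receiver *breaks hiding* if its probability of guessing a uniform committed bit after the commit phase is not bounded by $\frac12+\mathrm{negl}(\lambda)$ for any negligible function; a computationally unbounded malicious committer *breaks binding* if its probability of making the honest receiver output a uniform challenge bit $ch$, which it learns only after the commit phase, is not bounded by $\frac12+\mathrm{negl}(\lambda)$ for any negligible function. An adversary *breaks* the commitment if it breaks hiding or binding. A *quantum fully black-box reduction* from statistically hiding, statistically binding QCCC interactive commitments to PRSGs (or PRFSGs) is a pair $(C,S)$ of efficient oracle algorithms such that (1) for every implementation $G$, $C^G$ is a complete QCCC interactive bit commitment; (2) for every implementation $G$ and every (possibly inefficient and non-uniform) quantum adversary $A$, if $A$ breaks $C^G$, then $S^{A,G}$ breaks $G$. Here the two parties of $C$ ask only classical queries to $G$ (a classical query $k$, or $(k,x)$, returns one copy of the corresponding state), whereas $S$ may query $G$ in superposition, through the isometry $|k\rangle\mapsto|k\rangle|\phi_k\rangle$, respectively $|k,x\rangle\mapsto|k,x\rangle|\phi_{k,x}\rangle$.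 Of efficiency it is only required that the number of rounds and the number of queries are polynomially bounded, that the key length of every query to $G$ is polynomially bounded, and that $S$ on security parameter $\lambda$ uses $A$ only on security parameters bounded by a polynomial in $\lambda$ (in any way whatsoever); all quantum polynomial-time pairs $(C,S)$ are thus included. **Theorem.** For every $n(\lambda)=\omega(\log\lambda)$: 1. there is no quantum fully black-box reduction $(C,S)$ from statistically hiding, statistically binding QCCC interactive commitments to $(\lambda,n)$-PRSGs such that $C$ asks only classical queries to the PRSG; 2. for every input length $m:\mathbb N\to\mathbb N$, there is no quantum fully black-box reduction $(C,S)$ from statistically hiding, statistically binding QCCC interactive commitments to classically accessible $(\lambda,m,n)$-PRFSGs such that $C$ asks only classical queries to the PRFSG. -/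

import Mathlib

open MeasureTheory Filter
open scoped Matrix Kronecker

noncomputable section

namespace QCCC

/-! ## Pure states, Haar measure, negligible functions -/

/-- Bit strings of length `n`; they label the computational basis of `n` qubits. -/
abbrev Bits (n : ℕ) : Type := Fin n → Bool

/-- The Hilbert space of `n` qubits. -/
abbrev Ket (n : ℕ) : Type := EuclideanSpace ℂ (Bits n)

/-- Unit vectors of `n` qubits. -/
abbrev PureState (n : ℕ) : Type := Metric.sphere (0 : Ket n) 1

/-- The Haar measure on `n`-qubit pure states: the uniform probability measure on the unit
sphere, i.e. the normalized surface measure. -/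
def haarState (n : ℕ) : Measure (PureState n) :=
  ((volume : Measure (Ket n)).toSphere Set.univ)⁻¹ • (volume : Measure (Ket n)).toSphere

/-- `ε` is negligible: `s ^ c * ε s → 0` for every `c`. -/
def Negligible (ε : ℕ → ℝ) : Prop :=
  Asymptotics.SuperpolynomialDecay atTop (fun s : ℕ => (s : ℝ)) ε

/-- `n = ω(log s)`. -/
def SuperLog (n : ℕ → ℕ) : Prop :=
  (fun s : ℕ => Real.log (s : ℝ)) =o[atTop] (fun s : ℕ => (n s : ℝ))

/-! ## Quantum instruments -/

/-- A quantum instrument from the system with basis `α` to the system with basis `β`, with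
classical outcomes in `O`: a finite list of Kraus operators, each labelled by the outcome that
is reported when it occurs, with `∑ Kᴴ K = 1`.  Channels, measurements, unitaries and
preparations are all of this form. -/
structure Instr (α β O : Type) [Fintype α] [DecidableEq α] [Fintype β] where
  ops : List (O × Matrix β α ℂ)
  complete : (ops.map fun p => p.2ᴴ * p.2).sum = 1

/-- The isometry `|ψ⟩ ↦ |ψ⟩|φ⟩`. -/
def attach {α : Type} [DecidableEq α] {n : ℕ} (φ : PureState n) : Matrix (α × Bits n) α ℂ :=
  fun p a => if p.1 = a then φ.1 p.2 else 0

/-- The labelled Kraus operators of the operation that attaches `φ` and then applies `J`. -/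
def Instr.withState {α β O : Type} [Fintype α] [DecidableEq α] [Fintype β] {n : ℕ}
    (J : Instr (α × Bits n) β O) (φ : PureState n) : List (O × Matrix β α ℂ) :=
  J.ops.map fun p => (p.1, p.2 * attach φ)

/-- The (subnormalized) state `K ρ Kᴴ`. -/
def conj {α β : Type} [Fintype α] (K : Matrix β α ℂ) (ρ : Matrix α α ℂ) : Matrix β β ℂ :=
  K * ρ * Kᴴ

/-! ## Generators of states -/

/-- An implementation of a (classically accessible) pseudorandom function-like state generator:
for each security parameter `s`, key `k ∈ {0,1}ˢ` and input `x ∈ X s`, a pure state of `n s`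
qubits.  Pseudorandom state generators are the case `X s = Unit` of no input. -/
abbrev Generator (X : ℕ → Type) (n : ℕ → ℕ) : Type :=
  (s : ℕ) → Bits s → X s → PureState (n s)

section Interactive

variable (X : ℕ → Type) (n : ℕ → ℕ)

/-- Local computations of a party with *classical* oracle access to a generator.  The last index
is the dimension of the current memory, `e` that of the final memory, `O` the type of the
classical output.  `step` applies an instrument and branches on its outcome; `query l k x` obtains
one copy of the state with key `k` of length `l` and input `x`, and applies an instrument to it
and the memory.  The query is a classical value that may depend on all previous outcomes. -/
inductive Prog (O : Type) (e : ℕ) : ℕ → Type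
  | ret (o : O) : Prog O e e
  | step {d d' r : ℕ} (J : Instr (Fin d) (Fin d') (Fin r)) (next : Fin r → Prog O e d') :
      Prog O e d
  | query {d d' r : ℕ} (l : ℕ) (k : Bits l) (x : X l)
      (J : Instr (Fin d × Bits (n l)) (Fin d') (Fin r)) (next : Fin r → Prog O e d') :
      Prog O e d

variable {X n}

/-- The Kraus operators, labelled by outputs, of a computation with oracle `G`. -/
def Prog.kraus {O : Type} {e : ℕ} (G : Generator X n) :
    {d : ℕ} → Prog X n O e d → List (O × Matrix (Fin e) (Fin d) ℂ)
  | _, .ret o => [(o, 1)]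
  | _, .step J next =>
      J.ops.flatMap fun p => ((next p.1).kraus G).map fun q => (q.1, q.2 * p.2)
  | _, .query l k x J next =>
      (J.withState (G l k x)).flatMap fun p =>
        ((next p.1).kraus G).map fun q => (q.1, q.2 * p.2)

/-- At most `N` queries on every branch, all with keys of length at most `L`. -/
def Prog.Bounded {O : Type} {e : ℕ} (L : ℕ) : {d : ℕ} → Prog X n O e d → ℕ → Prop
  | _, .ret _, _ => True
  | _, .step _ next, N => ∀ i, (next i).Bounded L N
  | _, .query l _ _ _ next, N => l ≤ L ∧ ∃ N', N = N' + 1 ∧ ∀ i, (next i).Bounded L N'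

end Interactive

/-! ## Two-party protocols with quantum computation and classical communication -/

/-- Classical messages. -/
abbrev Msg : Type := List Bool

/-- The behaviour of a party with a memory of dimension `a`: for each transcript so far, the
labelled Kraus operators of its next local operation. -/
abbrev Behaviour (a : ℕ) (O : Type) : Type :=
  List Msg → List (O × Matrix (Fin a) (Fin a) ℂ)

/-- A classical-quantum state of two parties: the joint state is a mixture of the listed
subnormalized density matrices, each with its classical transcript.  The trace of an entry
is its probability. -/
abbrev Ensemble (a b : ℕ) : Type :=
  List (List Msg × Matrix (Fin a × Fin b) (Fin a × Fin b) ℂ)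

def onLeft {a b : ℕ} (K : Matrix (Fin a) (Fin a) ℂ)
    (ρ : Matrix (Fin a × Fin b) (Fin a × Fin b) ℂ) : Matrix (Fin a × Fin b) (Fin a × Fin b) ℂ :=
  conj (K ⊗ₖ (1 : Matrix (Fin b) (Fin b) ℂ)) ρ

def onRight {a b : ℕ} (K : Matrix (Fin b) (Fin b) ℂ)
    (ρ : Matrix (Fin a × Fin b) (Fin a × Fin b) ℂ) : Matrix (Fin a × Fin b) (Fin a × Fin b) ℂ :=
  conj ((1 : Matrix (Fin a) (Fin a) ℂ) ⊗ₖ K) ρ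

/-- Both memories start in the basis state `|0⟩`; the transcript is empty. -/
def start (a b : ℕ) : Ensemble (a + 1) (b + 1) :=
  [([], Matrix.single (0, 0) (0, 0) 1)]

/-- One round: the left party (the committer) sends a message, then the right party (the
receiver) does. -/
def round {a b : ℕ} (A : Behaviour a Msg) (B : Behaviour b Msg) (σ : Ensemble a b) :
    Ensemble a b :=
  (σ.flatMap fun t => (A t.1).map fun p => (t.1 ++ [p.1], onLeft p.2 t.2)).flatMap
    fun t => (B t.1).map fun p => (t.1 ++ [p.1], onRight p.2 t.2)

/-- `r` rounds of interaction. -/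
def interact {a b : ℕ} (A : Behaviour a Msg) (B : Behaviour b Msg) (r : ℕ) (σ : Ensemble a b) :
    Ensemble a b :=
  (round A B)^[r] σ

open Classical in
/-- The probability that the right party outputs `o` when it applies `B` to its part of `σ`. -/
def probOut {a b : ℕ} {O : Type} (B : Behaviour b O) (o : O) (σ : Ensemble a b) : ℝ :=
  (σ.map fun t =>
    ((B t.1).map fun p => if p.1 = o then (onRight p.2 t.2).trace.re else 0).sum).sum

/-! ## Commitments -/

/-- A QCCC interactive bit commitment with classical oracle access to a generator, at one security
parameter.  The last component of the receiver's code is its output, `none` standing for `⊥`. -/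
structure CommitmentAt (X : ℕ → Type) (n : ℕ → ℕ) where
  commitRounds : ℕ
  revealRounds : ℕ
  cDim : ℕ
  rDim : ℕ
  cCommit : Bool → List Msg → Prog X n Msg (cDim + 1) (cDim + 1)
  cReveal : Bool → List Msg → Prog X n Msg (cDim + 1) (cDim + 1)
  rCommit : List Msg → Prog X n Msg (rDim + 1) (rDim + 1)
  rReveal : List Msg → Prog X n Msg (rDim + 1) (rDim + 1)
  rOutput : List Msg → Prog X n (Option Bool) (rDim + 1) (rDim + 1)

/-- An oracle construction of a QCCC interactive bit commitment. -/
abbrev Commitment (X : ℕ → Type) (n : ℕ → ℕ) : Type := ℕ → CommitmentAt X n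

/-- The construction is efficient: polynomially many rounds, and polynomially many oracle queries
of polynomial length in each local computation.  Nothing else is restricted, so this holds for
every polynomial-time construction with classical queries. -/
def Commitment.Efficient {X : ℕ → Type} {n : ℕ → ℕ} (C : Commitment X n) : Prop :=
  ∃ p : Polynomial ℕ, ∀ s : ℕ,
    (C s).commitRounds ≤ p.eval s ∧ (C s).revealRounds ≤ p.eval s ∧
    (∀ b τ, ((C s).cCommit b τ).Bounded (p.eval s) (p.eval s)) ∧
    (∀ b τ, ((C s).cReveal b τ).Bounded (p.eval s) (p.eval s)) ∧
    (∀ τ, ((C s).rCommit τ).Bounded (p.eval s) (p.eval s)) ∧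
    (∀ τ, ((C s).rReveal τ).Bounded (p.eval s) (p.eval s)) ∧
    (∀ τ, ((C s).rOutput τ).Bounded (p.eval s) (p.eval s))

/-- A computationally unbounded malicious receiver at one security parameter, with its guess of
the committed bit at the end of the commit phase. -/
structure MalReceiver where
  dim : ℕ
  act : List Msg → Instr (Fin (dim + 1)) (Fin (dim + 1)) Msg
  guess : List Msg → Instr (Fin (dim + 1)) (Fin (dim + 1)) Bool

/-- A computationally unbounded malicious committer at one security parameter; it learns the bit
that it has to open only after the commit phase. -/
structure MalCommitter where
  dim : ℕ
  commit : List Msg → Instr (Fin (dim + 1)) (Fin (dim + 1)) Msg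
  reveal : Bool → List Msg → Instr (Fin (dim + 1)) (Fin (dim + 1)) Msg

/-- An adversary against a commitment: an arbitrary, possibly non-uniform, quantum algorithm that
plays the receiver or the committer. -/
inductive Adversary
  | receiver (R : ℕ → MalReceiver)
  | committer (C : ℕ → MalCommitter)

/-- The two adversaries play the same role and coincide on all security parameters up to `N`. -/
def Adversary.AgreeUpTo (N : ℕ) : Adversary → Adversary → Prop
  | .receiver R, .receiver R' => ∀ s ≤ N, R s = R' s
  | .committer C, .committer C' => ∀ s ≤ N, C s = C' s
  | _, _ => False

section Games

variable {X : ℕ → Type} {n : ℕ → ℕ}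

/-- `Pr[μ = b]` for a uniform bit `b` and honest parties. -/
def CommitmentAt.completeness (C : CommitmentAt X n) (G : Generator X n) : ℝ :=
  (1 / 2) * ∑ b : Bool,
    probOut (fun τ => (C.rOutput τ).kraus G) (some b)
      (interact (fun τ => (C.cReveal b τ).kraus G) (fun τ => (C.rReveal τ).kraus G) C.revealRounds
        (interact (fun τ => (C.cCommit b τ).kraus G) (fun τ => (C.rCommit τ).kraus G)
          C.commitRounds (start C.cDim C.rDim)))

/-- The probability that the malicious receiver guesses the uniform committed bit. -/
def CommitmentAt.hidingProb (C : CommitmentAt X n) (G : Generator X n) (R : MalReceiver) : ℝ :=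
  (1 / 2) * ∑ b : Bool,
    probOut (fun τ => (R.guess τ).ops) b
      (interact (fun τ => (C.cCommit b τ).kraus G) (fun τ => (R.act τ).ops)
        C.commitRounds (start C.cDim R.dim))

/-- The probability that the malicious committer, after the commit phase, opens to the uniform
challenge bit. -/
def CommitmentAt.bindingProb (C : CommitmentAt X n) (G : Generator X n) (D : MalCommitter) : ℝ :=
  (1 / 2) * ∑ ch : Bool,
    probOut (fun τ => (C.rOutput τ).kraus G) (some ch)
      (interact (fun τ => (D.reveal ch τ).ops) (fun τ => (C.rReveal τ).kraus G) C.revealRounds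
        (interact (fun τ => (D.commit τ).ops) (fun τ => (C.rCommit τ).kraus G)
          C.commitRounds (start D.dim C.rDim)))

/-- The construction with oracle `G` implements a commitment: it is complete. -/
def Commitment.Implements (C : Commitment X n) (G : Generator X n) : Prop :=
  ∃ ε : ℕ → ℝ, Negligible ε ∧ ∀ s, 1 - ε s ≤ (C s).completeness G

/-- The adversary breaks the construction with oracle `G`: it violates statistical hiding or
statistical binding. -/
def Commitment.BrokenBy (C : Commitment X n) (G : Generator X n) : Adversary → Prop
  | .receiver R => ¬ ∃ ε : ℕ → ℝ, Negligible ε ∧ ∀ s, (C s).hidingProb G (R s) ≤ 1 / 2 + ε s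
  | .committer D => ¬ ∃ ε : ℕ → ℝ, Negligible ε ∧ ∀ s, (C s).bindingProb G (D s) ≤ 1 / 2 + ε s

end Games

/-! ## Distinguishers with quantum access to the generator -/

section Distinguishers

variable (X : ℕ → Type) [∀ l, Fintype (X l)] [∀ l, DecidableEq (X l)] (n : ℕ → ℕ)

/-- Basis of the query register: superpositions of no query and of all keys of length at most `L`
with all inputs. -/
abbrev QueryReg (L : ℕ) : Type := Option (Σ l : Fin (L + 1), Bits l × X l)

/-- Basis of the answer register. -/
abbrev AnswerReg (L : ℕ) : Type := Option (Σ l : Fin (L + 1), Bits (n l))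

instance instDecidableEqQueryReg (L : ℕ) : DecidableEq (QueryReg X L) := inferInstance

instance instDecidableEqAnswerReg (L : ℕ) : DecidableEq (AnswerReg n L) := inferInstance

variable {X n} in
/-- The answer to a query: the state with the key and input in question, in the sector of
the answer register that belongs to the key length; no query is answered by `|none⟩`. -/
def answer (G : Generator X n) (L : ℕ) : QueryReg X L → AnswerReg n L → ℂ
  | none => fun a => if a = none then 1 else 0
  | some ⟨l, k, x⟩ => fun a => ∑ y : Bits (n l), if a = some ⟨l, y⟩ then (G l k x).1 y else 0

variable {X n} in
/-- The quantum query isometry `|q⟩|w⟩ ↦ |q⟩|w⟩|answer to q⟩`. -/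
def queryIso (G : Generator X n) (L w : ℕ) :
    Matrix ((QueryReg X L × Fin w) × AnswerReg n L) (QueryReg X L × Fin w) ℂ :=
  fun p q => if p.1 = q then answer G L q.1 p.2 else 0

/-- Distinguishers for security parameter `s`, indexed by the dimension of the current memory.
Besides local instruments they can make quantum queries to the generator, with local operations
before and after the query, and classical queries `x` to the challenge oracle, each of which
yields one copy of the `x`-th challenge state. -/
inductive Dist (s : ℕ) : ℕ → Type
  | out {d : ℕ} (b : Bool) : Dist s d
  | step {d d' r : ℕ} (J : Instr (Fin d) (Fin d') (Fin r)) (next : Fin r → Dist s d') : Dist s d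
  | query {d d' r : ℕ} (L w : ℕ) (pre : Instr (Fin d) (QueryReg X L × Fin w) Unit)
      (post : Instr ((QueryReg X L × Fin w) × AnswerReg n L) (Fin d') (Fin r))
      (next : Fin r → Dist s d') : Dist s d
  | challenge {d d' r : ℕ} (x : X s) (J : Instr (Fin d × Bits (n s)) (Fin d') (Fin r))
      (next : Fin r → Dist s d') : Dist s d

variable {X n}

/-- The probability that the distinguisher outputs `1` on the (subnormalized) memory state `ρ`, with
generator `G` and challenge states `χ`. -/
def Dist.prob {s : ℕ} (G : Generator X n) (χ : X s → PureState (n s)) :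
    {d : ℕ} → Dist X n s d → Matrix (Fin d) (Fin d) ℂ → ℝ
  | _, .out b, ρ => if b then ρ.trace.re else 0
  | _, .step J next, ρ => (J.ops.map fun p => (next p.1).prob G χ (conj p.2 ρ)).sum
  | _, .query L w pre post next, ρ =>
      (pre.ops.map fun p => (post.ops.map fun q =>
        (next q.1).prob G χ (conj q.2 (conj (queryIso G L w) (conj p.2 ρ)))).sum).sum
  | _, .challenge x J next, ρ =>
      ((J.withState (χ x)).map fun p => (next p.1).prob G χ (conj p.2 ρ)).sum

/-- At most `N` queries (to the generator and to the challenge oracle together) on every branch,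
those to the generator with keys of length at most `M`. -/
def Dist.Bounded {s : ℕ} (M : ℕ) : {d : ℕ} → Dist X n s d → ℕ → Prop
  | _, .out _, _ => True
  | _, .step _ next, N => ∀ i, (next i).Bounded M N
  | _, .query L _ _ _ next, N => L ≤ M ∧ ∃ N', N = N' + 1 ∧ ∀ i, (next i).Bounded M N'
  | _, .challenge _ _ next, N => ∃ N', N = N' + 1 ∧ ∀ i, (next i).Bounded M N'

/-- The distinguishing advantage, with the oracle `G`: in the real experiment the challenge is
`x ↦ G s k x` for a uniform key `k`, in the ideal one the challenge states for the different `x`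
are independent Haar random states. -/
def Dist.advantage {s : ℕ} (D : Dist X n s 1) (G : Generator X n) : ℝ :=
  |(∑ k : Bits s, D.prob G (G s k) 1) / 2 ^ s -
    ∫ χ, D.prob G χ 1 ∂(Measure.pi fun _ : X s => haarState (n s))|

/-- The family `D` of distinguishers breaks the pseudorandomness of `G`. -/
def Generator.BrokenBy (G : Generator X n) (D : (s : ℕ) → Dist X n s 1) : Prop :=
  ¬ ∃ ε : ℕ → ℝ, Negligible ε ∧ ∀ s, (D s).advantage G ≤ ε s

end Distinguishers

/-! ## Fully black-box reductions -/

section Reductions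

variable (X : ℕ → Type) [∀ l, Fintype (X l)] [∀ l, DecidableEq (X l)] (n : ℕ → ℕ)

/-- A security reduction: it turns an adversary `A` against the commitment into a distinguisher
`S^{A,G}` for each security parameter; `G` is accessed by the queries of the distinguisher. -/
abbrev SecurityReduction : Type := (s : ℕ) → Adversary → Dist X n s 1

variable {X n}

/-- The security reduction is efficient: it makes polynomially many queries of polynomial length,
and it uses the adversary only on security parameters (which are given in unary) that are
polynomially bounded.  How it uses the adversary on these parameters is not restricted: running it,
rewinding it, and calling its operations, their inverses or controlled versions of them in
superposition are all covered, as the local operations of the distinguisher may depend on `A`. -/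
def SecurityReduction.Efficient (S : SecurityReduction X n) : Prop :=
  ∃ p : Polynomial ℕ, ∀ s : ℕ,
    (∀ A, (S s A).Bounded (p.eval s) (p.eval s)) ∧
    (∀ A A', Adversary.AgreeUpTo (p.eval s) A A' → S s A = S s A')

/-- `(C, S)` is a quantum fully black-box reduction from statistically hiding and statistically
binding QCCC interactive commitments to pseudorandom generators of type `(X, n)`, where `C` makes
classical queries only. -/
structure IsFullyBlackBoxReduction (C : Commitment X n) (S : SecurityReduction X n) : Prop where
  efficient_construction : C.Efficient
  efficient_security : S.Efficient
  correctness : ∀ G : Generator X n, C.Implements G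
  security : ∀ (G : Generator X n) (A : Adversary),
    C.BrokenBy G A → Generator.BrokenBy G fun s => S s A

end Reductions

end QCCC

end

/-! The oracle is built from independent Haar random states, and everything rests on one correlation
inequality. The parties share no entanglement, so for a fixed generator and a fixed transcript their
joint unnormalized state is a product, and the probability of the transcript together with an output
is a product of a committer's trace and a receiver's trace. Each trace is a sum of terms |P|², where
P is a multihomogeneous polynomial of low degree in the amplitudes of the queried states. If the
dimension 2^n is large compared with the square of the degree, then E|P|² · E|Q|² ≤ 2 E(|P|²|Q|²)
(`integral_mul_integral_sqEval_le_two_mul`). The reason is that Haar moments are Fock inner products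
divided by rising factorials, that the Fock norm is supermultiplicative on such polynomials
(`fockNorm_mul_le`, of Bombieri type), and that the rising factorials are almost multiplicative.

Hence giving the two parties independent random generators at most doubles the failure probability
(`QueryBound.avg_mul_avg_le`). With independent generators the oracle is useless and the classical
impossibility argument applies. The transcript u has probability F_b(u) H(u), with F_b from a
committer to b and H from the receiver. If F_0 H and F_1 H are far apart, an honest-looking receiver
guesses b by maximum likelihood. If they are close, a committer commits to 0 and afterwards prepares
a state that a committer to the challenge bit could have, given u. Averaging fixes all randomness of
the attackers, who thus know nothing about the actual states of long keys. States of short keys,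
where 2^n may be too small, are fixed beforehand and known to everybody
(`QueryBound.exists_attack`).

Such an adversary is of no help against the generator. Replacing the states of one random key among
2^s is hardly noticed by few quantum queries, by a hybrid argument over the queries. A second moment
computation then shows that the squared advantage is of order q 2^(-s/2) on average
(`Dist.avg_advantage_sq_le`).

The generator and the adversaries are built in stages (`exists_step`). Each stage fixes the states
of the next range of key lengths and attacks one more security parameter, chosen too large to be
visible to the distinguishers at the lengths already fixed. An exponentially weighted sum of squared
advantages serves as a potential: one choice of states makes completeness, hiding or binding fail
while the potential stays bounded. In the limit (`exists_world`) one of the three failures occurs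
infinitely often. Failing completeness contradicts correctness. In the other two cases an adversary
breaks the commitment, although the reduction has exponentially small advantage with it. -/

noncomputable section

namespace QCCC

set_option linter.unusedSectionVars false

section Moments

/-! ## Moments of the Haar measure on pure states -/

open scoped ComplexConjugate Nat

/-- For equal exponents the integrand is radial and gives a Gamma value. For different exponents a
suitable rotation of the plane changes the sign of the integrand. -/
theorem integral_pow_mul_conj_pow_mul_gaussian (a b : ℕ) :
    ∫ z : ℂ, z ^ a * conj z ^ b * (Real.exp (-‖z‖ ^ 2) : ℂ) =
      if a = b then (Real.pi * a ! : ℂ) else 0 := by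
  split_ifs with h
  · subst h
    have h1 := Complex.integral_rpow_mul_exp_neg_rpow (p := 2) (q := 2 * a) (by norm_num)
      (by have : (0 : ℝ) ≤ a := Nat.cast_nonneg a
          linarith)
    have h2 : ∀ z : ℂ, z ^ a * conj z ^ a * (Real.exp (-‖z‖ ^ 2) : ℂ) =
        ((‖z‖ ^ (2 * a : ℝ) * Real.exp (-‖z‖ ^ (2 : ℝ)) : ℝ) : ℂ) := by
      intro z
      rw [← mul_pow, Complex.mul_conj, Complex.normSq_eq_norm_sq,
        show (2 * a : ℝ) = ((2 * a : ℕ) : ℝ) by push_cast; ring, Real.rpow_natCast,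
        Real.rpow_two, pow_mul]
      push_cast
      ring
    simp_rw [h2]
    rw [integral_complex_ofReal, h1]
    have : ((2 * a + 2) / 2 : ℝ) = a + 1 := by ring
    rw [this, Real.Gamma_nat_eq_factorial]
    push_cast
    ring
  · have hab : ((a : ℝ) - b) ≠ 0 := by
      intro h'
      exact h (by exact_mod_cast sub_eq_zero.mp h')
    set f : ℂ → ℂ := fun z => z ^ a * conj z ^ b * (Real.exp (-‖z‖ ^ 2) : ℂ) with hf
    -- The phase is chosen so that w^(a - b) = -1.
    set w : Circle := Circle.exp (Real.pi / (a - b)) with hw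
    have hc : (w : ℂ) ^ a * conj (w : ℂ) ^ b = -1 := by
      rw [← Circle.coe_inv_eq_conj, hw, ← Circle.exp_neg, Circle.coe_exp, Circle.coe_exp,
        ← Complex.exp_nat_mul, ← Complex.exp_nat_mul, ← Complex.exp_add, ← Complex.exp_pi_mul_I]
      congr 1
      have : ((a : ℂ) - b) ≠ 0 := by exact_mod_cast hab
      push_cast
      field_simp
      ring
    have hrot : ∀ z, f (rotation w z) = - f z := by
      intro z
      simp only [hf, rotation_apply, map_mul, mul_pow, norm_mul, Circle.norm_coe, one_mul]
      linear_combination (z ^ a * conj z ^ b * (Real.exp (-‖z‖ ^ 2) : ℂ)) * hc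
    have h1 : ∫ z, f (rotation w z) = ∫ z, f z :=
      (LinearIsometryEquiv.measurePreserving (rotation w)).integral_comp
        (rotation w).toHomeomorph.measurableEmbedding f
    simp_rw [hrot, integral_neg] at h1
    exact self_eq_neg.mp h1.symm

/-- The function `z ↦ ∏ z_b ^ α_b * conj z_b ^ β_b`. -/
def ketMonomial {ι : Type*} [Fintype ι] (α β : ι → ℕ) (z : ι → ℂ) : ℂ :=
  ∏ b, z b ^ α b * conj (z b) ^ β b

theorem ketMonomial_smul {ι : Type*} [Fintype ι] (α β : ι → ℕ) (z : ι → ℂ) (r : ℝ) :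
    ketMonomial α β (r • z) = (r : ℂ) ^ (∑ b, (α b + β b)) * ketMonomial α β z := by
  rw [ketMonomial, ketMonomial, ← Finset.prod_pow_eq_pow_sum, ← Finset.prod_mul_distrib]
  refine Finset.prod_congr rfl fun b _ => ?_
  simp only [Pi.smul_apply, Complex.real_smul, map_mul, Complex.conj_ofReal]
  ring

theorem integral_ketMonomial_pi {ι : Type*} [Fintype ι] (α β : ι → ℕ) :
    ∫ z : ι → ℂ, ketMonomial α β z * (Real.exp (-∑ b, ‖z b‖ ^ 2) : ℂ) =
      if α = β then (Real.pi : ℂ) ^ Fintype.card ι * ∏ b, (α b)! else 0 := by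
  have h : ∀ z : ι → ℂ, ketMonomial α β z * (Real.exp (-∑ b, ‖z b‖ ^ 2) : ℂ) =
      ∏ b, (z b ^ α b * conj (z b) ^ β b * (Real.exp (-‖z b‖ ^ 2) : ℂ)) := by
    intro z
    rw [ketMonomial, Finset.prod_mul_distrib (g := fun b => (Real.exp (-‖z b‖ ^ 2) : ℂ)),
      ← Finset.sum_neg_distrib, Real.exp_sum]
    push_cast
    rfl
  simp_rw [h]
  rw [integral_fintype_prod_volume_eq_prod
    (fun b (z : ℂ) => z ^ α b * conj z ^ β b * (Real.exp (-‖z‖ ^ 2) : ℂ))]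
  simp_rw [integral_pow_mul_conj_pow_mul_gaussian]
  split_ifs with hab
  · subst hab
    simp [Finset.prod_mul_distrib]
  · obtain ⟨b, hb⟩ := Function.ne_iff.mp hab
    exact Finset.prod_eq_zero (Finset.mem_univ b) (by simp [hb])

instance instIsProbabilityMeasureHaarState (n : ℕ) : IsProbabilityMeasure (haarState n) := by
  refine ⟨?_⟩
  rw [haarState, Measure.smul_apply, smul_eq_mul, ENNReal.inv_mul_cancel]
  · rw [Ne, Measure.measure_univ_eq_zero]
    exact Measure.toSphere_ne_zero _
  · exact measure_ne_top _ _

/-- Polar coordinates: the radial factor depends on f only through its degree, so sphere integrals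
of monomials can be read off from Gaussian integrals, which factor over the coordinates. -/
theorem integral_homogeneous_mul_gaussian {n : ℕ} (f : Ket n → ℂ) (m : ℕ)
    (hf : ∀ (r : ℝ) z, f (r • z) = (r : ℂ) ^ m * f z) :
    ∫ z : Ket n, f z * (Real.exp (-‖z‖ ^ 2) : ℂ) =
      (∫ ψ : PureState n, f ψ ∂(volume : Measure (Ket n)).toSphere) *
        ((∫ r in Set.Ioi (0 : ℝ), r ^ (Module.finrank ℝ (Ket n) - 1 + m) * Real.exp (-r ^ 2) : ℝ)) := by
  set μ : Measure (Ket n) := volume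
  set d := Module.finrank ℝ (Ket n) - 1
  calc ∫ z : Ket n, f z * (Real.exp (-‖z‖ ^ 2) : ℂ) ∂μ
      = ∫ z : ({(0 : Ket n)}ᶜ : Set (Ket n)), f z * (Real.exp (-‖z.1‖ ^ 2) : ℂ) ∂(μ.comap (↑)) := by
        rw [integral_subtype_comap (measurableSet_singleton _).compl
          fun z : Ket n => f z * (Real.exp (-‖z‖ ^ 2) : ℂ), restrict_compl_singleton]
    _ = ∫ p : PureState n × Set.Ioi (0 : ℝ),
          f p.1 * ((p.2.1 ^ m * Real.exp (-p.2.1 ^ 2) : ℝ) : ℂ)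
            ∂(μ.toSphere.prod (Measure.volumeIoiPow d)) := by
        rw [← μ.measurePreserving_homeomorphUnitSphereProd.integral_comp
          (Homeomorph.measurableEmbedding _)]
        refine integral_congr_ae (Eventually.of_forall fun z => ?_)
        have h1 := homeomorphUnitSphereProd_symm_apply_coe (Ket n) (homeomorphUnitSphereProd (Ket n) z)
        rw [Homeomorph.symm_apply_apply] at h1
        have h2 := homeomorphUnitSphereProd_apply_snd_coe (Ket n) z
        simp only
        rw [h2] at h1 ⊢
        conv_lhs => rw [h1, hf, norm_smul, norm_norm, norm_eq_of_mem_sphere, mul_one]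
        push_cast
        ring
    _ = _ := by
        rw [integral_prod_mul (fun ψ : PureState n => f ψ)
          (fun r : Set.Ioi (0 : ℝ) => ((r.1 ^ m * Real.exp (-r.1 ^ 2) : ℝ) : ℂ)),
          integral_complex_ofReal]
        congr 2
        simp only [Measure.volumeIoiPow, ENNReal.ofReal]
        rw [integral_withDensity_eq_integral_smul,
          integral_subtype_comap measurableSet_Ioi
            fun a : ℝ => Real.toNNReal (a ^ d) • (a ^ m * Real.exp (-a ^ 2)),
          setIntegral_congr_fun measurableSet_Ioi fun x hx => ?_]
        · rw [NNReal.smul_def, Real.coe_toNNReal _ (pow_nonneg hx.out.le _), smul_eq_mul, pow_add]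
          ring
        · exact (measurable_subtype_coe.pow_const _).real_toNNReal

theorem integral_Ioi_pow_mul_gaussian (k : ℕ) :
    ∫ r in Set.Ioi (0 : ℝ), r ^ k * Real.exp (-r ^ 2) = Real.Gamma ((k + 1) / 2) / 2 := by
  have h := integral_rpow_mul_exp_neg_rpow (p := 2) (q := k) (by norm_num)
    (by have : (0 : ℝ) ≤ k := Nat.cast_nonneg k
        linarith)
  simp only [Real.rpow_natCast, Real.rpow_two] at h
  rw [h]
  ring

/-- The constant collects a factor 2, a power of π and the ratio between the volume of the Euclidean
space and the product volume. Its value is irrelevant because it does not depend on the exponents: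
the case α = β = 0, which is the mass of the sphere, eliminates it later. -/
theorem exists_integral_ketMonomial_toSphere (n : ℕ) : ∃ c : ℂ, c ≠ 0 ∧ ∀ α β : Bits n → ℕ,
    (∫ ψ : PureState n, ketMonomial α β ψ.1 ∂(volume : Measure (Ket n)).toSphere) *
      (Real.Gamma (((Module.finrank ℝ (Ket n) - 1 + ∑ b, (α b + β b) : ℕ) + 1) / 2) : ℂ) =
      c * if α = β then (∏ b, (α b)! : ℂ) else 0 := by
  let T := PiLp.continuousLinearEquiv 2 ℝ (fun _ : Bits n => ℂ)
  let ν : Measure (Bits n → ℂ) := (volume : Measure (Ket n)).map T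
  have hν : ν = ν.addHaarScalarFactor volume • (volume : Measure (Bits n → ℂ)) :=
    Measure.isAddLeftInvariant_eq_smul ν volume
  set k := ν.addHaarScalarFactor (volume : Measure (Bits n → ℂ)) with hk
  have hk0 : k ≠ 0 := by
    intro h0
    rw [h0, zero_smul] at hν
    exact NeZero.ne ν hν
  refine ⟨2 * k * Real.pi ^ Fintype.card (Bits n), ?_, fun α β => ?_⟩
  · simp [hk0, Real.pi_ne_zero]
  have h1 := integral_homogeneous_mul_gaussian (n := n) (fun z => ketMonomial α β z)
    (∑ b, (α b + β b)) (fun r z => ketMonomial_smul α β z r)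
  rw [integral_Ioi_pow_mul_gaussian] at h1
  have h2 : ∫ z : Ket n, ketMonomial α β z * (Real.exp (-‖z‖ ^ 2) : ℂ) =
      ∫ z, ketMonomial α β z * (Real.exp (-∑ b, ‖z b‖ ^ 2) : ℂ) ∂ν := by
    refine Eq.trans ?_ (integral_map_equiv T.toHomeomorph.toMeasurableEquiv _).symm
    refine integral_congr_ae (Eventually.of_forall fun z => ?_)
    simp only [EuclideanSpace.norm_sq_eq]
    rfl
  rw [h2, hν, integral_smul_nnreal_measure, integral_ketMonomial_pi] at h1
  push_cast at h1 ⊢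
  have h3 : ∀ x y : ℂ, x * (y / 2) * 2 = x * y := fun x y => by ring
  rw [← h3, ← h1, NNReal.smul_def]
  split_ifs <;> simp
  ring

theorem integral_ketMonomial_haarState {n : ℕ} (α β : Bits n → ℕ) :
    ∫ ψ : PureState n, ketMonomial α β ψ.1 ∂(haarState n) =
      if α = β then (∏ b, (α b)! : ℂ) / ((2 ^ n).ascFactorial (∑ b, α b) : ℕ) else 0 := by
  obtain ⟨c, hc, h⟩ := exists_integral_ketMonomial_toSphere n
  have hG : ∀ k : ℕ, (Real.Gamma ((k + 1) / 2) : ℂ) ≠ 0 := by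
    intro k
    exact_mod_cast (Real.Gamma_pos_of_pos (by positivity : (0 : ℝ) < (k + 1) / 2)).ne'
  rw [haarState, integral_smul_measure]
  have h0 := h 0 0
  have hαβ := h α β
  have hd : Module.finrank ℝ (Ket n) = 2 * 2 ^ n := by
    rw [← Module.finrank_mul_finrank ℝ ℂ (Ket n)]
    simp
  have hpos : 0 < 2 ^ n := by positivity
  -- The real dimension is 2 * 2 ^ n and the total degree is even, so the argument of Gamma is the
  -- integer 2 ^ n + t.
  have hGam : ∀ t : ℕ, Real.Gamma (((2 * 2 ^ n - 1 + (t + t) : ℕ) + 1) / 2) =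
      (2 ^ n - 1 + t)! := by
    intro t
    rw [← Real.Gamma_nat_eq_factorial]
    congr 1
    rw [show 2 * 2 ^ n - 1 + (t + t) = 2 * (2 ^ n - 1 + t) + 1 by omega]
    push_cast
    ring
  simp only [ketMonomial, Pi.zero_apply, pow_zero, mul_one, Finset.prod_const_one, add_zero,
    Finset.sum_const_zero, if_true, Nat.factorial_zero, Nat.cast_one] at h0
  rw [integral_const, Complex.real_smul, mul_one] at h0
  have hm : (volume : Measure (Ket n)).toSphere.real Set.univ =
      ((volume : Measure (Ket n)).toSphere Set.univ).toReal := rfl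
  rw [ENNReal.toReal_inv, ← hm, Complex.real_smul]
  set m := (volume : Measure (Ket n)).toSphere.real Set.univ
  have hg0 := hGam 0
  simp only [add_zero] at hg0
  rw [hd, hg0] at h0
  rw [hd] at hαβ
  split_ifs with hab
  · subst hab
    rw [if_pos rfl, Finset.sum_add_distrib, hGam] at hαβ
    set I := ∫ ψ : PureState n, ketMonomial α α ψ.1 ∂(volume : Measure (Ket n)).toSphere
    set t := ∑ b, α b
    have hasc : (2 ^ n - 1 + t)! = (2 ^ n - 1)! * (2 ^ n).ascFactorial t := by
      have := Nat.factorial_mul_ascFactorial (2 ^ n - 1) t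
      rw [show 2 ^ n - 1 + 1 = 2 ^ n by omega] at this
      exact this.symm
    rw [hasc] at hαβ
    have hA : ((2 ^ n).ascFactorial t : ℂ) ≠ 0 := by
      intro h'
      rw [Nat.cast_eq_zero] at h'
      rw [h', mul_zero] at hasc
      exact Nat.factorial_ne_zero _ hasc
    have hF : ((2 ^ n - 1)! : ℂ) ≠ 0 := by exact_mod_cast Nat.factorial_ne_zero _
    have hm0 : (m : ℂ) ≠ 0 := by
      intro h'
      rw [h', zero_mul] at h0
      exact hc h0.symm
    push_cast at h0 hαβ ⊢
    rw [inv_mul_eq_div, div_eq_div_iff hm0 hA]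
    apply mul_right_cancel₀ hF
    linear_combination hαβ - (∏ b, ((α b)! : ℂ)) * h0
  · rw [if_neg hab, mul_zero] at hαβ
    rcases mul_eq_zero.mp hαβ with h' | h'
    · rw [h', mul_zero]
    · exact absurd h' (hG _)

end Moments

section Bombieri

/-! ## An inequality of Bombieri type for products of multihomogeneous polynomials -/

open scoped ComplexConjugate

/-- Coefficients of the expansion of `z ^ a * conj z ^ b` in complex Hermite polynomials. -/
def chaosCoeff (x y a b : ℕ) : ℝ :=
  if x ≤ a ∧ y ≤ b ∧ a - x = b - y then
    a.factorial * b.factorial / ((a - x).factorial * √(x.factorial * y.factorial)) else 0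

theorem chaosCoeff_self (a b : ℕ) : chaosCoeff a b a b = √(a.factorial * b.factorial) := by
  have h : (0 : ℝ) < a.factorial * b.factorial := by positivity
  rw [chaosCoeff, if_pos (by simp), Nat.sub_self, Nat.factorial_zero, Nat.cast_one, one_mul,
    div_eq_iff (Real.sqrt_pos.mpr h).ne', Real.mul_self_sqrt h.le]

/-- For given x both coefficients are nonzero for at most one y, namely y = b' + x - a. There the
two square roots multiply to an integer and the rest regroups into binomial coefficients. -/
theorem sum_chaosCoeff_mul_right {B a b a' b' : ℕ} (hB : b' < B) (h : a + b = a' + b') (x : ℕ) :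
    ∑ y ∈ Finset.range B, chaosCoeff x y a b' * chaosCoeff x y a' b =
      if x ≤ a' then
        (a'.factorial * b'.factorial * (a.choose x * b.choose (a' - x)) : ℝ) else 0 := by
  by_cases hx : x ≤ a ∧ x ≤ a' ∧ a ≤ b' + x
  · obtain ⟨h1, h2, h3⟩ := hx
    rw [if_pos h2, Finset.sum_eq_single (b' + x - a)]
    · rw [chaosCoeff, chaosCoeff, if_pos (by omega), if_pos (by omega)]
      have e1 : b' + x - a = b - (a' - x) := by omega
      rw [Nat.cast_choose ℝ h1, Nat.cast_choose ℝ (show a' - x ≤ b by omega), ← e1]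
      have hs : √((x.factorial : ℝ) * (b' + x - a).factorial) *
          √((x.factorial : ℝ) * (b' + x - a).factorial) = x.factorial * (b' + x - a).factorial :=
        Real.mul_self_sqrt (by positivity)
      have hs0 : √((x.factorial : ℝ) * (b' + x - a).factorial) ≠ 0 :=
        (Real.sqrt_pos.mpr (by positivity)).ne'
      rw [div_mul_div_comm, div_mul_div_comm, mul_mul_mul_comm ((a - x).factorial : ℝ), hs,
        ← mul_div_assoc]
      congr 1 <;> ring
    · intro y _ hy
      rw [chaosCoeff, if_neg (by omega), zero_mul]
    · intro hy
      exact absurd (Finset.mem_range.mpr (by omega)) hy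
  · rw [Finset.sum_eq_zero]
    · split_ifs with h2
      · by_cases h1 : x ≤ a
        · rw [Nat.choose_eq_zero_of_lt (show b < a' - x by omega)]
          simp
        · rw [Nat.choose_eq_zero_of_lt (show a < x by omega)]
          simp
      · rfl
    · intro y _
      by_cases h1 : x ≤ a ∧ y ≤ b' ∧ a - x = b' - y
      · rw [show chaosCoeff x y a' b = 0 from if_neg (by omega), mul_zero]
      · rw [chaosCoeff, if_neg h1, zero_mul]

/-- Parseval's identity in one complex Gaussian variable: the inner product of z^a conj(z)^b' and
z^a' conj(z)^b is the moment of z^(a+b) conj(z)^(a'+b'). Combinatorially it is Vandermonde's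
identity. -/
theorem sum_chaosCoeff_mul {B a b a' b' : ℕ} (ha' : a' < B) (hb' : b' < B) :
    ∑ xy ∈ Finset.range B ×ˢ Finset.range B,
      chaosCoeff xy.1 xy.2 a b' * chaosCoeff xy.1 xy.2 a' b =
      if a + b = a' + b' then ((a + b).factorial : ℝ) else 0 := by
  split_ifs with h
  · rw [Finset.sum_product]
    simp_rw [sum_chaosCoeff_mul_right hb' h]
    rw [← Finset.sum_filter, ← Finset.mul_sum]
    have e : (Finset.range B).filter (· ≤ a') = Finset.range a'.succ := by
      ext x
      simp only [Finset.mem_filter, Finset.mem_range]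
      omega
    rw [e]
    have h1 := Nat.add_choose_eq a b a'
    rw [Finset.Nat.sum_antidiagonal_eq_sum_range_succ (fun i j => a.choose i * b.choose j)] at h1
    have h2 : ∑ x ∈ Finset.range a'.succ, (a.choose x * b.choose (a' - x) : ℝ) =
        (a + b).choose a' := by
      rw [h1]
      push_cast
      rfl
    rw [h2, h]
    have h3 := Nat.choose_mul_factorial_mul_factorial (Nat.le_add_right a' b')
    rw [Nat.add_sub_cancel_left] at h3
    rw [← h3]
    push_cast
    ring
  · refine Finset.sum_eq_zero fun xy _ => ?_
    by_cases h1 : xy.1 ≤ a ∧ xy.2 ≤ b' ∧ a - xy.1 = b' - xy.2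
    · rw [show chaosCoeff xy.1 xy.2 a' b = 0 from if_neg (by omega), mul_zero]
    · rw [chaosCoeff, if_neg h1, zero_mul]

variable {V : Type*} [Fintype V] [DecidableEq V]

theorem sum_prod_chaosCoeff_mul {B : ℕ} (α β α' β' : V →₀ ℕ) (hα' : ∀ v, α' v < B)
    (hβ' : ∀ v, β' v < B) :
    ∑ ξ ∈ Fintype.piFinset fun _ : V => Finset.range B ×ˢ Finset.range B,
      (∏ v, chaosCoeff (ξ v).1 (ξ v).2 (α v) (β' v)) *
        (∏ v, chaosCoeff (ξ v).1 (ξ v).2 (α' v) (β v)) =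
      if α + β = α' + β' then (∏ v, ((α + β) v).factorial : ℝ) else 0 := by
  simp_rw [← Finset.prod_mul_distrib]
  rw [← Finset.prod_univ_sum (fun _ : V => Finset.range B ×ˢ Finset.range B)
    (fun v xy => chaosCoeff xy.1 xy.2 (α v) (β' v) * chaosCoeff xy.1 xy.2 (α' v) (β v))]
  simp_rw [sum_chaosCoeff_mul (hα' _) (hβ' _)]
  split_ifs with h
  · refine Finset.prod_congr rfl fun v _ => ?_
    rw [if_pos (by simpa using DFunLike.congr_fun h v)]
    rfl
  · obtain ⟨v, hv⟩ := DFunLike.ne_iff.mp h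
    exact Finset.prod_eq_zero (Finset.mem_univ v) (if_neg (by simpa using hv))

/-- The squared Fock norm of a product of two polynomials whose exponents form antichains is at
least the product of the squared Fock norms. -/
theorem fockNorm_mul_le (A B : Finset (V →₀ ℕ)) (p q : (V →₀ ℕ) → ℂ)
    (hA : ∀ α ∈ A, ∀ α' ∈ A, α ≤ α' → α = α') (hB : ∀ β ∈ B, ∀ β' ∈ B, β ≤ β' → β = β') :
    (∑ α ∈ A, ‖p α‖ ^ 2 * ∏ v, ((α v).factorial : ℝ)) *
      (∑ β ∈ B, ‖q β‖ ^ 2 * ∏ v, ((β v).factorial : ℝ)) ≤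
    (∑ α ∈ A, ∑ β ∈ B, ∑ α' ∈ A, ∑ β' ∈ B, p α * q β * conj (p α' * q β') *
      if α + β = α' + β' then (∏ v, (((α + β) v).factorial : ℂ)) else 0).re := by
  obtain ⟨N, hN⟩ : ∃ N : ℕ, ∀ α ∈ A ∪ B, ∀ v, α v < N := by
    refine ⟨(A ∪ B).sup (fun α => Finset.univ.sup fun v => α v) + 1, fun α hα v => ?_⟩
    exact Nat.lt_succ_of_le ((Finset.le_sup (f := fun v => α v) (Finset.mem_univ v)).trans
      (Finset.le_sup (f := fun α : V →₀ ℕ => Finset.univ.sup fun v => α v) hα))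
  set Ξ := Fintype.piFinset fun _ : V => Finset.range N ×ˢ Finset.range N with hΞ
  set Φ : (V → ℕ × ℕ) → (V →₀ ℕ) → (V →₀ ℕ) → ℝ :=
    fun ξ α β => ∏ v, chaosCoeff (ξ v).1 (ξ v).2 (α v) (β v) with hΦ
  -- `W ξ` is the Hermite coefficient of p · conj q at ξ. Since |p q| = |p conj q| pointwise, the
  -- Fock norm of p q is the sum of the ‖W ξ‖²; this is `key`.
  set W : (V → ℕ × ℕ) → ℂ := fun ξ => ∑ α ∈ A, ∑ β ∈ B, p α * conj (q β) * Φ ξ α β with hW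
  have key : (∑ α ∈ A, ∑ β ∈ B, ∑ α' ∈ A, ∑ β' ∈ B, p α * q β * conj (p α' * q β') *
      if α + β = α' + β' then (∏ v, (((α + β) v).factorial : ℂ)) else 0) =
      ((∑ ξ ∈ Ξ, ‖W ξ‖ ^ 2 : ℝ) : ℂ) := by
    have h1 : ∀ ξ, ((‖W ξ‖ ^ 2 : ℝ) : ℂ) = ∑ α ∈ A, ∑ β ∈ B, ∑ α' ∈ A, ∑ β' ∈ B,
        p α * q β * conj (p α' * q β') * ((Φ ξ α β' * Φ ξ α' β : ℝ) : ℂ) := by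
      intro ξ
      have h2 : W ξ * conj (W ξ) = ((‖W ξ‖ ^ 2 : ℝ) : ℂ) := by
        rw [Complex.mul_conj, Complex.normSq_eq_norm_sq]
      rw [← h2, hW]
      simp only [map_sum, map_mul, Complex.conj_conj, Complex.conj_ofReal, Finset.sum_mul_sum]
      refine Finset.sum_congr rfl fun α _ => ?_
      conv_rhs => rw [Finset.sum_comm]
      refine Finset.sum_congr rfl fun α' _ => ?_
      rw [Finset.sum_comm]
      refine Finset.sum_congr rfl fun β _ => Finset.sum_congr rfl fun β' _ => ?_
      push_cast
      ring
    rw [Complex.ofReal_sum]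
    simp_rw [h1]
    conv_rhs => rw [Finset.sum_comm]
    refine Finset.sum_congr rfl fun α hα => ?_
    conv_rhs => rw [Finset.sum_comm]
    refine Finset.sum_congr rfl fun β hβ => ?_
    conv_rhs => rw [Finset.sum_comm]
    refine Finset.sum_congr rfl fun α' hα' => ?_
    conv_rhs => rw [Finset.sum_comm]
    refine Finset.sum_congr rfl fun β' hβ' => ?_
    rw [← Finset.mul_sum, ← Complex.ofReal_sum, hΦ,
      sum_prod_chaosCoeff_mul α β α' β' (hN _ (Finset.mem_union_left _ hα'))
        (hN _ (Finset.mem_union_right _ hβ'))]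
    split_ifs <;> simp
  rw [key, Complex.ofReal_re, Finset.sum_mul_sum, ← Finset.sum_product']
  -- At ξ = (x, y) with x ∈ A and y ∈ B, a term (α, β) contributes only if x ≤ α and y ≤ β, and the
  -- antichain property leaves (x, y) alone. Discarding all other ξ gives the inequality.
  have hpair : ∀ x ∈ A ×ˢ B, ‖p x.1‖ ^ 2 * (∏ v, ((x.1 v).factorial : ℝ)) *
      (‖q x.2‖ ^ 2 * ∏ v, ((x.2 v).factorial : ℝ)) = ‖W (fun v => (x.1 v, x.2 v))‖ ^ 2 := by
    rintro ⟨x, y⟩ hxy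
    obtain ⟨hx, hy⟩ := Finset.mem_product.mp hxy
    have hzero : ∀ α ∈ A, ∀ β ∈ B, ¬ (α = x ∧ β = y) →
        Φ (fun v => (x v, y v)) α β = 0 := by
      intro α hα β hβ hne
      by_contra h0
      rw [hΦ, ← Ne, Finset.prod_ne_zero_iff] at h0
      have hle : ∀ v, x v ≤ α v ∧ y v ≤ β v := by
        intro v
        have := h0 v (Finset.mem_univ v)
        rw [chaosCoeff] at this
        by_contra hcon
        exact this (if_neg fun h => hcon ⟨h.1, h.2.1⟩)
      exact hne ⟨(hA x hx α hα fun v => (hle v).1).symm, (hB y hy β hβ fun v => (hle v).2).symm⟩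
    have hself : Φ (fun v => (x v, y v)) x y =
        ∏ v, √((x v).factorial * (y v).factorial) := by
      simp only [hΦ, chaosCoeff_self]
    have hWxy : W (fun v => (x v, y v)) = p x * conj (q y) * Φ (fun v => (x v, y v)) x y := by
      rw [hW]
      simp only
      rw [Finset.sum_eq_single_of_mem x hx, Finset.sum_eq_single_of_mem y hy]
      · intro β hβ hne
        rw [hzero x hx β hβ fun h => hne h.2, Complex.ofReal_zero, mul_zero]
      · intro α hα hne
        refine Finset.sum_eq_zero fun β hβ => ?_
        rw [hzero α hα β hβ fun h => hne h.1, Complex.ofReal_zero, mul_zero]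
    simp only
    rw [hWxy, hself, norm_mul, norm_mul, RCLike.norm_conj, Complex.norm_real, mul_pow, mul_pow,
      Real.norm_eq_abs, sq_abs, ← Finset.prod_pow]
    have : ∀ v, √(((x v).factorial : ℝ) * (y v).factorial) ^ 2 =
        (x v).factorial * (y v).factorial := fun v => Real.sq_sqrt (by positivity)
    simp_rw [this, Finset.prod_mul_distrib]
    ring
  rw [Finset.sum_congr rfl hpair,
    ← Finset.sum_image (s := A ×ˢ B) (g := fun (x : (V →₀ ℕ) × (V →₀ ℕ)) (v : V) => (x.1 v, x.2 v))
      (f := fun ξ => ‖W ξ‖ ^ 2)]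
  · refine Finset.sum_le_sum_of_subset_of_nonneg ?_ fun _ _ _ => by positivity
    intro ξ hξ
    obtain ⟨⟨x, y⟩, hxy, rfl⟩ := Finset.mem_image.mp hξ
    obtain ⟨hx, hy⟩ := Finset.mem_product.mp hxy
    rw [hΞ, Fintype.mem_piFinset]
    intro v
    simp only [Finset.mem_product, Finset.mem_range]
    exact ⟨hN x (Finset.mem_union_left _ hx) v, hN y (Finset.mem_union_right _ hy) v⟩
  · rintro ⟨x, y⟩ - ⟨x', y'⟩ - h
    simp only [Prod.mk.injEq]
    exact ⟨Finsupp.ext fun v => congrArg Prod.fst (congrFun h v),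
      Finsupp.ext fun v => congrArg Prod.snd (congrFun h v)⟩

end Bombieri

/-! ## Independent Haar random states and multihomogeneous polynomials in their amplitudes -/

section Tables

open scoped ComplexConjugate

variable (X : ℕ → Type) [∀ l, Fintype (X l)] [∀ l, DecidableEq (X l)] (n : ℕ → ℕ) (N : ℕ)

/-- The keys of length at most `N`. -/
abbrev Row : Type := Σ l : Fin (N + 1), Bits l

/-- The pairs of a key of length at most `N` and an input. -/
abbrev Coord : Type := Σ r : Row N, X r.1

/-- The amplitudes of the states with keys of length at most `N`. -/
abbrev Amplitude : Type := Σ c : Coord X N, Bits (n c.1.1)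

/-- States for all keys of length at most `N` and all inputs. -/
abbrev Table : Type := (r : Row N) → X r.1 → PureState (n r.1)

/-- Independent Haar random states. -/
def tableMeasure : Measure (Table X n N) :=
  Measure.pi fun r => Measure.pi fun _ : X r.1 => haarState (n r.1)

instance instIsProbabilityMeasureTableMeasure : IsProbabilityMeasure (tableMeasure X n N) := by
  unfold tableMeasure
  infer_instance

variable {X n N}

/-- The amplitudes of the states of a table. -/
def amplitudes (y : Table X n N) (v : Amplitude X n N) : ℂ := (y v.1.1 v.1.2).1 v.2

theorem continuous_amplitudes : Continuous (amplitudes : Table X n N → Amplitude X n N → ℂ) := by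
  unfold amplitudes
  fun_prop

theorem Continuous.integrable_of_compactSpace {Y E : Type*} [TopologicalSpace Y] [CompactSpace Y]
    [T2Space Y] [MeasurableSpace Y] [OpensMeasurableSpace Y] [NormedAddCommGroup E]
    [SecondCountableTopologyEither Y E] {μ : Measure Y} [IsFiniteMeasure μ] {f : Y → E}
    (hf : Continuous f) : Integrable f μ :=
  integrableOn_univ.mp (hf.continuousOn.integrableOn_compact isCompact_univ)

theorem continuous_ketMonomial {ι : Type*} [Fintype ι] (α β : ι → ℕ) :
    Continuous (ketMonomial α β) := by
  unfold ketMonomial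
  fun_prop

/-- The product of rising factorials that normalizes the moments of multidegree `d`. -/
def risingProd (n : ℕ → ℕ) (d : Coord X N → ℕ) : ℕ :=
  ∏ c : Coord X N, (2 ^ n c.1.1).ascFactorial (d c)

theorem integral_ketMonomial_tableMeasure (α β : Amplitude X n N → ℕ) :
    ∫ y, ketMonomial α β (amplitudes y) ∂(tableMeasure X n N) =
      if α = β then (∏ v, ((α v).factorial : ℂ)) / (risingProd n fun c => ∑ b, α ⟨c, b⟩ : ℕ)
      else 0 := by
  have h1 : ∀ y : Table X n N, ketMonomial α β (amplitudes y) =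
      ∏ r, ∏ x, ketMonomial (fun b => α ⟨⟨r, x⟩, b⟩) (fun b => β ⟨⟨r, x⟩, b⟩) (y r x).1 := by
    intro y
    simp only [ketMonomial, amplitudes, Fintype.prod_sigma]
  simp_rw [h1]
  rw [tableMeasure, integral_fintype_prod_eq_prod
    (fun (r : Row N) (χ : X r.1 → PureState (n r.1)) =>
      ∏ x, ketMonomial (fun b => α ⟨⟨r, x⟩, b⟩) (fun b => β ⟨⟨r, x⟩, b⟩) (χ x).1)]
  have h2 : ∀ r : Row N, ∫ χ : X r.1 → PureState (n r.1),
      (∏ x, ketMonomial (fun b => α ⟨⟨r, x⟩, b⟩) (fun b => β ⟨⟨r, x⟩, b⟩) (χ x).1)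
        ∂(Measure.pi fun _ => haarState (n r.1)) =
      ∏ x, ∫ ψ : PureState (n r.1),
        ketMonomial (fun b => α ⟨⟨r, x⟩, b⟩) (fun b => β ⟨⟨r, x⟩, b⟩) ψ.1 ∂(haarState (n r.1)) :=
    fun r => integral_fintype_prod_eq_prod (fun (x : X r.1) (ψ : PureState (n r.1)) =>
      ketMonomial (fun b => α ⟨⟨r, x⟩, b⟩) (fun b => β ⟨⟨r, x⟩, b⟩) ψ.1)
  simp_rw [h2, integral_ketMonomial_haarState]
  split_ifs with h
  · subst h
    simp only [if_true, risingProd, Fintype.prod_sigma, Finset.prod_div_distrib, Nat.cast_prod]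
  · obtain ⟨⟨⟨r, x⟩, b⟩, hv⟩ := Function.ne_iff.mp h
    refine Finset.prod_eq_zero (Finset.mem_univ r) (Finset.prod_eq_zero (Finset.mem_univ x) ?_)
    exact if_neg fun h' => hv (congrFun h' b)

/-- The multidegree of a variable. -/
def ampWeight (v : Amplitude X n N) : Coord X N → ℕ := Pi.single v.1 1

theorem weight_ampWeight (α : Amplitude X n N →₀ ℕ) (c : Coord X N) :
    Finsupp.weight ampWeight α c = ∑ b, α ⟨c, b⟩ := by
  rw [Finsupp.weight_apply, Finsupp.sum_fintype _ _ (by simp), Fintype.sum_sigma, Finset.sum_apply]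
  simp only [Finset.sum_apply, Pi.smul_apply, ampWeight, smul_eq_mul]
  rw [Finset.sum_eq_single_of_mem c (Finset.mem_univ c)]
  · simp
  · intro c' _ hc
    simp [Pi.single_eq_of_ne hc.symm]

/-- This is where multihomogeneity matters: it makes the exponents of a polynomial an antichain, as
`fockNorm_mul_le` requires. -/
theorem eq_of_le_of_weight_eq {α α' : Amplitude X n N →₀ ℕ} (h : α ≤ α')
    (hw : Finsupp.weight ampWeight α = Finsupp.weight ampWeight α') : α = α' := by
  ext ⟨c, b⟩
  have h1 := congrFun hw c
  rw [weight_ampWeight, weight_ampWeight] at h1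
  exact (Finset.sum_eq_sum_iff_of_le fun b _ => h ⟨c, b⟩).mp h1 b (Finset.mem_univ b)

theorem integral_ketMonomial_of_weight {d : Coord X N → ℕ} {α : Amplitude X n N →₀ ℕ}
    (hα : Finsupp.weight ampWeight α = d) (β : Amplitude X n N →₀ ℕ) :
    ∫ y, ketMonomial α β (amplitudes y) ∂(tableMeasure X n N) =
      (if α = β then (∏ v, ((α v).factorial : ℂ)) else 0) / (risingProd n d : ℕ) := by
  have : d = fun c => ∑ b, α ⟨c, b⟩ := by
    ext c
    rw [← hα, weight_ampWeight]
  rw [integral_ketMonomial_tableMeasure, this]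
  simp only [DFunLike.coe_fn_eq]
  split_ifs <;> simp

open MvPolynomial

/-- The squared modulus of the value of a polynomial at the amplitudes. -/
def sqEval (P : MvPolynomial (Amplitude X n N) ℂ) (y : Table X n N) : ℝ :=
  ‖eval (amplitudes y) P‖ ^ 2

theorem continuous_sqEval (P : MvPolynomial (Amplitude X n N) ℂ) : Continuous (sqEval P) := by
  unfold sqEval
  have := (MvPolynomial.continuous_eval P).comp (continuous_amplitudes (X := X) (n := n) (N := N))
  exact (this.norm).pow 2

theorem ketMonomial_add {ι : Type*} [Fintype ι] (α β α' β' : ι → ℕ) (z : ι → ℂ) :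
    ketMonomial (α + α') (β + β') z = ketMonomial α β z * ketMonomial α' β' z := by
  simp only [ketMonomial, ← Finset.prod_mul_distrib, Pi.add_apply, pow_add]
  exact Finset.prod_congr rfl fun _ _ => by ring

theorem sqEval_eq_sum (P : MvPolynomial (Amplitude X n N) ℂ) (y : Table X n N) :
    (sqEval P y : ℂ) = ∑ α ∈ P.support, ∑ α' ∈ P.support,
      P.coeff α * conj (P.coeff α') * ketMonomial α α' (amplitudes y) := by
  have h : eval (amplitudes y) P * conj (eval (amplitudes y) P) = (sqEval P y : ℂ) := by
    rw [Complex.mul_conj, Complex.normSq_eq_norm_sq, sqEval]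
  rw [← h, eval_eq', map_sum, Finset.sum_mul_sum]
  refine Finset.sum_congr rfl fun α _ => Finset.sum_congr rfl fun α' _ => ?_
  simp only [map_mul, map_prod, map_pow, ketMonomial, Finset.prod_mul_distrib]
  ring

theorem integrable_const_mul_ketMonomial (k : ℂ) (α β : Amplitude X n N → ℕ) :
    Integrable (fun y => k * ketMonomial α β (amplitudes y)) (tableMeasure X n N) :=
  Continuous.integrable_of_compactSpace
    (continuous_const.mul ((continuous_ketMonomial α β).comp continuous_amplitudes))

/-- Distinct monomials are orthogonal under the Haar measures, and by multihomogeneity all of them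
have the same normalization. -/
theorem integral_sqEval {P : MvPolynomial (Amplitude X n N) ℂ} {d : Coord X N → ℕ}
    (hP : IsWeightedHomogeneous ampWeight P d) :
    ∫ y, sqEval P y ∂(tableMeasure X n N) =
      (∑ α ∈ P.support, ‖P.coeff α‖ ^ 2 * ∏ v, ((α v).factorial : ℝ)) / risingProd n d := by
  apply Complex.ofReal_injective
  rw [← integral_complex_ofReal]
  simp_rw [sqEval_eq_sum]
  rw [integral_finsetSum _ fun α _ => integrable_finsetSum _ fun α' _ =>
    integrable_const_mul_ketMonomial _ _ _]
  push_cast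
  rw [Finset.sum_div]
  refine Finset.sum_congr rfl fun α hα => ?_
  rw [integral_finsetSum _ fun α' _ => integrable_const_mul_ketMonomial _ _ _,
    Finset.sum_eq_single_of_mem α hα]
  · rw [integral_const_mul, integral_ketMonomial_of_weight (hP (mem_support_iff.mp hα)),
      if_pos rfl, Complex.mul_conj, Complex.normSq_eq_norm_sq]
    push_cast
    ring
  · intro α' _ hne
    rw [integral_const_mul, integral_ketMonomial_of_weight (hP (mem_support_iff.mp hα)),
      if_neg hne.symm, zero_div, mul_zero]

theorem integral_sqEval_mul {P Q : MvPolynomial (Amplitude X n N) ℂ} {d e : Coord X N → ℕ}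
    (hP : IsWeightedHomogeneous ampWeight P d) (hQ : IsWeightedHomogeneous ampWeight Q e) :
    (∫ y, sqEval P y * sqEval Q y ∂(tableMeasure X n N) : ℝ) =
      (∑ α ∈ P.support, ∑ β ∈ Q.support, ∑ α' ∈ P.support, ∑ β' ∈ Q.support,
        P.coeff α * Q.coeff β * conj (P.coeff α' * Q.coeff β') *
        if α + β = α' + β' then (∏ v, (((α + β) v).factorial : ℂ)) else 0) /
        (risingProd n (d + e) : ℕ) := by
  rw [← integral_complex_ofReal]
  have h1 : ∀ y : Table X n N, ((sqEval P y * sqEval Q y : ℝ) : ℂ) =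
      ∑ α ∈ P.support, ∑ β ∈ Q.support, ∑ α' ∈ P.support, ∑ β' ∈ Q.support,
        (P.coeff α * Q.coeff β * conj (P.coeff α' * Q.coeff β')) *
          ketMonomial ((α + β : Amplitude X n N →₀ ℕ) : Amplitude X n N → ℕ)
            (α' + β' : Amplitude X n N →₀ ℕ) (amplitudes y) := by
    intro y
    rw [Complex.ofReal_mul, sqEval_eq_sum, sqEval_eq_sum]
    simp only [Finset.sum_mul_sum]
    refine Finset.sum_congr rfl fun α _ => Finset.sum_congr rfl fun β _ =>
      Finset.sum_congr rfl fun α' _ => Finset.sum_congr rfl fun β' _ => ?_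
    rw [Finsupp.coe_add, Finsupp.coe_add, ketMonomial_add, map_mul]
    ring
  simp_rw [h1]
  have hi := fun (α β α' β' : Amplitude X n N →₀ ℕ) => integrable_const_mul_ketMonomial
    (P.coeff α * Q.coeff β * conj (P.coeff α' * Q.coeff β'))
    ((α + β : Amplitude X n N →₀ ℕ) : Amplitude X n N → ℕ) (α' + β' : Amplitude X n N →₀ ℕ)
  rw [integral_finsetSum _ fun α _ => integrable_finsetSum _ fun β _ => integrable_finsetSum _
    fun α' _ => integrable_finsetSum _ fun β' _ => hi α β α' β', Finset.sum_div]
  refine Finset.sum_congr rfl fun α hα => ?_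
  rw [integral_finsetSum _ fun β _ => integrable_finsetSum _ fun α' _ => integrable_finsetSum _
    fun β' _ => hi α β α' β', Finset.sum_div]
  refine Finset.sum_congr rfl fun β hβ => ?_
  rw [integral_finsetSum _ fun α' _ => integrable_finsetSum _ fun β' _ => hi α β α' β',
    Finset.sum_div]
  refine Finset.sum_congr rfl fun α' _ => ?_
  rw [integral_finsetSum _ fun β' _ => hi α β α' β', Finset.sum_div]
  refine Finset.sum_congr rfl fun β' _ => ?_
  rw [integral_const_mul, integral_ketMonomial_of_weight (d := d + e), mul_div_assoc]
  rw [map_add, hP (mem_support_iff.mp hα), hQ (mem_support_iff.mp hβ)]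

theorem risingProd_pos (d : Coord X N → ℕ) : 0 < risingProd n d :=
  Finset.prod_pos fun c _ => by
    obtain ⟨k, hk⟩ : ∃ k, 2 ^ n c.1.1 = k + 1 := ⟨2 ^ n c.1.1 - 1, by
      have : 0 < 2 ^ n c.1.1 := by positivity
      omega⟩
    rw [hk]
    exact Nat.ascFactorial_pos _ _

/-- Once the rising factorials are cleared, both sides are Fock norms and the claim is
`fockNorm_mul_le`. -/
theorem integral_mul_integral_sqEval_le {P Q : MvPolynomial (Amplitude X n N) ℂ}
    {d e : Coord X N → ℕ} (hP : IsWeightedHomogeneous ampWeight P d)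
    (hQ : IsWeightedHomogeneous ampWeight Q e) :
    risingProd n d * risingProd n e * ((∫ y, sqEval P y ∂(tableMeasure X n N)) *
      ∫ y, sqEval Q y ∂(tableMeasure X n N)) ≤
      risingProd n (d + e) * ∫ y, sqEval P y * sqEval Q y ∂(tableMeasure X n N) := by
  have hd : (risingProd n d : ℝ) ≠ 0 := by exact_mod_cast (risingProd_pos d).ne'
  have he : (risingProd n e : ℝ) ≠ 0 := by exact_mod_cast (risingProd_pos e).ne'
  have hde : (risingProd n (d + e) : ℝ) ≠ 0 := by exact_mod_cast (risingProd_pos (d + e)).ne'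
  have h := fockNorm_mul_le P.support Q.support P.coeff Q.coeff
    (fun α hα α' hα' hle => eq_of_le_of_weight_eq hle
      ((hP (mem_support_iff.mp hα)).trans (hP (mem_support_iff.mp hα')).symm))
    (fun α hα α' hα' hle => eq_of_le_of_weight_eq hle
      ((hQ (mem_support_iff.mp hα)).trans (hQ (mem_support_iff.mp hα')).symm))
  have h2 := congrArg Complex.re (integral_sqEval_mul hP hQ)
  rw [Complex.ofReal_re, ← Complex.ofReal_natCast, Complex.div_ofReal_re] at h2
  rw [h2, integral_sqEval hP, integral_sqEval hQ, mul_div_cancel₀ _ hde]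
  refine le_trans (le_of_eq ?_) h
  field_simp

/-- Factor by factor, D + d + i ≤ (D + i)(1 + d/D) for i < e. -/
theorem ascFactorial_add_le (D d e : ℕ) (hD : 0 < D) :
    ((D.ascFactorial (d + e) : ℕ) : ℝ) ≤
      D.ascFactorial d * D.ascFactorial e * (1 + d / D : ℝ) ^ e := by
  have hD' : (0 : ℝ) < D := by exact_mod_cast hD
  induction e with
  | zero => simp
  | succ e ih =>
    rw [← add_assoc, Nat.ascFactorial_succ, Nat.ascFactorial_succ]
    push_cast
    calc ((D : ℝ) + (d + e)) * (D.ascFactorial (d + e) : ℕ)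
        ≤ ((D + e) * (1 + d / D)) * (D.ascFactorial d * D.ascFactorial e * (1 + d / D : ℝ) ^ e) := by
          gcongr
          have : (0 : ℝ) ≤ e * (d / D) := by positivity
          have h3 : (D : ℝ) * (d / D) = d := by field_simp
          nlinarith
      _ = _ := by ring

/-- If the dimension is at least 2q², each correction 1 + d/D is at most 1 + 1/(2q). At most q such
factors occur, so their product is at most exp(1/2) ≤ 2. Only coordinates with d ≠ 0 need a large
dimension. -/
theorem risingProd_add_le {d e : Coord X N → ℕ} {q : ℕ} (hd : ∑ c, d c ≤ q) (he : ∑ c, e c ≤ q)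
    (hq : ∀ c, d c ≠ 0 → 2 * q ^ 2 ≤ 2 ^ n c.1.1) :
    (risingProd n (d + e) : ℝ) ≤ 2 * (risingProd n d * risingProd n e) := by
  rcases Nat.eq_zero_or_pos q with rfl | hq0
  · have hd0 : d = 0 := by
      ext c
      exact (Finset.sum_eq_zero_iff.mp (Nat.le_zero.mp hd)) c (Finset.mem_univ c)
    subst hd0
    have : (0 : ℝ) ≤ risingProd n e := Nat.cast_nonneg _
    simp only [zero_add, risingProd, Pi.zero_apply, Nat.ascFactorial_zero, Finset.prod_const_one,
      Nat.cast_one, one_mul] at this ⊢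
    linarith
  have hq' : (0 : ℝ) < q := by exact_mod_cast hq0
  have h1 : (risingProd n (d + e) : ℝ) ≤ ∏ c : Coord X N, ((2 ^ n c.1.1).ascFactorial (d c) *
      (2 ^ n c.1.1).ascFactorial (e c) * (1 + 1 / (2 * q) : ℝ) ^ e c) := by
    rw [risingProd, Nat.cast_prod]
    refine Finset.prod_le_prod (fun _ _ => Nat.cast_nonneg _) fun c _ => ?_
    refine (ascFactorial_add_le _ _ _ (by positivity)).trans ?_
    have h2 : ((d c : ℝ) / ((2 ^ n c.1.1 : ℕ) : ℝ)) ≤ 1 / (2 * q) := by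
      by_cases h0 : d c = 0
      · rw [h0]
        simp
      · rw [div_le_div_iff₀ (by positivity) (by positivity)]
        have hdc : d c ≤ q := (Finset.single_le_sum (f := d) (fun _ _ => Nat.zero_le _)
          (Finset.mem_univ c)).trans hd
        have h2 : d c * (2 * q) ≤ 1 * 2 ^ n c.1.1 := by
          have := hq c h0
          nlinarith
        exact_mod_cast h2
    exact mul_le_mul_of_nonneg_left (pow_le_pow_left₀ (by positivity) (by linarith) _)
      (by positivity)
  refine h1.trans ?_
  rw [Finset.prod_mul_distrib, Finset.prod_mul_distrib, Finset.prod_pow_eq_pow_sum, mul_comm]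
  have h3 : (1 + 1 / (2 * q) : ℝ) ^ (∑ c, e c) ≤ 2 := by
    calc (1 + 1 / (2 * q) : ℝ) ^ (∑ c, e c) ≤ (1 + 1 / (2 * q) : ℝ) ^ q :=
          pow_le_pow_right₀ (by simp) he
      _ ≤ Real.exp (1 / (2 * q)) ^ q := by
          gcongr
          rw [add_comm]
          exact Real.add_one_le_exp _
      _ = Real.exp (1 / 2) := by
          rw [← Real.exp_nat_mul]
          congr 1
          field_simp
      _ ≤ 2 := by
          have h4 : Real.exp (1 / 2) * Real.exp (1 / 2) = Real.exp 1 := by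
            rw [← Real.exp_add]
            norm_num
          have h5 := Real.exp_one_lt_d9
          have h6 := Real.exp_pos (1 / 2)
          nlinarith
  rw [risingProd, risingProd]
  push_cast
  gcongr

/-- Multihomogeneous polynomials of low degree in the amplitudes of Haar random states of many
qubits are essentially positively correlated. -/
theorem integral_mul_integral_sqEval_le_two_mul {P Q : MvPolynomial (Amplitude X n N) ℂ}
    {d e : Coord X N → ℕ} {q : ℕ} (hP : IsWeightedHomogeneous ampWeight P d)
    (hQ : IsWeightedHomogeneous ampWeight Q e) (hd : ∑ c, d c ≤ q) (he : ∑ c, e c ≤ q)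
    (hq : ∀ c, d c ≠ 0 → 2 * q ^ 2 ≤ 2 ^ n c.1.1) :
    (∫ y, sqEval P y ∂(tableMeasure X n N)) * (∫ y, sqEval Q y ∂(tableMeasure X n N)) ≤
      2 * ∫ y, sqEval P y * sqEval Q y ∂(tableMeasure X n N) := by
  have hd' : (0 : ℝ) < risingProd n d := by exact_mod_cast risingProd_pos d
  have he' : (0 : ℝ) < risingProd n e := by exact_mod_cast risingProd_pos e
  have h1 := integral_mul_integral_sqEval_le hP hQ
  have h2 := risingProd_add_le hd he hq
  have h3 : 0 ≤ ∫ y, sqEval P y * sqEval Q y ∂(tableMeasure X n N) :=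
    integral_nonneg fun y => mul_nonneg (sq_nonneg _) (sq_nonneg _)
  have h4 := h1.trans (mul_le_mul_of_nonneg_right h2 h3)
  rw [show 2 * ((risingProd n d : ℝ) * risingProd n e) *
    (∫ y, sqEval P y * sqEval Q y ∂(tableMeasure X n N)) = risingProd n d * risingProd n e *
      (2 * ∫ y, sqEval P y * sqEval Q y ∂(tableMeasure X n N)) by ring] at h4
  exact le_of_mul_le_mul_left h4 (by positivity)

end Tables

open scoped ComplexOrder

/-! ## Positive functionals bounded by the trace -/

section Functionals

variable {α β γ : Type} [Fintype α] [Fintype β] [Fintype γ]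

theorem conj_add (K : Matrix β α ℂ) (ρ σ : Matrix α α ℂ) :
    conj K (ρ + σ) = conj K ρ + conj K σ := by
  simp [conj, Matrix.mul_add, Matrix.add_mul]

theorem conj_smul (K : Matrix β α ℂ) (r : ℝ) (ρ : Matrix α α ℂ) :
    conj K (r • ρ) = r • conj K ρ := by
  simp [conj]

theorem conj_zero (K : Matrix β α ℂ) : conj K (0 : Matrix α α ℂ) = 0 := by
  simp [conj]

theorem conj_mul (K : Matrix γ β ℂ) (K' : Matrix β α ℂ) (ρ : Matrix α α ℂ) :
    conj (K * K') ρ = conj K (conj K' ρ) := by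
  simp [conj, Matrix.conjTranspose_mul, Matrix.mul_assoc]

theorem conj_posSemidef (K : Matrix β α ℂ) {ρ : Matrix α α ℂ} (h : ρ.PosSemidef) :
    (conj K ρ).PosSemidef :=
  h.mul_mul_conjTranspose_same K

theorem trace_conj (K : Matrix β α ℂ) (ρ : Matrix α α ℂ) :
    (conj K ρ).trace = (Kᴴ * K * ρ).trace := by
  rw [conj, Matrix.trace_mul_comm, Matrix.mul_assoc]

theorem trace_re_nonneg {ρ : Matrix α α ℂ} (h : ρ.PosSemidef) : 0 ≤ ρ.trace.re :=
  (Complex.nonneg_iff.mp h.trace_nonneg).1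

theorem sum_trace_conj [DecidableEq α] {O : Type} (ops : List (O × Matrix β α ℂ))
    (h : (ops.map fun p => p.2ᴴ * p.2).sum = 1) (ρ : Matrix α α ℂ) :
    (ops.map fun p => (conj p.2 ρ).trace.re).sum = ρ.trace.re := by
  have h1 : ∀ l : List (O × Matrix β α ℂ), (l.map fun p => (conj p.2 ρ).trace.re).sum =
      ((l.map fun p => p.2ᴴ * p.2).sum * ρ).trace.re := by
    intro l
    induction l with
    | nil => simp
    | cons p l ih =>
      rw [List.map_cons, List.sum_cons, ih, List.map_cons, List.sum_cons, Matrix.add_mul,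
        Matrix.trace_add, Complex.add_re, trace_conj]
  rw [h1, h, Matrix.one_mul]

/-- Real linear functionals on matrices that on positive semidefinite matrices are nonnegative and
bounded by the trace. -/
structure SubTrace (f : Matrix α α ℂ → ℝ) : Prop where
  add : ∀ ρ σ, f (ρ + σ) = f ρ + f σ
  smul : ∀ (r : ℝ) ρ, f (r • ρ) = r * f ρ
  nonneg : ∀ ρ, ρ.PosSemidef → 0 ≤ f ρ
  le_trace : ∀ ρ, ρ.PosSemidef → f ρ ≤ ρ.trace.re

theorem SubTrace.sum_ops [DecidableEq α] {O : Type} {ops : List (O × Matrix β α ℂ)}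
    (h : (ops.map fun p => p.2ᴴ * p.2).sum = 1) {f : O → Matrix β β ℂ → ℝ}
    (hf : ∀ i, SubTrace (f i)) :
    SubTrace fun ρ => (ops.map fun p => f p.1 (conj p.2 ρ)).sum where
  add ρ σ := by simp only [conj_add, (hf _).add, List.sum_map_add]
  smul r ρ := by simp only [conj_smul, (hf _).smul, List.sum_map_mul_left]
  nonneg ρ hρ := List.sum_nonneg fun x hx => by
    obtain ⟨p, _, rfl⟩ := List.mem_map.mp hx
    exact (hf _).nonneg _ (conj_posSemidef _ hρ)
  le_trace ρ hρ := by
    rw [← sum_trace_conj ops h ρ]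
    exact List.sum_le_sum fun p _ => (hf _).le_trace _ (conj_posSemidef _ hρ)

theorem SubTrace.comp_conj [DecidableEq α] {f : Matrix β β ℂ → ℝ} (hf : SubTrace f)
    {K : Matrix β α ℂ} (hK : Kᴴ * K = 1) : SubTrace fun ρ => f (conj K ρ) := by
  simpa using SubTrace.sum_ops (O := Unit) (ops := [((), K)]) (by simpa using hK) fun _ => hf

/-- Young's inequality for operators. It is the positivity of `f` on `conj E ρ` for E = √c B - (A -
B)/√c, whose cross terms cancel those of A = B + (A - B). -/
theorem SubTrace.conj_le {f : Matrix β β ℂ → ℝ} (hf : SubTrace f) (A B : Matrix β α ℂ)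
    {ρ : Matrix α α ℂ} (hρ : ρ.PosSemidef) {c : ℝ} (hc : 0 < c) :
    f (conj A ρ) ≤ (1 + c) * f (conj B ρ) + (1 + 1 / c) * f (conj (A - B) ρ) := by
  set E : Matrix β α ℂ := (√c : ℂ) • B - ((√c)⁻¹ : ℂ) • (A - B) with hE
  have hs : (√c : ℂ) ≠ 0 := by exact_mod_cast (Real.sqrt_pos.mpr hc).ne'
  have hss : (√c : ℂ) * √c = c := by exact_mod_cast Real.mul_self_sqrt hc.le
  have hc' : (c : ℂ) ≠ 0 := by exact_mod_cast hc.ne'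
  have hss' : ((√c : ℂ))⁻¹ * (√c : ℂ)⁻¹ = (c : ℂ)⁻¹ := by rw [← mul_inv, hss]
  have key : conj A ρ + conj E ρ = (1 + c) • conj B ρ + (1 + 1 / c) • conj (A - B) ρ := by
    obtain ⟨D, hD⟩ : ∃ D, D = A - B := ⟨_, rfl⟩
    have hA : A = B + D := by rw [hD]; abel
    rw [hE, ← hD, hA]
    simp only [conj, Matrix.conjTranspose_add, Matrix.conjTranspose_sub,
      Matrix.conjTranspose_smul, Matrix.add_mul, Matrix.sub_mul, Matrix.mul_add, Matrix.mul_sub,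
      Matrix.smul_mul, Matrix.mul_smul, smul_sub, smul_smul, add_smul, one_smul]
    have e1 : star (√c : ℂ) = √c := Complex.conj_ofReal _
    have e2 : star ((√c : ℂ)⁻¹) = (√c : ℂ)⁻¹ := by rw [star_inv₀, e1]
    rw [e1, e2, hss, hss', mul_inv_cancel₀ hs, inv_mul_cancel₀ hs, one_smul, one_smul]
    have e3 : ∀ M : Matrix β β ℂ, (c : ℂ) • M = c • M := fun M => Complex.coe_smul c M
    have e4 : ∀ M : Matrix β β ℂ, (c : ℂ)⁻¹ • M = (1 / c) • M := fun M => by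
      rw [one_div, ← Complex.ofReal_inv]
      exact Complex.coe_smul c⁻¹ M
    rw [e3, e4]
    abel
  have h1 := congrArg f key
  rw [hf.add, hf.add, hf.smul, hf.smul] at h1
  have h2 := hf.nonneg _ (conj_posSemidef E hρ)
  linarith

theorem SubTrace.abs_sub_conj_le [DecidableEq α] {f : Matrix β β ℂ → ℝ} (hf : SubTrace f)
    {A B : Matrix β α ℂ} (hA : Aᴴ * A = 1) (hB : Bᴴ * B = 1)
    {ρ : Matrix α α ℂ} (hρ : ρ.PosSemidef) {c : ℝ} (hc : 0 < c) :
    |f (conj A ρ) - f (conj B ρ)| ≤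
      c * ρ.trace.re + (1 + 1 / c) * (conj (A - B) ρ).trace.re := by
  have hneg : conj (B - A) ρ = conj (A - B) ρ := by
    rw [conj, conj, ← neg_sub A B, Matrix.conjTranspose_neg, Matrix.neg_mul, Matrix.neg_mul,
      Matrix.mul_neg, neg_neg]
  have h1 := hf.conj_le A B hρ hc
  have h2 := hf.conj_le B A hρ hc
  rw [hneg] at h2
  have h3 := (hf.comp_conj hA).le_trace ρ hρ
  have h4 := (hf.comp_conj hB).le_trace ρ hρ
  have h5 := hf.le_trace _ (conj_posSemidef (A - B) hρ)
  have h6 : (1 + 1 / c) * f (conj (A - B) ρ) ≤ (1 + 1 / c) * (conj (A - B) ρ).trace.re :=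
    mul_le_mul_of_nonneg_left h5 (by positivity)
  have h7 := mul_le_mul_of_nonneg_left h3 hc.le
  have h8 := mul_le_mul_of_nonneg_left h4 hc.le
  rw [abs_le]
  constructor <;> linarith

theorem pureState_norm_sq {n : ℕ} (ψ : PureState n) : ∑ b, ‖ψ.1 b‖ ^ 2 = 1 := by
  rw [← EuclideanSpace.norm_sq_eq, norm_eq_of_mem_sphere, one_pow]

theorem attach_isometry {n : ℕ} [DecidableEq α] (ψ : PureState n) :
    (attach (α := α) ψ)ᴴ * attach (α := α) ψ = 1 := by
  ext a a'
  rw [Matrix.mul_apply, Fintype.sum_prod_type]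
  simp only [Matrix.conjTranspose_apply, attach]
  rw [Finset.sum_eq_single_of_mem a (Finset.mem_univ a)]
  · by_cases h : a = a'
    · subst h
      rw [Matrix.one_apply_eq]
      simp only [if_true]
      have h1 : ∀ b, star (ψ.1 b) * ψ.1 b = ((‖ψ.1 b‖ ^ 2 : ℝ) : ℂ) := fun b => by
        rw [mul_comm]
        exact (Complex.mul_conj _).trans (by rw [Complex.normSq_eq_norm_sq])
      simp_rw [h1]
      rw [← Complex.ofReal_sum, pureState_norm_sq, Complex.ofReal_one]
    · simp [h, Matrix.one_apply_ne h]
  · intro b _ hb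
    simp [hb]

theorem Instr.withState_complete {O : Type} [DecidableEq α] {n : ℕ}
    (J : Instr (α × Bits n) β O) (ψ : PureState n) :
    ((J.withState ψ).map fun p => p.2ᴴ * p.2).sum = 1 := by
  rw [Instr.withState, List.map_map]
  have h : ∀ l : List (O × Matrix β (α × Bits n) ℂ),
      (l.map fun p => (p.2 * attach (α := α) ψ)ᴴ * (p.2 * attach (α := α) ψ)).sum =
        (attach (α := α) ψ)ᴴ * (l.map fun p => p.2ᴴ * p.2).sum * attach (α := α) ψ := by
    intro l
    induction l with
    | nil => simp
    | cons p l ih =>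
      rw [List.map_cons, List.sum_cons, ih, List.map_cons, List.sum_cons]
      simp only [Matrix.mul_add, Matrix.add_mul, Matrix.conjTranspose_mul, Matrix.mul_assoc]
  change (J.ops.map fun p => (p.2 * attach (α := α) ψ)ᴴ * (p.2 * attach (α := α) ψ)).sum = 1
  rw [h, J.complete, Matrix.mul_one, attach_isometry]

end Functionals

/-! ## Distinguishers -/

section DistLemmas

variable {X : ℕ → Type} [∀ l, Fintype (X l)] [∀ l, DecidableEq (X l)] {n : ℕ → ℕ}

theorem sum_answer (G : Generator X n) (L : ℕ) (l : Fin (L + 1)) (k : Bits l) (x : X l)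
    (h : AnswerReg n L → ℂ → ℝ) (h0 : ∀ a, h a 0 = 0) :
    ∑ a, h a (answer G L (some ⟨l, k, x⟩) a) =
      ∑ y : Bits (n l), h (some ⟨l, y⟩) ((G l k x).1 y) := by
  rw [Fintype.sum_option, Fintype.sum_sigma, Finset.sum_eq_single_of_mem l (Finset.mem_univ l)]
  · simp [answer, h0]
  · intro l' _ hl
    refine Finset.sum_eq_zero fun y' _ => ?_
    simp only [answer]
    rw [Finset.sum_eq_zero, h0]
    intro y _
    refine if_neg fun h' => hl ?_
    simp only [Option.some.injEq, Sigma.mk.injEq] at h'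
    exact h'.1

theorem sum_norm_sq_answer (G : Generator X n) (L : ℕ) (q : QueryReg X L) :
    ∑ a, ‖answer G L q a‖ ^ 2 = 1 := by
  rcases q with _ | ⟨l, k, x⟩
  · simp [answer]
  · rw [sum_answer G L l k x (fun _ z => ‖z‖ ^ 2) (by simp), pureState_norm_sq]

/-- An operator controlled by the query register leaves no interference between different queries in
the trace, so a superposition of queries is as good as a mixture here. -/
theorem trace_conj_of_blockDiagonal {L w : ℕ} (g : QueryReg X L → AnswerReg n L → ℂ)
    (K : Matrix ((QueryReg X L × Fin w) × AnswerReg n L) (QueryReg X L × Fin w) ℂ)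
    (hK : ∀ p q, K p q = if p.1 = q then g q.1 p.2 else 0)
    (σ : Matrix (QueryReg X L × Fin w) (QueryReg X L × Fin w) ℂ) :
    (conj K σ).trace.re = ∑ q, (∑ a, ‖g q.1 a‖ ^ 2) * (σ q q).re := by
  have h1 : ∀ p, conj K σ p p = ((‖g p.1.1 p.2‖ ^ 2 : ℝ) : ℂ) * σ p.1 p.1 := by
    rintro ⟨q, a⟩
    rw [conj, Matrix.mul_apply, Finset.sum_eq_single_of_mem q (Finset.mem_univ q)]
    · rw [Matrix.mul_apply, Finset.sum_eq_single_of_mem q (Finset.mem_univ q)]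
      · simp only [hK, if_true, Matrix.conjTranspose_apply]
        have : ((‖g q.1 a‖ ^ 2 : ℝ) : ℂ) = g q.1 a * star (g q.1 a) := by
          rw [← Complex.normSq_eq_norm_sq]
          exact (Complex.mul_conj _).symm
        rw [this]
        ring
      · intro q' _ hq
        simp [hK, hq.symm]
    · intro q' _ hq
      simp [Matrix.conjTranspose_apply, hK, hq.symm]
  rw [Matrix.trace, Complex.re_sum, Fintype.sum_prod_type]
  refine Finset.sum_congr rfl fun q _ => ?_
  rw [Finset.sum_mul]
  refine Finset.sum_congr rfl fun a _ => ?_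
  rw [Matrix.diag_apply, h1, Complex.re_ofReal_mul]

theorem queryIso_isometry (G : Generator X n) (L w : ℕ) :
    (queryIso G L w)ᴴ * queryIso G L w = 1 := by
  ext q q'
  rw [Matrix.mul_apply, Fintype.sum_prod_type]
  simp only [Matrix.conjTranspose_apply, queryIso]
  rw [Finset.sum_eq_single_of_mem q (Finset.mem_univ q)]
  · by_cases h : q = q'
    · subst h
      rw [Matrix.one_apply_eq]
      simp only [if_true]
      have h1 : ∀ a, star (answer G L q.1 a) * answer G L q.1 a =
          ((‖answer G L q.1 a‖ ^ 2 : ℝ) : ℂ) := fun b => by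
        rw [mul_comm]
        exact (Complex.mul_conj _).trans (by rw [Complex.normSq_eq_norm_sq])
      simp_rw [h1]
      rw [← Complex.ofReal_sum, sum_norm_sq_answer, Complex.ofReal_one]
    · simp [h, Matrix.one_apply_ne h]
  · intro b _ hb
    simp [hb]

theorem Dist.subTrace_prob {s d : ℕ} (G : Generator X n) (χ : X s → PureState (n s))
    (D : Dist X n s d) : SubTrace (D.prob G χ) := by
  induction D with
  | out b =>
    cases b
    · exact ⟨by simp [Dist.prob], by simp [Dist.prob], by simp [Dist.prob],
        fun ρ hρ => by simpa [Dist.prob] using trace_re_nonneg hρ⟩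
    · exact ⟨by simp [Dist.prob], by simp [Dist.prob],
        fun ρ hρ => by simpa [Dist.prob] using trace_re_nonneg hρ, by simp [Dist.prob]⟩
  | step J next ih => exact SubTrace.sum_ops J.complete ih
  | query L w pre post next ih =>
    exact SubTrace.sum_ops pre.complete fun _ =>
      (SubTrace.sum_ops post.complete ih).comp_conj (queryIso_isometry G L w)
  | challenge x J next ih => exact SubTrace.sum_ops (J.withState_complete (χ x)) ih

/-- The generator with the states of the key `k` replaced. -/
def replaceRow (G : Generator X n) (s : ℕ) (k : Bits s) (ψ : X s → PureState (n s)) :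
    Generator X n :=
  Function.update G s (Function.update (G s) k ψ)

/-- A basis query names at most one key, so at most one term is nonzero. That term is the squared
distance of two unit vectors, hence at most 4. -/
theorem sum_norm_sq_answer_sub_le (G : Generator X n) (s : ℕ) (ψ : X s → PureState (n s)) (L : ℕ)
    (q : QueryReg X L) :
    ∑ k, ∑ a, ‖(answer (replaceRow G s k ψ) L q - answer G L q) a‖ ^ 2 ≤ 4 := by
  have hbound : ∀ G' : Generator X n, ∑ a, ‖(answer G' L q - answer G L q) a‖ ^ 2 ≤ 4 := by
    intro G'
    calc ∑ a, ‖(answer G' L q - answer G L q) a‖ ^ 2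
        ≤ ∑ a, (2 * ‖answer G' L q a‖ ^ 2 + 2 * ‖answer G L q a‖ ^ 2) := by
          refine Finset.sum_le_sum fun a _ => ?_
          have h1 := norm_sub_le (answer G' L q a) (answer G L q a)
          have h2 := norm_nonneg (answer G' L q a - answer G L q a)
          rw [Pi.sub_apply]
          nlinarith [sq_nonneg (‖answer G' L q a‖ - ‖answer G L q a‖)]
      _ = 4 := by
          rw [Finset.sum_add_distrib, ← Finset.mul_sum, ← Finset.mul_sum, sum_norm_sq_answer,
            sum_norm_sq_answer]
          norm_num
  rcases q with _ | ⟨l, k', x⟩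
  · simp [answer]
  · by_cases hl : (l : ℕ) = s
    · subst hl
      rw [Finset.sum_eq_single_of_mem k' (Finset.mem_univ k')]
      · exact hbound _
      · intro k _ hk
        have : answer (replaceRow G l k ψ) L (some ⟨l, k', x⟩) = answer G L (some ⟨l, k', x⟩) := by
          funext a
          simp [answer, replaceRow, Function.update_of_ne hk.symm]
        simp [this]
    · refine le_trans (le_of_eq (Finset.sum_eq_zero fun k _ => ?_)) (by norm_num)
      have : answer (replaceRow G s k ψ) L (some ⟨l, k', x⟩) = answer G L (some ⟨l, k', x⟩) := by
        funext a
        simp [answer, replaceRow, Function.update_of_ne hl]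
      simp [this]

theorem sum_trace_conj_queryIso_sub_le (G : Generator X n) (s : ℕ) (ψ : X s → PureState (n s))
    (L w : ℕ) {σ : Matrix (QueryReg X L × Fin w) (QueryReg X L × Fin w) ℂ} (hσ : σ.PosSemidef) :
    ∑ k, (conj (queryIso (replaceRow G s k ψ) L w - queryIso G L w) σ).trace.re ≤
      4 * σ.trace.re := by
  have h2 : ∀ k, (conj (queryIso (replaceRow G s k ψ) L w - queryIso G L w) σ).trace.re =
      ∑ q, (∑ a, ‖(answer (replaceRow G s k ψ) L q.1 - answer G L q.1) a‖ ^ 2) * (σ q q).re :=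
    fun k => trace_conj_of_blockDiagonal
      (fun q => answer (replaceRow G s k ψ) L q - answer G L q) _ (fun p q => by
        by_cases h : p.1 = q <;> simp [queryIso, h]) σ
  simp_rw [h2]
  rw [Finset.sum_comm, Matrix.trace, Complex.re_sum, Finset.mul_sum]
  refine Finset.sum_le_sum fun q _ => ?_
  rw [← Finset.sum_mul]
  exact mul_le_mul_of_nonneg_right (sum_norm_sq_answer_sub_le G s ψ L q.1)
    (Complex.nonneg_iff.mp hσ.diag_nonneg).1

theorem sum_abs_sub_list_sum_le {ι κ : Type} [Fintype κ] (l : List ι) (f : κ → ι → ℝ)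
    (g : ι → ℝ) : ∑ k, |(l.map (f k)).sum - (l.map g).sum| ≤
      (l.map fun p => ∑ k, |f k p - g p|).sum := by
  induction l with
  | nil => simp
  | cons p l ih =>
    simp only [List.map_cons, List.sum_cons]
    refine le_trans ?_ (add_le_add_right ih _)
    rw [← Finset.sum_add_distrib]
    refine Finset.sum_le_sum fun k _ => ?_
    rw [add_sub_add_comm]
    exact abs_add_le _ _

/-- Replacing the states of one of the keys of length `s` is hardly noticed by a distinguisher that
makes few queries, on average over the key. -/
theorem Dist.sum_abs_prob_replaceRow_sub_le {s d M N : ℕ} (D : Dist X n s d) (hD : D.Bounded M N)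
    (G : Generator X n) (χ ψ : X s → PureState (n s)) {c : ℝ} (hc : 0 < c)
    {ρ : Matrix (Fin d) (Fin d) ℂ} (hρ : ρ.PosSemidef) :
    ∑ k, |D.prob (replaceRow G s k ψ) χ ρ - D.prob G χ ρ| ≤
      N * (2 ^ s * c + (1 + 1 / c) * 4) * ρ.trace.re := by
  set κ : ℝ := 2 ^ s * c + (1 + 1 / c) * 4 with hκ
  have hκ0 : 0 ≤ κ := by positivity
  have hsum : ∀ {α β O : Type} [Fintype α] [Fintype β] [DecidableEq α]
      (ops : List (O × Matrix β α ℂ)) (_ : (ops.map fun p => p.2ᴴ * p.2).sum = 1)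
      (τ : Matrix α α ℂ) (a : ℝ) (g : O × Matrix β α ℂ → ℝ)
      (_ : ∀ p ∈ ops, g p ≤ a * (conj p.2 τ).trace.re), (ops.map g).sum ≤ a * τ.trace.re := by
    intro α β O _ _ _ ops hops τ a g hg
    refine (List.sum_le_sum hg).trans (le_of_eq ?_)
    rw [List.sum_map_mul_left, sum_trace_conj ops hops]
  induction D generalizing N with
  | out b =>
    have := mul_nonneg (mul_nonneg (Nat.cast_nonneg N) hκ0) (trace_re_nonneg hρ)
    simpa [Dist.prob] using this
  | step J next ih =>
    simp only [Dist.prob]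
    refine (sum_abs_sub_list_sum_le _ _ _).trans (hsum _ J.complete _ _ _ fun p _ => ?_)
    exact ih p.1 (hD p.1) (conj_posSemidef _ hρ)
  | challenge x J next ih =>
    obtain ⟨N', rfl, hN⟩ := hD
    simp only [Dist.prob]
    refine (sum_abs_sub_list_sum_le _ _ _).trans
      (hsum _ (J.withState_complete (χ x)) _ _ _ fun p _ => ?_)
    refine (ih p.1 (hN p.1) (conj_posSemidef _ hρ)).trans ?_
    have := trace_re_nonneg (conj_posSemidef p.2 hρ)
    gcongr
    simp
  | query L w pre post next ih =>
    obtain ⟨-, N', rfl, hN⟩ := hD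
    simp only [Dist.prob]
    refine (sum_abs_sub_list_sum_le _ _ _).trans (hsum _ pre.complete _ _ _ fun p _ => ?_)
    set σ := conj p.2 ρ with hσdef
    have hσ : σ.PosSemidef := conj_posSemidef _ hρ
    set F : Generator X n → Matrix _ _ ℂ → ℝ := fun G' τ =>
      (post.ops.map fun q => (next q.1).prob G' χ (conj q.2 τ)).sum with hF
    have hFs : ∀ G', SubTrace (F G') := fun G' =>
      SubTrace.sum_ops post.complete fun i => (next i).subTrace_prob G' χ
    -- Hybrid argument: the present query is switched to the old generator at cost `κ`. The
    -- remaining queries are switched by the induction hypothesis in `h2`.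
    have h1 : ∑ k, |F (replaceRow G s k ψ) (conj (queryIso (replaceRow G s k ψ) L w) σ) -
        F (replaceRow G s k ψ) (conj (queryIso G L w) σ)| ≤ κ * σ.trace.re := by
      calc _ ≤ ∑ k : Bits s, (c * σ.trace.re + (1 + 1 / c) *
            (conj (queryIso (replaceRow G s k ψ) L w - queryIso G L w) σ).trace.re) :=
            Finset.sum_le_sum fun k _ => (hFs _).abs_sub_conj_le (queryIso_isometry _ _ _)
              (queryIso_isometry _ _ _) hσ hc
        _ ≤ 2 ^ s * (c * σ.trace.re) + (1 + 1 / c) * (4 * σ.trace.re) := by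
            rw [Finset.sum_add_distrib, Finset.sum_const, nsmul_eq_mul, ← Finset.mul_sum]
            refine add_le_add (le_of_eq (by
              rw [Finset.card_univ, Fintype.card_fun, Fintype.card_bool, Fintype.card_fin]
              push_cast
              ring)) (mul_le_mul_of_nonneg_left
              (sum_trace_conj_queryIso_sub_le G s ψ L w hσ) (by positivity))
        _ = κ * σ.trace.re := by
            rw [hκ]
            ring
    have hτ : (conj (queryIso G L w) σ).trace.re = σ.trace.re := by
      rw [trace_conj, queryIso_isometry, Matrix.one_mul]
    have h2 : ∑ k, |F (replaceRow G s k ψ) (conj (queryIso G L w) σ) -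
        F G (conj (queryIso G L w) σ)| ≤ N' * κ * σ.trace.re := by
      refine (sum_abs_sub_list_sum_le _ _ _).trans ?_
      rw [← hτ]
      exact hsum _ post.complete _ _ _ fun q _ =>
        ih q.1 (hN q.1) (conj_posSemidef _ (conj_posSemidef _ hσ))
    calc _ ≤ ∑ k, (|F (replaceRow G s k ψ) (conj (queryIso (replaceRow G s k ψ) L w) σ) -
          F (replaceRow G s k ψ) (conj (queryIso G L w) σ)| +
          |F (replaceRow G s k ψ) (conj (queryIso G L w) σ) - F G (conj (queryIso G L w) σ)|) :=
          Finset.sum_le_sum fun k _ => abs_sub_le _ _ _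
      _ ≤ κ * σ.trace.re + N' * κ * σ.trace.re := by
          rw [Finset.sum_add_distrib]
          exact add_le_add h1 h2
      _ = _ := by
          push_cast
          ring

theorem Dist.prob_congr {s d M N : ℕ} (D : Dist X n s d) (hD : D.Bounded M N)
    {G G' : Generator X n} (h : ∀ l ≤ M, G l = G' l) (χ : X s → PureState (n s))
    (ρ : Matrix (Fin d) (Fin d) ℂ) : D.prob G χ ρ = D.prob G' χ ρ := by
  induction D generalizing N with
  | out b => rfl
  | step J next ih =>
    simp only [Dist.prob]
    congr 2
    funext p
    exact ih p.1 (hD p.1) _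
  | challenge x J next ih =>
    obtain ⟨N', rfl, hN⟩ := hD
    simp only [Dist.prob]
    congr 2
    funext p
    exact ih p.1 (hN p.1) _
  | query L w pre post next ih =>
    obtain ⟨hL, N', rfl, hN⟩ := hD
    have hq : queryIso G L w = queryIso G' L w := by
      funext p q
      rcases q with ⟨_ | ⟨l, k, x⟩, i⟩
      · rfl
      · simp only [queryIso, answer]
        rw [h l (le_trans (Nat.lt_succ_iff.mp l.2) hL)]
    simp only [Dist.prob]
    congr 2
    funext p
    congr 2
    funext q
    rw [hq]
    exact ih q.1 (hN q.1) _

theorem continuous_conj {α β Y : Type} [Fintype α] [TopologicalSpace Y] {K : Y → Matrix β α ℂ}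
    {ρ : Y → Matrix α α ℂ} (hK : Continuous K) (hρ : Continuous ρ) :
    Continuous fun y => conj (K y) (ρ y) := by
  unfold conj
  exact (hK.matrix_mul hρ).matrix_mul hK.matrix_conjTranspose

theorem continuous_attach {α Y : Type} [DecidableEq α] [TopologicalSpace Y] {m : ℕ}
    {ψ : Y → PureState m} (hψ : Continuous ψ) : Continuous fun y => attach (α := α) (ψ y) := by
  refine continuous_matrix fun p a => ?_
  unfold attach
  split_ifs
  · fun_prop
  · exact continuous_const

theorem continuous_list_map_sum {ι Y : Type} {M : Type*} [TopologicalSpace Y] [TopologicalSpace M]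
    [AddMonoid M] [ContinuousAdd M] (l : List ι) {f : Y → ι → M}
    (h : ∀ i ∈ l, Continuous fun y => f y i) : Continuous fun y => (l.map (f y)).sum :=
  continuous_list_sum l h

theorem continuous_queryIso {Y : Type} [TopologicalSpace Y] {G : Y → Generator X n}
    (hG : Continuous G) (L w : ℕ) : Continuous fun y => queryIso (G y) L w := by
  refine continuous_matrix fun p q => ?_
  unfold queryIso
  split_ifs
  · rcases q with ⟨_ | ⟨l, k, x⟩, i⟩
    · exact continuous_const
    · simp only [answer]
      refine continuous_finsetSum _ fun b _ => ?_
      split_ifs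
      · have : Continuous fun y => G y l k x :=
          (continuous_apply x).comp ((continuous_apply k).comp ((continuous_apply (l : ℕ)).comp hG))
        fun_prop
      · exact continuous_const
  · exact continuous_const

theorem Dist.continuous_prob {s d : ℕ} (D : Dist X n s d) {Y : Type} [TopologicalSpace Y]
    {G : Y → Generator X n} (hG : Continuous G) {χ : Y → X s → PureState (n s)}
    (hχ : Continuous χ) {ρ : Y → Matrix (Fin d) (Fin d) ℂ} (hρ : Continuous ρ) :
    Continuous fun y => D.prob (G y) (χ y) (ρ y) := by
  induction D with
  | out b =>
    cases b
    · exact continuous_const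
    · simp only [Dist.prob, if_true]
      exact Complex.continuous_re.comp hρ.matrix_trace
  | step J next ih =>
    simp only [Dist.prob]
    exact continuous_list_map_sum _ fun p _ => ih p.1 (continuous_conj continuous_const hρ)
  | challenge x J next ih =>
    simp only [Dist.prob, Instr.withState, List.map_map]
    refine continuous_list_map_sum _ fun p _ => ih p.1 (continuous_conj ?_ hρ)
    exact continuous_const.matrix_mul (continuous_attach ((continuous_apply x).comp hχ))
  | query L w pre post next ih =>
    simp only [Dist.prob]
    exact continuous_list_map_sum _ fun p _ => continuous_list_map_sum _ fun q _ => ih q.1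
      (continuous_conj continuous_const (continuous_conj (continuous_queryIso hG L w)
        (continuous_conj continuous_const hρ)))

end DistLemmas

/-! ## Averages over the states of long keys -/

section Resampling

variable {ι : Type*} [Fintype ι] [DecidableEq ι] {Ω : ι → Type*} [∀ i, MeasurableSpace (Ω i)]
  (μ : (i : ι) → Measure (Ω i)) [∀ i, IsProbabilityMeasure (μ i)]

/-- Resampling one coordinate independently preserves a product measure. This is what lets a single
key's states be refreshed in the second moment argument. -/
theorem measurePreserving_update (i : ι) :
    MeasurePreserving (fun p : ((j : ι) → Ω j) × Ω i => Function.update p.1 i p.2)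
      ((Measure.pi μ).prod (μ i)) (Measure.pi μ) := by
  refine ⟨measurable_update', (Measure.pi_eq fun s hs => ?_).symm⟩
  rw [Measure.map_apply measurable_update' (MeasurableSet.univ_pi hs)]
  have h : (fun p : ((j : ι) → Ω j) × Ω i => Function.update p.1 i p.2) ⁻¹' Set.univ.pi s =
      (Set.univ.pi (Function.update s i Set.univ)) ×ˢ s i := by
    ext ⟨y, z⟩
    simp only [Set.mem_preimage, Set.mem_univ_pi, Set.mem_prod]
    constructor
    · intro h
      refine ⟨fun j => ?_, by simpa using h i⟩
      by_cases hj : j = i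
      · subst hj
        simp
      · simpa [hj] using h j
    · rintro ⟨h1, h2⟩ j
      by_cases hj : j = i
      · subst hj
        simpa using h2
      · simpa [hj] using h1 j
  rw [h, Measure.prod_prod, Measure.pi_pi, ← Finset.mul_prod_erase Finset.univ _ (Finset.mem_univ i),
    ← Finset.mul_prod_erase Finset.univ (fun j => μ j (s j)) (Finset.mem_univ i)]
  rw [Function.update_self, measure_univ, one_mul, mul_comm]
  congr 1
  refine Finset.prod_congr rfl fun j hj => ?_
  rw [Function.update_of_ne (Finset.ne_of_mem_erase hj)]

theorem MeasurePreserving.integral_comp_of_continuous {Y Z : Type*} [MeasurableSpace Y]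
    [TopologicalSpace Z] [MeasurableSpace Z] [OpensMeasurableSpace Z] {μ : Measure Y}
    {ν : Measure Z} {T : Y → Z} (hT : MeasurePreserving T μ ν) {f : Z → ℝ} (hf : Continuous f) :
    ∫ y, f (T y) ∂μ = ∫ z, f z ∂ν := by
  rw [← hT.map_eq, integral_map hT.measurable.aemeasurable hf.aestronglyMeasurable]

end Resampling

/-! ### Partial averages over the states of a range of key lengths -/

section Average

variable {X : ℕ → Type} [∀ l, Fintype (X l)] [∀ l, DecidableEq (X l)] {n : ℕ → ℕ}

/-- The generator `G` with the states of the keys of lengths in `(L, N]` replaced by `y`. -/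
def overwrite (G : Generator X n) (L N : ℕ) (y : Table X n N) : Generator X n := fun l k =>
  if h : L < l ∧ l ≤ N then y ⟨⟨l, Nat.lt_succ_of_le h.2⟩, k⟩ else G l k

theorem overwrite_of_not {G : Generator X n} {L N : ℕ} (y : Table X n N) {l : ℕ}
    (h : ¬ (L < l ∧ l ≤ N)) : overwrite G L N y l = G l := by
  funext k
  exact dif_neg h

theorem overwrite_of_mem {G : Generator X n} {L N : ℕ} (y : Table X n N) {l : ℕ}
    (h : L < l ∧ l ≤ N) :
    overwrite G L N y l = fun k => y ⟨⟨l, Nat.lt_succ_of_le h.2⟩, k⟩ := by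
  funext k
  exact dif_pos h

theorem continuous_overwrite {Y : Type*} [TopologicalSpace Y] {L N : ℕ} {G : Y → Generator X n}
    (hG : Continuous G) {y : Y → Table X n N} (hy : Continuous y) :
    Continuous fun t => overwrite (G t) L N (y t) := by
  refine continuous_pi fun l => continuous_pi fun k => ?_
  unfold overwrite
  split_ifs with h
  · exact (continuous_apply _).comp hy
  · exact (continuous_apply k).comp ((continuous_apply l).comp hG)

theorem overwrite_update {G : Generator X n} {L N : ℕ} (y : Table X n N) {l : ℕ}
    (h : L < l ∧ l ≤ N) (k : Bits l) (ψ : X l → PureState (n l)) :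
    overwrite G L N (Function.update y ⟨⟨l, Nat.lt_succ_of_le h.2⟩, k⟩ ψ) =
      replaceRow (overwrite G L N y) l k ψ := by
  funext l'
  by_cases hl : l' = l
  · subst hl
    rw [overwrite_of_mem _ h, replaceRow, Function.update_self]
    funext k'
    by_cases hk : k' = k
    · subst hk
      rw [Function.update_self, Function.update_self]
    · rw [Function.update_of_ne hk, overwrite_of_mem _ h, Function.update_of_ne]
      simpa using hk
  · rw [replaceRow, Function.update_of_ne hl]
    by_cases h' : L < l' ∧ l' ≤ N
    · rw [overwrite_of_mem _ h', overwrite_of_mem _ h']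
      funext k'
      rw [Function.update_of_ne]
      intro h2
      simp only [Sigma.mk.injEq, Fin.mk.injEq] at h2
      exact hl h2.1
    · rw [overwrite_of_not _ h', overwrite_of_not _ h']

theorem overwrite_overwrite_comm (G : Generator X n) (L N N' : ℕ) (y : Table X n N)
    (y' : Table X n N') : overwrite (overwrite G L N y) N N' y' =
      overwrite (overwrite G N N' y') L N y := by
  funext l
  by_cases h1 : L < l ∧ l ≤ N
  · rw [overwrite_of_not _ (by omega), overwrite_of_mem _ h1, overwrite_of_mem _ h1]
  · by_cases h2 : N < l ∧ l ≤ N'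
    · rw [overwrite_of_mem _ h2, overwrite_of_not _ h1, overwrite_of_mem _ h2]
    · rw [overwrite_of_not _ h2, overwrite_of_not _ h1, overwrite_of_not _ h1, overwrite_of_not _ h2]

/-- The average of `f` over independent Haar random states for the keys of lengths in `(L, N]`, the
other states being those of `G`. -/
def avg (G : Generator X n) (L N : ℕ) (f : Generator X n → ℝ) : ℝ :=
  ∫ y, f (overwrite G L N y) ∂(tableMeasure X n N)

theorem integrable_overwrite (G : Generator X n) (L N : ℕ) {f : Generator X n → ℝ}
    (hf : Continuous f) :
    Integrable (fun y => f (overwrite G L N y)) (tableMeasure X n N) :=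
  Continuous.integrable_of_compactSpace
    (hf.comp (continuous_overwrite continuous_const continuous_id))

theorem avg_const (G : Generator X n) (L N : ℕ) (c : ℝ) : avg G L N (fun _ => c) = c := by
  simp [avg]

theorem avg_add (G : Generator X n) (L N : ℕ) {f g : Generator X n → ℝ} (hf : Continuous f)
    (hg : Continuous g) : avg G L N (fun G' => f G' + g G') = avg G L N f + avg G L N g :=
  integral_add (integrable_overwrite G L N hf) (integrable_overwrite G L N hg)

theorem avg_sub (G : Generator X n) (L N : ℕ) {f g : Generator X n → ℝ} (hf : Continuous f)
    (hg : Continuous g) : avg G L N (fun G' => f G' - g G') = avg G L N f - avg G L N g :=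
  integral_sub (integrable_overwrite G L N hf) (integrable_overwrite G L N hg)

theorem avg_const_mul (G : Generator X n) (L N : ℕ) (c : ℝ) (f : Generator X n → ℝ) :
    avg G L N (fun G' => c * f G') = c * avg G L N f :=
  integral_const_mul _ _

theorem avg_mul_const (G : Generator X n) (L N : ℕ) (c : ℝ) (f : Generator X n → ℝ) :
    avg G L N (fun G' => f G' * c) = avg G L N f * c :=
  integral_mul_const _ _

theorem avg_sum (G : Generator X n) (L N : ℕ) {ι : Type*} (s : Finset ι)
    {f : ι → Generator X n → ℝ} (hf : ∀ i ∈ s, Continuous (f i)) :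
    avg G L N (fun G' => ∑ i ∈ s, f i G') = ∑ i ∈ s, avg G L N (f i) :=
  integral_finsetSum _ fun i hi => integrable_overwrite G L N (hf i hi)

theorem avg_nonneg (G : Generator X n) (L N : ℕ) {f : Generator X n → ℝ} (hf : ∀ G', 0 ≤ f G') :
    0 ≤ avg G L N f :=
  integral_nonneg fun _ => hf _

theorem exists_avg_le (G : Generator X n) (L N : ℕ) {f : Generator X n → ℝ} (hf : Continuous f) :
    ∃ y, avg G L N f ≤ f (overwrite G L N y) :=
  exists_integral_le (integrable_overwrite G L N hf)

theorem continuous_integral {Y Z : Type*} [TopologicalSpace Y] [FirstCountableTopology Y]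
    [LocallyCompactSpace Y] [TopologicalSpace Z] [CompactSpace Z]
    [MeasurableSpace Z] [OpensMeasurableSpace Z] {μ : Measure Z} [IsFiniteMeasure μ]
    {f : Y → Z → ℝ} (hf : Continuous (Function.uncurry f)) : Continuous fun y => ∫ z, f y z ∂μ := by
  simpa using continuous_parametric_integral_of_continuous (μ := μ) hf isCompact_univ

theorem continuous_avg {L N : ℕ} {f : Generator X n → ℝ} (hf : Continuous f) :
    Continuous fun G => avg G L N f :=
  continuous_integral (hf.comp (continuous_overwrite continuous_fst continuous_snd))

theorem integral_swap_of_continuous {Y Z : Type*} [TopologicalSpace Y] [CompactSpace Y] [T2Space Y]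
    [MeasurableSpace Y] [OpensMeasurableSpace Y] [SecondCountableTopology Y] [TopologicalSpace Z]
    [CompactSpace Z] [T2Space Z] [MeasurableSpace Z] [OpensMeasurableSpace Z]
    [SecondCountableTopology Z] (μ : Measure Y) [IsFiniteMeasure μ] (ν : Measure Z)
    [IsFiniteMeasure ν] {f : Y → Z → ℝ} (hf : Continuous (Function.uncurry f)) :
    ∫ y, ∫ z, f y z ∂ν ∂μ = ∫ z, ∫ y, f y z ∂μ ∂ν :=
  integral_integral_swap (Continuous.integrable_of_compactSpace hf)

/-- The two ranges of key lengths are disjoint, so Fubini allows the range (L, N] to be averaged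
first, where the bound holds for all values of the other states. -/
theorem avg_avg_le (G : Generator X n) (L N N' : ℕ) {f : Generator X n → ℝ} (hf : Continuous f)
    {K : ℝ} (hK : ∀ G', avg G' L N f ≤ K) : avg G L N (fun G' => avg G' N N' f) ≤ K := by
  have hc : Continuous (Function.uncurry fun (y : Table X n N) (y' : Table X n N') =>
      f (overwrite (overwrite G L N y) N N' y')) :=
    hf.comp (continuous_overwrite (continuous_overwrite continuous_const continuous_fst)
      continuous_snd)
  have key : ∀ y', ∫ y, f (overwrite (overwrite G L N y) N N' y') ∂(tableMeasure X n N) =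
      avg (overwrite G N N' y') L N f := fun y' =>
    integral_congr_ae (Eventually.of_forall fun y =>
      congrArg f (overwrite_overwrite_comm G L N N' y y'))
  have hc' : Continuous fun y' => avg (overwrite G N N' y') L N f :=
    (continuous_avg hf).comp (continuous_overwrite continuous_const continuous_id)
  calc avg G L N (fun G' => avg G' N N' f)
      = ∫ y', ∫ y, f (overwrite (overwrite G L N y) N N' y') ∂(tableMeasure X n N)
          ∂(tableMeasure X n N') :=
        integral_swap_of_continuous (tableMeasure X n N) (tableMeasure X n N') hc
    _ = ∫ y', avg (overwrite G N N' y') L N f ∂(tableMeasure X n N') := by simp_rw [key]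
    _ ≤ ∫ _, K ∂(tableMeasure X n N') :=
        integral_mono (Continuous.integrable_of_compactSpace hc') (integrable_const K) fun y' => hK _
    _ = K := by simp

end Average

/-! ## The expected squared advantage of a distinguisher -/

section SecondMoment

variable {κ Y Z : Type*} [Fintype κ] [DecidableEq κ] [TopologicalSpace Y] [CompactSpace Y]
  [T2Space Y] [MeasurableSpace Y] [OpensMeasurableSpace Y] [SecondCountableTopology Y]
  [TopologicalSpace Z] [CompactSpace Z] [T2Space Z] [MeasurableSpace Z] [OpensMeasurableSpace Z]
  [SecondCountableTopology Z]

theorem abs_mul_sub_mul_le {a b c d : ℝ} (ha : |a| ≤ 1) (hd : |d| ≤ 1) :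
    a * b - c * d ≤ |a - c| + |b - d| := by
  have h : a * b - c * d = a * (b - d) + (a - c) * d := by ring
  rw [h]
  have h1 : a * (b - d) ≤ |b - d| := by
    refine (le_abs_self _).trans ?_
    rw [abs_mul]
    exact mul_le_of_le_one_left (abs_nonneg _) ha
  have h2 : (a - c) * d ≤ |a - c| := by
    refine (le_abs_self _).trans ?_
    rw [abs_mul]
    exact mul_le_of_le_one_right (abs_nonneg _) hd
  linarith

/-- If resampling the `k`-th coordinate hardly changes `p` for most `k`, then the average of
`p` at the coordinates is close to its mean, in quadratic mean. -/
theorem integral_sq_sub_le (π : Measure Y) [IsProbabilityMeasure π] (ν : Measure Z)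
    [IsProbabilityMeasure ν] (upd : κ → Y → Z → Y) (read : κ → Y → Z) {p : Y → Z → ℝ} {η : ℝ}
    (hu : ∀ k, Continuous fun q : Y × Z => upd k q.1 q.2) (hr : ∀ k, Continuous (read k))
    (hmp : ∀ k, MeasurePreserving (fun q : Y × Z => upd k q.1 q.2) (π.prod ν) π)
    (hru : ∀ k y z, read k (upd k y z) = z)
    (hru' : ∀ k k' y z, k ≠ k' → read k' (upd k y z) = read k' y)
    (hp : Continuous (Function.uncurry p)) (hp0 : ∀ y z, 0 ≤ p y z) (hp1 : ∀ y z, p y z ≤ 1)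
    (hη : ∀ y z z', ∑ k, |p (upd k y z) z' - p y z'| ≤ (Fintype.card κ : ℝ) * η)
    (hκ : 0 < Fintype.card κ) :
    ∫ y, ((∑ k, p y (read k y)) / (Fintype.card κ : ℝ) - ∫ z, p y z ∂ν) ^ 2 ∂π ≤
      1 / (Fintype.card κ : ℝ) + 8 * η := by
  set K : ℝ := (Fintype.card κ : ℝ) with hK
  have hK0 : 0 < K := Nat.cast_pos.mpr hκ
  set b : Y → ℝ := fun y => ∫ z, p y z ∂ν with hb
  have hpz : ∀ y, Continuous (p y) := fun y => hp.comp (by fun_prop : Continuous fun z => (y, z))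
  have hbc : Continuous b := by
    have hb' : Continuous fun y : Y => ∫ z, p y z ∂ν := by
      exact continuous_integral hp
    exact hb'
  have hpi : ∀ y, Integrable (p y) ν := fun y => Continuous.integrable_of_compactSpace (hpz y)
  have hb0 : ∀ y, 0 ≤ b y := fun y => integral_nonneg fun z => hp0 y z
  have hb1 : ∀ y, b y ≤ 1 := fun y =>
    (integral_mono (hpi y) (integrable_const 1) fun z => hp1 y z).trans (le_of_eq (by simp))
  set c : κ → Y → ℝ := fun k y => p y (read k y) - b y with hc
  have hcc : ∀ k, Continuous (c k) := fun k =>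
    (hp.comp (continuous_id.prodMk (hr k))).sub hbc
  have hc1 : ∀ k y, |c k y| ≤ 1 := fun k y => abs_le.mpr
    ⟨by linarith [hp0 y (read k y), hb1 y], by linarith [hp1 y (read k y), hb0 y]⟩
  have h1 : ∀ y, ((∑ k, p y (read k y)) / K - b y) ^ 2 =
      (∑ k, ∑ k', c k y * c k' y) / K ^ 2 := by
    intro y
    have : (∑ k, p y (read k y)) / K - b y = (∑ k, c k y) / K := by
      simp only [hc, Finset.sum_sub_distrib, Finset.sum_const, Finset.card_univ, nsmul_eq_mul]
      rw [← hK]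
      field_simp
    rw [this, div_pow, sq (∑ k, c k y), Finset.sum_mul_sum]
  set e : Y → Z → ℝ := fun y z => p y z - b y with he
  have hec : Continuous (Function.uncurry e) := hp.sub (hbc.comp continuous_fst)
  have he1 : ∀ y z, |e y z| ≤ 1 := fun y z => abs_le.mpr
    ⟨by linarith [hp0 y z, hb1 y], by linarith [hp1 y z, hb0 y]⟩
  set P : Measure ((Y × Z) × Z) := (π.prod ν).prod ν with hP
  -- Coordinates k' and k are resampled, with the fresh values `q.1.2` and `q.2`. The result again
  -- has law `π`.
  set U : κ → κ → (Y × Z) × Z → Y := fun k k' q => upd k (upd k' q.1.1 q.1.2) q.2 with hU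
  have hUc : ∀ k k', Continuous (U k k') := fun k k' =>
    (hu k).comp (((hu k').comp continuous_fst).prodMk continuous_snd)
  have hUmp : ∀ k k', MeasurePreserving (U k k') P π := fun k k' =>
    (hmp k).comp ((hmp k').prod (MeasurePreserving.id ν))
  set Δ : κ → κ → (Y × Z) × Z → Z → ℝ :=
    fun k k' q z => |p (U k k' q) z - p q.1.1 z| with hΔ
  set B : κ → κ → (Y × Z) × Z → ℝ := fun k k' q => |b (U k k' q) - b q.1.1| with hB
  have hΔsum : ∀ q z, ∑ k, ∑ k', Δ k k' q z ≤ K ^ 2 * (2 * η) := by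
    intro q z
    have hle : ∀ k k', Δ k k' q z ≤ |p (U k k' q) z - p (upd k' q.1.1 q.1.2) z| +
        |p (upd k' q.1.1 q.1.2) z - p q.1.1 z| := fun k k' => abs_sub_le _ _ _
    calc ∑ k, ∑ k', Δ k k' q z ≤ ∑ k, ∑ k', (|p (U k k' q) z - p (upd k' q.1.1 q.1.2) z| +
        |p (upd k' q.1.1 q.1.2) z - p q.1.1 z|) :=
          Finset.sum_le_sum fun k _ => Finset.sum_le_sum fun k' _ => hle k k'
      _ = ∑ k', ∑ k, |p (U k k' q) z - p (upd k' q.1.1 q.1.2) z| +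
          ∑ k : κ, ∑ k', |p (upd k' q.1.1 q.1.2) z - p q.1.1 z| := by
          simp only [Finset.sum_add_distrib]
          rw [Finset.sum_comm]
      _ ≤ ∑ _k' : κ, K * η + ∑ _k : κ, K * η :=
          add_le_add (Finset.sum_le_sum fun k' _ => hη _ _ _)
            (Finset.sum_le_sum fun k _ => hη _ _ _)
      _ = K ^ 2 * (2 * η) := by
          simp only [Finset.sum_const, Finset.card_univ, nsmul_eq_mul]
          rw [← hK]
          ring
  have hBsum : ∀ q, ∑ k, ∑ k', B k k' q ≤ K ^ 2 * (2 * η) := by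
    intro q
    have hΔi : ∀ k k', Integrable (fun z => Δ k k' q z) ν := fun k k' =>
      Continuous.integrable_of_compactSpace (((hpz _).sub (hpz _)).abs)
    have hle : ∀ k k', B k k' q ≤ ∫ z, Δ k k' q z ∂ν := by
      intro k k'
      simp only [hB, hb, hΔ]
      rw [← integral_sub (hpi _) (hpi _)]
      exact abs_integral_le_integral_abs
    calc ∑ k, ∑ k', B k k' q ≤ ∑ k, ∑ k', ∫ z, Δ k k' q z ∂ν :=
          Finset.sum_le_sum fun k _ => Finset.sum_le_sum fun k' _ => hle k k'
      _ = ∫ z, ∑ k, ∑ k', Δ k k' q z ∂ν := by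
          rw [integral_finsetSum _ fun k _ => integrable_finsetSum _ fun k' _ => hΔi k k']
          refine Finset.sum_congr rfl fun k _ => ?_
          rw [integral_finsetSum _ fun k' _ => hΔi k k']
      _ ≤ ∫ _, K ^ 2 * (2 * η) ∂ν := integral_mono
          (integrable_finsetSum _ fun k _ => integrable_finsetSum _ fun k' _ => hΔi k k')
          (integrable_const _) fun z => hΔsum q z
      _ = K ^ 2 * (2 * η) := by simp
  have hη0 : 0 ≤ η := by
    obtain ⟨y⟩ : Nonempty Y := nonempty_of_isProbabilityMeasure π
    obtain ⟨z⟩ : Nonempty Z := nonempty_of_isProbabilityMeasure ν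
    have := (Finset.sum_nonneg fun k _ => abs_nonneg _).trans (hη y z z)
    exact nonneg_of_mul_nonneg_right this hK0
  -- The error of undoing both resamplings in a product of two centred factors: each factor changes
  -- by at most Δ + B. The sums of Δ and of B over all pairs are at most 2ηK², so the total is 8ηK².
  set R : κ → κ → (Y × Z) × Z → ℝ := fun k k' q =>
    Δ k k' q q.2 + Δ k k' q q.1.2 + 2 * B k k' q with hR
  have hRc : ∀ k k', Continuous (R k k') := by
    intro k k'
    have h2 : ∀ f : (Y × Z) × Z → Z, Continuous f → Continuous fun q => Δ k k' q (f q) :=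
      fun f hf => ((hp.comp ((hUc k k').prodMk hf)).sub
        (hp.comp ((continuous_fst.comp continuous_fst).prodMk hf))).abs
    exact ((h2 _ continuous_snd).add (h2 _ (continuous_snd.comp continuous_fst))).add
      (continuous_const.mul ((hbc.comp (hUc k k')).sub
        (hbc.comp (continuous_fst.comp continuous_fst))).abs)
  have hR0 : ∀ k k' q, 0 ≤ R k k' q := fun k k' q => by
    simp only [hR, hΔ, hB]
    positivity
  have hRi : ∀ k k', Integrable (R k k') P := fun k k' =>
    Continuous.integrable_of_compactSpace (hRc k k')
  have hRsum : ∀ q, ∑ k, ∑ k', R k k' q ≤ K ^ 2 * (8 * η) := by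
    intro q
    simp only [hR, Finset.sum_add_distrib, ← Finset.mul_sum]
    linarith [hΔsum q q.2, hΔsum q q.1.2, hBsum q]
  have hcont : Continuous fun q : (Y × Z) × Z => e q.1.1 q.2 * e q.1.1 q.1.2 :=
    (hec.comp ((continuous_fst.comp continuous_fst).prodMk continuous_snd)).mul
      (hec.comp ((continuous_fst.comp continuous_fst).prodMk (continuous_snd.comp continuous_fst)))
  -- Given y, the two factors are independent and centred.
  have hee : ∫ q, e q.1.1 q.2 * e q.1.1 q.1.2 ∂P = 0 := by
    rw [hP, integral_prod _ (Continuous.integrable_of_compactSpace hcont)]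
    refine integral_eq_zero_of_ae (Eventually.of_forall fun q => ?_)
    simp only
    rw [integral_mul_const]
    have : ∫ z, e q.1 z ∂ν = 0 := by
      simp only [he]
      rw [integral_sub (hpi _) (integrable_const _)]
      simp [hb]
    simp [this]
  -- After resampling, the coordinates k and k' are fresh and independent of the y from which the
  -- experiment was formed, so the correlation is zero up to the change of p and b. The diagonal
  -- terms are at most 1 each and yield 1/K.
  have hoff : ∀ k k', k ≠ k' → ∫ y, c k y * c k' y ∂π ≤ ∫ q, R k k' q ∂P := by
    intro k k' hkk
    rw [← MeasurePreserving.integral_comp_of_continuous (hUmp k k')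
      (f := fun y => c k y * c k' y) ((hcc k).mul (hcc k')),
      ← sub_zero (∫ q, c k (U k k' q) * c k' (U k k' q) ∂P), ← hee, ← integral_sub]
    · refine integral_mono ?_ (hRi k k') fun q => ?_
      · exact (Continuous.integrable_of_compactSpace
          (((hcc k).comp (hUc k k')).mul ((hcc k').comp (hUc k k')))).sub
          (Continuous.integrable_of_compactSpace hcont)
      · have hk : read k (U k k' q) = q.2 := hru _ _ _
        have hk' : read k' (U k k' q) = q.1.2 := by
          simp only [hU]
          rw [hru' _ _ _ _ hkk, hru]
        refine (abs_mul_sub_mul_le (hc1 _ _) (he1 _ _)).trans ?_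
        have t1 : ∀ z, |p (U k k' q) z - b (U k k' q) - (p q.1.1 z - b q.1.1)| ≤
            Δ k k' q z + B k k' q := by
          intro z
          rw [show p (U k k' q) z - b (U k k' q) - (p q.1.1 z - b q.1.1) =
            (p (U k k' q) z - p q.1.1 z) - (b (U k k' q) - b q.1.1) by ring]
          exact abs_sub _ _
        simp only [hc, he, hk, hk', hR]
        linarith [t1 q.2, t1 q.1.2]
    · exact Continuous.integrable_of_compactSpace
        (((hcc k).comp (hUc k k')).mul ((hcc k').comp (hUc k k')))
    · exact Continuous.integrable_of_compactSpace hcont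
  have hcci : ∀ k k', Integrable (fun y => c k y * c k' y) π := fun k k' =>
    Continuous.integrable_of_compactSpace ((hcc k).mul (hcc k'))
  have hall : ∀ k k', ∫ y, c k y * c k' y ∂π ≤ (if k = k' then 1 else 0) + ∫ q, R k k' q ∂P := by
    intro k k'
    have hRint : 0 ≤ ∫ q, R k k' q ∂P := integral_nonneg fun q => hR0 k k' q
    split_ifs with h
    · subst h
      have h2 : ∫ y, c k y * c k y ∂π ≤ ∫ _, (1 : ℝ) ∂π := integral_mono (hcci k k)
        (integrable_const _) fun y => by
          simp only
          rw [← abs_mul_abs_self]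
          exact mul_le_one₀ (hc1 k y) (abs_nonneg _) (hc1 k y)
      simp only [integral_const, probReal_univ, smul_eq_mul, mul_one] at h2
      linarith
    · rw [zero_add]
      exact hoff k k' h
  calc ∫ y, ((∑ k, p y (read k y)) / K - b y) ^ 2 ∂π
      = (∑ k, ∑ k', ∫ y, c k y * c k' y ∂π) / K ^ 2 := by
        simp_rw [h1]
        rw [integral_div, integral_finsetSum _ fun k _ => integrable_finsetSum _ fun k' _ =>
          hcci k k']
        congr 1
        refine Finset.sum_congr rfl fun k _ => ?_
        rw [integral_finsetSum _ fun k' _ => hcci k k']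
    _ ≤ (∑ k : κ, ∑ k' : κ, ((if k = k' then 1 else 0) + ∫ q, R k k' q ∂P)) / K ^ 2 := by
        gcongr with k _ k' _
        exact hall k k'
    _ = (K + ∫ q, ∑ k, ∑ k', R k k' q ∂P) / K ^ 2 := by
        rw [integral_finsetSum _ fun k _ => integrable_finsetSum _ fun k' _ => hRi k k']
        congr 1
        simp only [Finset.sum_add_distrib, Finset.sum_ite_eq, Finset.mem_univ, if_true,
          Finset.sum_const, Finset.card_univ, nsmul_eq_mul, mul_one]
        congr 1
        refine Finset.sum_congr rfl fun k _ => ?_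
        rw [integral_finsetSum _ fun k' _ => hRi k k']
    _ ≤ (K + K ^ 2 * (8 * η)) / K ^ 2 := by
        gcongr
        refine (integral_mono (integrable_finsetSum _ fun k _ => integrable_finsetSum _ fun k' _ =>
          hRi k k') (integrable_const _) hRsum).trans (le_of_eq (by simp))
    _ = 1 / K + 8 * η := by
        field_simp

end SecondMoment

/-! ### The mean squared advantage against Haar random states -/

section Advantage

variable {X : ℕ → Type} [∀ l, Fintype (X l)] [∀ l, DecidableEq (X l)] {n : ℕ → ℕ}

theorem Dist.continuous_advantage {s : ℕ} (D : Dist X n s 1) :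
    Continuous fun G : Generator X n => D.advantage G := by
  unfold Dist.advantage
  refine Continuous.abs (Continuous.sub ?_ ?_)
  · refine Continuous.div_const (continuous_finsetSum _ fun k _ => ?_) _
    exact D.continuous_prob continuous_id
      ((continuous_apply k).comp (continuous_apply s)) continuous_const
  · exact continuous_integral (D.continuous_prob continuous_fst continuous_snd continuous_const)

theorem Dist.advantage_congr {s M N : ℕ} (D : Dist X n s 1) (hD : D.Bounded M N)
    {G G' : Generator X n} (h : ∀ l ≤ M, G l = G' l) (hs : G s = G' s) :
    D.advantage G = D.advantage G' := by
  unfold Dist.advantage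
  simp only [hs, D.prob_congr hD h]

theorem Dist.prob_one_nonneg {s : ℕ} (D : Dist X n s 1) (G : Generator X n)
    (χ : X s → PureState (n s)) : 0 ≤ D.prob G χ 1 :=
  (D.subTrace_prob G χ).nonneg 1 Matrix.PosSemidef.one

theorem Dist.prob_one_le_one {s : ℕ} (D : Dist X n s 1) (G : Generator X n)
    (χ : X s → PureState (n s)) : D.prob G χ 1 ≤ 1 :=
  ((D.subTrace_prob G χ).le_trace 1 Matrix.PosSemidef.one).trans (le_of_eq (by simp))

/-- Against independent Haar random states a distinguisher with few queries has a small
advantage, in quadratic mean. -/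
theorem Dist.avg_advantage_sq_le {s M q : ℕ} (D : Dist X n s 1) (hD : D.Bounded M q)
    (G : Generator X n) {L N : ℕ} (h : L < s ∧ s ≤ N) :
    avg G L N (fun G' => D.advantage G' ^ 2) ≤
      1 / 2 ^ s + 72 * q * (1 / Real.sqrt 2) ^ s := by
  -- The value r = 2^(-s/2) for `c` balances 2^s c against 4/c. With 2^s r ≥ 1 the hybrid bound
  -- becomes q(2^s r + 4 + 4 · 2^s r) ≤ 2^s · 9qr, which explains η = 9qr and the constant 72 = 8 ·
  -- 9.
  set r : ℝ := (1 / Real.sqrt 2) ^ s with hr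
  have hr0 : 0 < r := by positivity
  have hr1 : r ≤ 1 := pow_le_one₀ (by positivity) (by
    rw [div_le_one (by positivity)]
    exact Real.one_le_sqrt.mpr (by norm_num))
  have hrr : (2 : ℝ) ^ s * (r * r) = 1 := by
    rw [hr, ← mul_pow, ← mul_pow, div_mul_div_comm, Real.mul_self_sqrt (by norm_num)]
    norm_num
  have hcard : (Fintype.card (Bits s) : ℝ) = 2 ^ s := by simp
  have key := integral_sq_sub_le (κ := Bits s) (tableMeasure X n N)
    (Measure.pi fun _ : X s => haarState (n s))
    (fun k y z => Function.update y ⟨⟨s, Nat.lt_succ_of_le h.2⟩, k⟩ z)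
    (fun k y => y ⟨⟨s, Nat.lt_succ_of_le h.2⟩, k⟩)
    (p := fun y χ => D.prob (overwrite G L N y) χ 1) (η := 9 * q * r)
    (fun k => by exact continuous_fst.update _ continuous_snd)
    (fun k => continuous_apply _)
    (fun k => measurePreserving_update
      (fun r : Row N => Measure.pi fun _ : X r.1 => haarState (n r.1))
      (⟨⟨s, Nat.lt_succ_of_le h.2⟩, k⟩ : Row N))
    (fun k y z => by simp)
    (fun k k' y z hk => by
      rw [Function.update_of_ne]
      simpa using hk.symm)
    (D.continuous_prob (continuous_overwrite continuous_const continuous_fst) continuous_snd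
      continuous_const)
    (fun y z => D.prob_one_nonneg _ _) (fun y z => D.prob_one_le_one _ _)
    (fun y z z' => by
      simp only [overwrite_update y h]
      refine (D.sum_abs_prob_replaceRow_sub_le hD _ z' z hr0 Matrix.PosSemidef.one).trans ?_
      rw [hcard]
      have h1 : 1 / r = 2 ^ s * r := by
        rw [div_eq_iff hr0.ne']
        linarith
      have h2 : (1 : ℝ) ≤ 2 ^ s * r := by
        rw [← h1, le_div_iff₀ hr0]
        linarith
      rw [h1]
      simp only [Matrix.trace_one, Fintype.card_fin, Nat.cast_one, Complex.one_re, mul_one]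
      have hq : (0 : ℝ) ≤ q := Nat.cast_nonneg q
      nlinarith)
    Fintype.card_pos
  rw [hcard] at key
  unfold avg
  refine le_trans (le_of_eq ?_) (key.trans (le_of_eq (by ring)))
  refine integral_congr_ae (Eventually.of_forall fun y => ?_)
  simp only [Dist.advantage, sq_abs, overwrite_of_mem y h]

end Advantage

/-! ## Computations with classical queries -/

section Kraus

variable {α β γ : Type} [Fintype α] [Fintype β] [Fintype γ] {O : Type}

open Classical in
/-- The subnormalized state after those operations of the list that report an outcome in `P`. -/
def act (K : List (O × Matrix β α ℂ)) (P : O → Prop) (ρ : Matrix α α ℂ) : Matrix β β ℂ :=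
  (K.map fun p => if P p.1 then conj p.2 ρ else 0).sum

theorem trace_list_sum (l : List (Matrix α α ℂ)) : l.sum.trace = (l.map Matrix.trace).sum := by
  induction l with
  | nil => simp
  | cons a l ih => simp [Matrix.trace_add, ih]

theorem act_posSemidef (K : List (O × Matrix β α ℂ)) (P : O → Prop) {ρ : Matrix α α ℂ}
    (h : ρ.PosSemidef) : (act K P ρ).PosSemidef := by
  unfold act
  induction K with
  | nil => exact Matrix.PosSemidef.zero
  | cons p K ih =>
    simp only [List.map_cons, List.sum_cons]
    refine Matrix.PosSemidef.add ?_ ih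
    split_ifs
    · exact conj_posSemidef _ h
    · exact Matrix.PosSemidef.zero

theorem act_add (K : List (O × Matrix β α ℂ)) (P : O → Prop) (ρ σ : Matrix α α ℂ) :
    act K P (ρ + σ) = act K P ρ + act K P σ := by
  unfold act
  rw [← List.sum_map_add]
  congr 1
  refine List.map_congr_left fun p _ => ?_
  split_ifs
  · exact conj_add _ _ _
  · simp

theorem act_smul (K : List (O × Matrix β α ℂ)) (P : O → Prop) (r : ℝ) (ρ : Matrix α α ℂ) :
    act K P (r • ρ) = r • act K P ρ := by
  unfold act
  rw [List.smul_sum, List.map_map]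
  congr 1
  refine List.map_congr_left fun p _ => ?_
  simp only [Function.comp]
  split_ifs
  · exact conj_smul _ _ _
  · simp

theorem act_zero (K : List (O × Matrix β α ℂ)) (P : O → Prop) :
    act K P (0 : Matrix α α ℂ) = 0 := by
  unfold act
  rw [List.sum_eq_zero]
  intro x hx
  obtain ⟨p, _, rfl⟩ := List.mem_map.mp hx
  split_ifs
  · exact conj_zero _
  · rfl

/-- A list of Kraus operators of a channel. -/
def Complete [DecidableEq α] (K : List (O × Matrix β α ℂ)) : Prop :=
  (K.map fun p => p.2ᴴ * p.2).sum = 1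

theorem Complete.trace_act_true [DecidableEq α] {K : List (O × Matrix β α ℂ)} (hK : Complete K)
    (ρ : Matrix α α ℂ) : (act K (fun _ => True) ρ).trace.re = ρ.trace.re := by
  rw [← sum_trace_conj K hK]
  unfold act
  simp only [if_true]
  rw [trace_list_sum, List.map_map, ← Complex.coe_reAddGroupHom, map_list_sum, List.map_map]
  rfl

end Kraus

/-! ### Kraus operators of computations with classical queries -/

section Programs

variable {α β γ : Type} [Fintype α] [Fintype β] [Fintype γ] {O O' : Type}

theorem sum_flatMap {ι M : Type*} [AddMonoid M] (l : List ι) (f : ι → List M) :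
    (l.flatMap f).sum = (l.map fun i => (f i).sum).sum := by
  induction l with
  | nil => simp
  | cons i l ih => simp [ih]

theorem Complete.bind [DecidableEq α] [DecidableEq β] {K : List (O × Matrix β α ℂ)}
    (hK : Complete K) {K' : O → List (O' × Matrix γ β ℂ)} (hK' : ∀ o, Complete (K' o)) :
    Complete (K.flatMap fun p => (K' p.1).map fun q => (q.1, q.2 * p.2)) := by
  unfold Complete at *
  rw [← hK, List.map_flatMap, sum_flatMap]
  congr 1
  refine List.map_congr_left fun p _ => ?_
  simp only [List.map_map]
  have h : ∀ q : O' × Matrix γ β ℂ, (q.2 * p.2)ᴴ * (q.2 * p.2) = p.2ᴴ * (q.2ᴴ * q.2) * p.2 := by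
    intro q
    rw [Matrix.conjTranspose_mul]
    simp only [Matrix.mul_assoc]
  have h2 : ∀ l : List (O' × Matrix γ β ℂ),
      (l.map fun q => (q.2 * p.2)ᴴ * (q.2 * p.2)).sum =
        p.2ᴴ * (l.map fun q => q.2ᴴ * q.2).sum * p.2 := by
    intro l
    induction l with
    | nil => simp
    | cons q l ih =>
      simp only [List.map_cons, List.sum_cons, Matrix.mul_add, Matrix.add_mul]
      rw [ih, h]
  exact (h2 _).trans (by rw [hK', Matrix.mul_one])

theorem act_bind (K : List (O × Matrix β α ℂ)) (K' : O → List (O' × Matrix γ β ℂ))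
    (P : O' → Prop) (ρ : Matrix α α ℂ) :
    act (K.flatMap fun p => (K' p.1).map fun q => (q.1, q.2 * p.2)) P ρ =
      (K.map fun p => act (K' p.1) P (conj p.2 ρ)).sum := by
  unfold act
  rw [List.map_flatMap, sum_flatMap]
  congr 1
  refine List.map_congr_left fun p _ => ?_
  simp only [Function.comp_def, List.map_map, conj_mul]

variable {X : ℕ → Type} [∀ l, Fintype (X l)] [∀ l, DecidableEq (X l)] {n : ℕ → ℕ} {e : ℕ}

theorem Prog.complete_kraus {d : ℕ} (p : Prog X n O e d) (G : Generator X n) :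
    Complete (p.kraus G) := by
  induction p with
  | ret o => simp [Complete, Prog.kraus]
  | step J next ih => exact Complete.bind J.complete ih
  | query l k x J next ih => exact Complete.bind (J.withState_complete (G l k x)) ih

/-- Branching is over finite types, whatever the generator. One finite set of transcripts thus
serves all generators, so averages commute with sums over transcripts and the parties may be given
different generators. -/
theorem Prog.exists_labels {d : ℕ} (p : Prog X n O e d) :
    ∃ s : Finset O, ∀ G : Generator X n, ∀ q ∈ p.kraus G, q.1 ∈ s := by
  classical
  induction p with
  | ret o => exact ⟨{o}, by simp [Prog.kraus]⟩
  | step J next ih =>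
    choose s hs using ih
    refine ⟨Finset.univ.biUnion s, fun G q hq => ?_⟩
    simp only [Prog.kraus, List.mem_flatMap, List.mem_map] at hq
    obtain ⟨p, -, q', hq', rfl⟩ := hq
    exact Finset.mem_biUnion.mpr ⟨p.1, Finset.mem_univ _, hs p.1 G q' hq'⟩
  | query l k x J next ih =>
    choose s hs using ih
    refine ⟨Finset.univ.biUnion s, fun G q hq => ?_⟩
    simp only [Prog.kraus, List.mem_flatMap, List.mem_map] at hq
    obtain ⟨p, -, q', hq', rfl⟩ := hq
    exact Finset.mem_biUnion.mpr ⟨p.1, Finset.mem_univ _, hs p.1 G q' hq'⟩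

theorem Prog.kraus_congr {d L N : ℕ} (p : Prog X n O e d) (hp : p.Bounded L N)
    {G G' : Generator X n} (h : ∀ l ≤ L, G l = G' l) : p.kraus G = p.kraus G' := by
  induction p generalizing N with
  | ret o => rfl
  | step J next ih =>
    simp only [Prog.kraus]
    congr 1
    funext p
    rw [ih p.1 (hp p.1)]
  | query l k x J next ih =>
    obtain ⟨hl, N', -, hN⟩ := hp
    simp only [Prog.kraus, h l hl]
    congr 1
    funext p
    rw [ih p.1 (hN p.1)]

theorem Prog.act_kraus_step {d d' r : ℕ} (J : Instr (Fin d) (Fin d') (Fin r))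
    (next : Fin r → Prog X n O e d') (G : Generator X n) (P : O → Prop)
    (ρ : Matrix (Fin d) (Fin d) ℂ) : act ((Prog.step J next).kraus G) P ρ =
      (J.ops.map fun p => act ((next p.1).kraus G) P (conj p.2 ρ)).sum :=
  act_bind J.ops (fun i => (next i).kraus G) P ρ

theorem Prog.act_kraus_query {d d' r : ℕ} (l : ℕ) (k : Bits l) (x : X l)
    (J : Instr (Fin d × Bits (n l)) (Fin d') (Fin r))
    (next : Fin r → Prog X n O e d') (G : Generator X n) (P : O → Prop)
    (ρ : Matrix (Fin d) (Fin d) ℂ) : act ((Prog.query l k x J next).kraus G) P ρ =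
      (J.ops.map fun p => act ((next p.1).kraus G) P
        (conj p.2 (conj (attach (α := Fin d) (G l k x)) ρ))).sum := by
  refine (act_bind (J.withState (G l k x)) (fun i => (next i).kraus G) P ρ).trans ?_
  simp only [Instr.withState, List.map_map, Function.comp_def]
  congr 1
  exact List.map_congr_left fun p _ => congrArg (act ((next p.1).kraus G) P)
    (conj_mul p.2 (attach (α := Fin d) (G l k x)) ρ)

theorem Prog.continuous_act {d : ℕ} (p : Prog X n O e d) (P : O → Prop) {Y : Type}
    [TopologicalSpace Y] {G : Y → Generator X n} (hG : Continuous G)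
    {ρ : Y → Matrix (Fin d) (Fin d) ℂ} (hρ : Continuous ρ) :
    Continuous fun y => act (p.kraus (G y)) P (ρ y) := by
  induction p with
  | ret o =>
    simp only [act, Prog.kraus, List.map_cons, List.map_nil, List.sum_cons, List.sum_nil, add_zero]
    split_ifs
    · exact continuous_conj continuous_const hρ
    · exact continuous_const
  | step J next ih =>
    simp only [Prog.act_kraus_step]
    exact continuous_list_map_sum _ fun p _ => ih p.1 (continuous_conj continuous_const hρ)
  | query l k x J next ih =>
    simp only [Prog.act_kraus_query]
    refine continuous_list_map_sum _ fun p _ => ih p.1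
      (continuous_conj continuous_const (continuous_conj ?_ hρ))
    exact (continuous_attach
      ((continuous_apply x).comp ((continuous_apply k).comp ((continuous_apply l).comp hG))))

end Programs

/-! ## States that are Gram matrices of multihomogeneous polynomials -/

section Gram

open MvPolynomial

variable {X : ℕ → Type} [∀ l, Fintype (X l)] [∀ l, DecidableEq (X l)] {n : ℕ → ℕ} {N : ℕ}
  {α β : Type} [Fintype α] [Fintype β]

/-- The pure state whose amplitudes are the values of the polynomials `v`. -/
def rankOne (v : α → MvPolynomial (Amplitude X n N) ℂ) (y : Table X n N) : Matrix α α ℂ :=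
  fun a b => eval (amplitudes y) (v a) * star (eval (amplitudes y) (v b))

/-- `M` is a sum of pure states whose amplitudes are multihomogeneous polynomials of degree at most
`q` in the amplitudes of the states with keys longer than `L`. -/
def IsGram (L q : ℕ) (M : Table X n N → Matrix α α ℂ) : Prop :=
  ∃ T : List ((Coord X N → ℕ) × (α → MvPolynomial (Amplitude X n N) ℂ)),
    (∀ t ∈ T, (∀ a, IsWeightedHomogeneous (ampWeight (X := X) (n := n)) (t.2 a) t.1) ∧
      ∑ c, t.1 c ≤ q ∧ ∀ c, t.1 c ≠ 0 → L < c.1.1) ∧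
    ∀ y, M y = (T.map fun t => rankOne t.2 y).sum

theorem IsGram.zero (L q : ℕ) : IsGram L q (fun _ : Table X n N => (0 : Matrix α α ℂ)) :=
  ⟨[], by simp, by simp⟩

theorem IsGram.add {L q : ℕ} {M M' : Table X n N → Matrix α α ℂ} (h : IsGram L q M)
    (h' : IsGram L q M') : IsGram L q fun y => M y + M' y := by
  obtain ⟨T, hT, hM⟩ := h
  obtain ⟨T', hT', hM'⟩ := h'
  refine ⟨T ++ T', fun t ht => ?_, fun y => by simp [hM, hM']⟩
  rcases List.mem_append.mp ht with ht | ht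
  exacts [hT t ht, hT' t ht]

theorem IsGram.mono {L q q' : ℕ} (hq : q ≤ q') {M : Table X n N → Matrix α α ℂ}
    (h : IsGram L q M) : IsGram L q' M := by
  obtain ⟨T, hT, hM⟩ := h
  exact ⟨T, fun t ht => ⟨(hT t ht).1, (hT t ht).2.1.trans hq, (hT t ht).2.2⟩, hM⟩

theorem IsGram.list_sum {L q : ℕ} {ι : Type} (l : List ι) {M : ι → Table X n N → Matrix α α ℂ}
    (h : ∀ i ∈ l, IsGram L q (M i)) : IsGram L q fun y => (l.map fun i => M i y).sum := by
  induction l with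
  | nil => exact IsGram.zero L q
  | cons i l ih =>
    simp only [List.map_cons, List.sum_cons]
    exact (h i List.mem_cons_self).add (ih fun j hj => h j (List.mem_cons_of_mem _ hj))

theorem conj_rankOne (K : Matrix β α ℂ) (v : α → MvPolynomial (Amplitude X n N) ℂ)
    (y : Table X n N) : conj K (rankOne v y) = rankOne (fun b => ∑ a, C (K b a) * v a) y := by
  ext b b'
  simp only [conj, Matrix.mul_apply, rankOne, Matrix.conjTranspose_apply, map_sum, map_mul, eval_C,
    star_sum, star_mul', Finset.sum_mul, Finset.mul_sum]
  refine Finset.sum_congr rfl fun a' _ => Finset.sum_congr rfl fun a _ => by ring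

theorem conj_list_sum (K : Matrix β α ℂ) (l : List (Matrix α α ℂ)) :
    conj K l.sum = (l.map (conj K)).sum := by
  induction l with
  | nil => simp [conj_zero]
  | cons a l ih => simp [conj_add, ih]

/-- The amplitudes of a branch all have the same multidegree, so a fixed matrix, which mixes them
linearly, preserves it. -/
theorem IsGram.conj {L q : ℕ} {M : Table X n N → Matrix α α ℂ} (h : IsGram L q M)
    (K : Matrix β α ℂ) : IsGram L q fun y => conj K (M y) := by
  obtain ⟨T, hT, hM⟩ := h
  refine ⟨T.map fun t => (t.1, fun b => ∑ a, C (K b a) * t.2 a), fun t ht => ?_, fun y => ?_⟩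
  · obtain ⟨t', ht', rfl⟩ := List.mem_map.mp ht
    refine ⟨fun b => ?_, (hT t' ht').2⟩
    refine IsWeightedHomogeneous.sum _ _ _ fun a _ => ?_
    simpa using (isWeightedHomogeneous_C _ (K b a)).mul ((hT t' ht').1 a)
  · simp only [hM]
    rw [conj_list_sum, List.map_map, List.map_map]
    congr 1
    exact List.map_congr_left fun t _ => conj_rankOne K t.2 y

theorem conj_attach_rankOne [DecidableEq α] {m : ℕ} (ψ : PureState m)
    (v : α → MvPolynomial (Amplitude X n N) ℂ) (w : Bits m → MvPolynomial (Amplitude X n N) ℂ)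
    (y : Table X n N) (h : ∀ b, eval (amplitudes y) (w b) = ψ.1 b) :
    QCCC.conj (attach (α := α) ψ) (rankOne v y) = rankOne (fun p => w p.2 * v p.1) y := by
  ext ⟨a, b⟩ ⟨a', b'⟩
  simp only [QCCC.conj, Matrix.mul_apply, rankOne, Matrix.conjTranspose_apply, attach, map_mul, h]
  simp only [apply_ite star, star_zero, mul_ite, ite_mul, zero_mul, mul_zero, Finset.sum_ite_eq,
    Finset.mem_univ, if_true, star_mul']
  ring

/-- A classical query concerns one definite state, so all amplitudes of a branch gain the same
degree: one variable of that state if the key is long, a constant if the key is short. A query in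
superposition would destroy multihomogeneity. -/
theorem IsGram.conj_attach [DecidableEq α] {L q l : ℕ} (G : Generator X n)
    {M : Table X n N → Matrix α α ℂ} (h : IsGram L q M) (hl : l ≤ N) (k : Bits l) (x : X l) :
    IsGram L (q + 1) fun y =>
      QCCC.conj (attach (α := α) (overwrite G L N y l k x)) (M y) := by
  obtain ⟨T, hT, hM⟩ := h
  by_cases hL : L < l
  · set c : Coord X N := ⟨⟨⟨l, Nat.lt_succ_of_le hl⟩, k⟩, x⟩ with hc
    refine ⟨T.map fun t => (Pi.single c 1 + t.1,
      fun p => MvPolynomial.X (⟨c, p.2⟩ : Amplitude X n N) * t.2 p.1), fun t ht => ?_, fun y => ?_⟩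
    · obtain ⟨t', ht', rfl⟩ := List.mem_map.mp ht
      refine ⟨fun p => (isWeightedHomogeneous_X ℂ ampWeight _).mul ((hT t' ht').1 p.1), ?_,
        fun c' hc' => ?_⟩
      · simp only [Pi.add_apply, Finset.sum_add_distrib]
        rw [Finset.sum_pi_single']
        simp only [Finset.mem_univ, if_true]
        linarith [(hT t' ht').2.1]
      · by_cases h : c' = c
        · rw [h]
          exact hL
        · refine (hT t' ht').2.2 c' ?_
          simpa [Pi.single_eq_of_ne h] using hc'
    · simp only [hM]
      rw [conj_list_sum, List.map_map, List.map_map]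
      congr 1
      refine List.map_congr_left fun t _ => ?_
      refine conj_attach_rankOne _ t.2 (fun b => MvPolynomial.X (⟨c, b⟩ : Amplitude X n N)) y ?_
      intro b
      rw [eval_X, overwrite_of_mem y ⟨hL, hl⟩]
      rfl
  · refine ⟨T.map fun t => (t.1, fun p => C ((G l k x).1 p.2) * t.2 p.1), fun t ht => ?_,
      fun y => ?_⟩
    · obtain ⟨t', ht', rfl⟩ := List.mem_map.mp ht
      refine ⟨fun p => ?_, (hT t' ht').2.1.trans (Nat.le_succ q), (hT t' ht').2.2⟩
      simpa using (isWeightedHomogeneous_C _ ((G l k x).1 p.2)).mul ((hT t' ht').1 p.1)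
    · simp only [hM]
      rw [conj_list_sum, List.map_map, List.map_map]
      congr 1
      refine List.map_congr_left fun t _ => ?_
      refine conj_attach_rankOne _ t.2 (fun b => C ((G l k x).1 b)) y ?_
      intro b
      rw [eval_C, overwrite_of_not y (by omega)]

theorem isGram_single [DecidableEq α] (L q : ℕ) (a : α) :
    IsGram L q fun _ : Table X n N => Matrix.single a a (1 : ℂ) := by
  refine ⟨[(0, fun b => C (if b = a then 1 else 0))], fun t ht => ?_, fun y => ?_⟩
  · obtain rfl := List.mem_singleton.mp ht
    exact ⟨fun b => isWeightedHomogeneous_C _ _, by simp, by simp⟩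
  · ext b b'
    simp only [List.map_cons, List.map_nil, List.sum_cons, List.sum_nil, add_zero, rankOne, eval_C,
      Matrix.single_apply]
    have h1 : (b = a) = (a = b) := propext eq_comm
    have h2 : (b' = a) = (a = b') := propext eq_comm
    simp only [h1, h2]
    by_cases h : a = b <;> by_cases h' : a = b' <;> simp [h, h']

theorem IsGram.act_kraus {O : Type} {e d L q N' : ℕ} (G : Generator X n) (p : Prog X n O e d)
    (hp : p.Bounded N N') (P : O → Prop) {ρ : Table X n N → Matrix (Fin d) (Fin d) ℂ}
    (h : IsGram L q ρ) : IsGram L (q + N') fun y => act (p.kraus (overwrite G L N y)) P (ρ y) := by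
  induction p generalizing q N' with
  | ret o =>
    simp only [act, Prog.kraus, List.map_cons, List.map_nil, List.sum_cons, List.sum_nil, add_zero]
    split_ifs
    · exact (h.conj 1).mono (Nat.le_add_right _ _)
    · exact IsGram.zero _ _
  | step J next ih =>
    simp only [Prog.act_kraus_step]
    exact IsGram.list_sum _ fun p _ => ih p.1 (hp p.1) (h.conj p.2)
  | query l k x J next ih =>
    obtain ⟨hl, N'', rfl, hN⟩ := hp
    simp only [Prog.act_kraus_query]
    refine IsGram.list_sum _ fun p _ => ?_
    have := ih p.1 (hN p.1) ((h.conj_attach G hl k x).conj p.2)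
    exact this.mono (by omega)

theorem trace_re_rankOne (v : α → MvPolynomial (Amplitude X n N) ℂ) (y : Table X n N) :
    (rankOne v y).trace.re = ∑ a, sqEval (v a) y := by
  simp only [Matrix.trace, Matrix.diag, rankOne, Complex.re_sum, sqEval]
  refine Finset.sum_congr rfl fun a _ => ?_
  rw [Complex.star_def, Complex.mul_conj, Complex.normSq_eq_norm_sq, Complex.ofReal_re]

theorem IsGram.exists_trace {L q : ℕ} {M : Table X n N → Matrix α α ℂ} (h : IsGram L q M) :
    ∃ T : List ((Coord X N → ℕ) × MvPolynomial (Amplitude X n N) ℂ),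
    (∀ t ∈ T, IsWeightedHomogeneous (ampWeight (X := X) (n := n)) t.2 t.1 ∧
      ∑ c, t.1 c ≤ q ∧ ∀ c, t.1 c ≠ 0 → L < c.1.1) ∧
    ∀ y, (M y).trace.re = (T.map fun t => sqEval t.2 y).sum := by
  obtain ⟨T, hT, hM⟩ := h
  refine ⟨T.flatMap fun t => (Finset.univ : Finset α).toList.map fun a => (t.1, t.2 a),
    fun t ht => ?_, fun y => ?_⟩
  · simp only [List.mem_flatMap, List.mem_map] at ht
    obtain ⟨t', ht', a, -, rfl⟩ := ht
    exact ⟨(hT t' ht').1 a, (hT t' ht').2⟩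
  · rw [hM, trace_list_sum, List.map_map, ← Complex.coe_reAddGroupHom, map_list_sum, List.map_map,
      List.map_flatMap, sum_flatMap]
    congr 1
    refine List.map_congr_left fun t _ => ?_
    simp only [Function.comp, List.map_map, Complex.coe_reAddGroupHom, trace_re_rankOne]
    exact (Finset.sum_map_toList _ _).symm

/-- Random states are at least half as likely to be used by both parties at once as independent
random states. -/
theorem IsGram.integral_mul_integral_le {L q : ℕ} {M : Table X n N → Matrix α α ℂ}
    {M' : Table X n N → Matrix β β ℂ} (h : IsGram L q M) (h' : IsGram L q M')
    (hn : ∀ l, L < l → 2 * q ^ 2 ≤ 2 ^ n l) :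
    (∫ y, (M y).trace.re ∂(tableMeasure X n N)) * (∫ y, (M' y).trace.re ∂(tableMeasure X n N)) ≤
      2 * ∫ y, (M y).trace.re * (M' y).trace.re ∂(tableMeasure X n N) := by
  obtain ⟨T, hT, hM⟩ := h.exists_trace
  obtain ⟨T', hT', hM'⟩ := h'.exists_trace
  simp only [hM, hM']
  have hi : ∀ P : MvPolynomial (Amplitude X n N) ℂ, Integrable (sqEval P) (tableMeasure X n N) :=
    fun P => Continuous.integrable_of_compactSpace (continuous_sqEval P)
  have hi2 : ∀ P Q : MvPolynomial (Amplitude X n N) ℂ,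
      Integrable (fun y => sqEval P y * sqEval Q y) (tableMeasure X n N) :=
    fun P Q => Continuous.integrable_of_compactSpace
      ((continuous_sqEval P).mul (continuous_sqEval Q))
  have hli : ∀ T' : List ((Coord X N → ℕ) × MvPolynomial (Amplitude X n N) ℂ),
      Continuous fun y : Table X n N => (T'.map fun t => sqEval t.2 y).sum := fun T' =>
    continuous_list_sum _ fun t _ => continuous_sqEval t.2
  have hi3 : ∀ (t : (Coord X N → ℕ) × MvPolynomial (Amplitude X n N) ℂ)
      (T' : List ((Coord X N → ℕ) × MvPolynomial (Amplitude X n N) ℂ)),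
      Integrable (fun y => sqEval t.2 y * (T'.map fun t => sqEval t.2 y).sum)
        (tableMeasure X n N) :=
    fun t T' => Continuous.integrable_of_compactSpace ((continuous_sqEval t.2).mul (hli T'))
  have hi4 : ∀ T T' : List ((Coord X N → ℕ) × MvPolynomial (Amplitude X n N) ℂ),
      Integrable (fun y => (T.map fun t => sqEval t.2 y).sum * (T'.map fun t => sqEval t.2 y).sum)
        (tableMeasure X n N) :=
    fun T T' => Continuous.integrable_of_compactSpace ((hli T).mul (hli T'))
  -- Both sides are bilinear in the two lists, so the inequality for single polynomials is summed
  -- first over one list and then over the other.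
  have hsplit : ∀ t ∈ T, (∫ y, sqEval t.2 y ∂(tableMeasure X n N)) *
      (∫ y, (T'.map fun t => sqEval t.2 y).sum ∂(tableMeasure X n N)) ≤
      2 * ∫ y, sqEval t.2 y * (T'.map fun t => sqEval t.2 y).sum ∂(tableMeasure X n N) := by
    intro t ht
    clear hM' h'
    induction T' with
    | nil => simp
    | cons t' T' ih =>
      have ih' := ih fun t ht => hT' t (List.mem_cons_of_mem _ ht)
      have h1 := integral_mul_integral_sqEval_le_two_mul (hT t ht).1
        (hT' t' List.mem_cons_self).1 (hT t ht).2.1 (hT' t' List.mem_cons_self).2.1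
        fun c hc => hn _ ((hT t ht).2.2 c hc)
      simp only [List.map_cons, List.sum_cons, mul_add]
      rw [integral_add (hi _) (Continuous.integrable_of_compactSpace (hli T')),
        integral_add (hi2 _ _) (hi3 t T')]
      linarith
  clear hM h
  induction T with
  | nil => simp
  | cons t T ih =>
    have ih' := ih (fun t ht => hT t (List.mem_cons_of_mem _ ht))
      (fun t ht => hsplit t (List.mem_cons_of_mem _ ht))
    have h1 := hsplit t List.mem_cons_self
    simp only [List.map_cons, List.sum_cons, add_mul]
    rw [integral_add (hi _) (Continuous.integrable_of_compactSpace (hli T)),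
      integral_add (hi3 t T') (hi4 T T')]
    linarith

end Gram

/-! ## Interactions as sums over transcripts -/

section Heisenberg

variable {a b : ℕ}

/-- Real observables of the joint state that depend on the transcript. -/
abbrev Observable (a b : ℕ) : Type :=
  List Msg → Matrix (Fin a × Fin b) (Fin a × Fin b) ℂ →+ ℝ

/-- The expectation of an observable. -/
def Observable.expect (Φ : Observable a b) (σ : Ensemble a b) : ℝ :=
  (σ.map fun t => Φ t.1 t.2).sum

/-- `conj K` as a homomorphism. -/
def conjHom {α β : Type} [Fintype α] [Fintype β] (K : Matrix β α ℂ) : Matrix α α ℂ →+ Matrix β β ℂ :=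
  AddMonoidHom.mk' (conj K) (conj_add K)

/-- An observable before one round of interaction. -/
def Observable.pull (A : Behaviour a Msg) (B : Behaviour b Msg) (Φ : Observable a b) :
    Observable a b := fun t =>
  ((A t).map fun p => ((B (t ++ [p.1])).map fun q => (Φ (t ++ [p.1] ++ [q.1])).comp
    ((conjHom ((1 : Matrix (Fin a) (Fin a) ℂ) ⊗ₖ q.2)).comp
      (conjHom (p.2 ⊗ₖ (1 : Matrix (Fin b) (Fin b) ℂ))))).sum).sum

theorem list_sum_apply {M N ι : Type*} [AddMonoid M] [AddCommMonoid N] (l : List ι)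
    (f : ι → M →+ N) (x : M) : (l.map f).sum x = (l.map fun i => f i x).sum := by
  induction l with
  | nil => simp
  | cons i l ih => simp [ih]

theorem Observable.pull_apply (A : Behaviour a Msg) (B : Behaviour b Msg) (Φ : Observable a b)
    (t : List Msg) (ρ : Matrix (Fin a × Fin b) (Fin a × Fin b) ℂ) :
    Φ.pull A B t ρ = ((A t).map fun p => ((B (t ++ [p.1])).map fun q =>
      Φ (t ++ [p.1] ++ [q.1]) (onRight q.2 (onLeft p.2 ρ))).sum).sum := by
  unfold Observable.pull
  rw [list_sum_apply]
  congr 1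
  refine List.map_congr_left fun p _ => ?_
  rw [list_sum_apply]
  rfl

/-- Evolving the observable instead of the ensemble keeps the initial product state fixed. The sum
over transcripts then appears only when the pulled-back observable is evaluated on product states.
-/
theorem Observable.expect_round (A : Behaviour a Msg) (B : Behaviour b Msg) (Φ : Observable a b)
    (σ : Ensemble a b) : Φ.expect (round A B σ) = (Φ.pull A B).expect σ := by
  unfold Observable.expect round
  rw [List.flatMap_assoc, List.map_flatMap, sum_flatMap]
  congr 1
  refine List.map_congr_left fun t _ => ?_
  rw [List.flatMap_map, List.map_flatMap, sum_flatMap, Observable.pull_apply]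
  congr 1
  refine List.map_congr_left fun p _ => ?_
  rw [List.map_map]
  rfl

theorem Observable.expect_interact (A : Behaviour a Msg) (B : Behaviour b Msg) (Φ : Observable a b)
    (r : ℕ) (σ : Ensemble a b) :
    Φ.expect (interact A B r σ) = (((Observable.pull A B)^[r] Φ)).expect σ := by
  induction r generalizing σ with
  | zero => rfl
  | succ r ih =>
    rw [Function.iterate_succ_apply', ← Observable.expect_round, ← ih]
    rfl

end Heisenberg

/-! ### Factorization of transcript probabilities into the two parties' traces -/

section Products

variable {α β : Type} [Fintype α] [Fintype β] {O : Type}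

/-- Kraus operators with the same label are grouped, so that only the reported messages index the
transcripts. -/
theorem sum_ops_eq {M : Type*} [AddCommMonoid M] [DecidableEq O] (K : List (O × Matrix β α ℂ))
    (s : Finset O) (hs : ∀ p ∈ K, p.1 ∈ s) (f : O → Matrix β β ℂ →+ M) (ρ : Matrix α α ℂ) :
    (K.map fun p => f p.1 (conj p.2 ρ)).sum = ∑ o ∈ s, f o (act K (· = o) ρ) := by
  unfold act
  induction K with
  | nil => simp
  | cons p K ih =>
    simp only [List.map_cons, List.sum_cons, map_add, Finset.sum_add_distrib]
    rw [ih fun q hq => hs q (List.mem_cons_of_mem _ hq)]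
    congr 1
    rw [Finset.sum_eq_single p.1]
    · rw [if_pos rfl]
    · intro o _ ho
      rw [if_neg ho.symm, map_zero]
    · intro h
      exact absurd (hs p List.mem_cons_self) h

/-- The real part of the trace. -/
def traceRe : Matrix α α ℂ →+ ℝ :=
  Complex.reAddGroupHom.comp (Matrix.traceAddMonoidHom α ℂ)

theorem Complete.sum_trace_act [DecidableEq α] [DecidableEq O] {K : List (O × Matrix β α ℂ)}
    (hK : Complete K) (s : Finset O) (hs : ∀ p ∈ K, p.1 ∈ s) (ρ : Matrix α α ℂ) :
    ∑ o ∈ s, (act K (· = o) ρ).trace.re = ρ.trace.re := by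
  rw [← sum_trace_conj K hK]
  exact (sum_ops_eq K s hs (fun _ => traceRe) ρ).symm

theorem act_add_act_not (K : List (O × Matrix β α ℂ)) (P : O → Prop) (ρ : Matrix α α ℂ) :
    act K P ρ + act K (fun o => ¬ P o) ρ = act K (fun _ => True) ρ := by
  unfold act
  rw [← List.sum_map_add]
  congr 1
  refine List.map_congr_left fun p _ => ?_
  by_cases h : P p.1 <;> simp [h]

/-- `l ⊗ₖ ·` as a homomorphism. -/
def kroneckerLeft (l : Matrix α α ℂ) : Matrix β β ℂ →+ Matrix (α × β) (α × β) ℂ :=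
  AddMonoidHom.mk' (fun k => l ⊗ₖ k) fun _ _ => Matrix.kronecker_add _ _ _

/-- `· ⊗ₖ k` as a homomorphism. -/
def kroneckerRight (k : Matrix β β ℂ) : Matrix α α ℂ →+ Matrix (α × β) (α × β) ℂ :=
  AddMonoidHom.mk' (fun l => l ⊗ₖ k) fun _ _ => Matrix.add_kronecker _ _ _

variable {a b : ℕ}

theorem onLeft_kronecker (K l : Matrix (Fin a) (Fin a) ℂ) (k : Matrix (Fin b) (Fin b) ℂ) :
    onLeft K (l ⊗ₖ k) = conj K l ⊗ₖ k := by
  simp only [onLeft, conj, Matrix.conjTranspose_kronecker, ← Matrix.mul_kronecker_mul,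
    Matrix.conjTranspose_one, Matrix.one_mul, Matrix.mul_one]

theorem onRight_kronecker (K k : Matrix (Fin b) (Fin b) ℂ) (l : Matrix (Fin a) (Fin a) ℂ) :
    onRight K (l ⊗ₖ k) = l ⊗ₖ conj K k := by
  simp only [onRight, conj, Matrix.conjTranspose_kronecker, ← Matrix.mul_kronecker_mul,
    Matrix.conjTranspose_one, Matrix.one_mul, Matrix.mul_one]

theorem Observable.pull_kronecker {A : Behaviour a Msg} {B : Behaviour b Msg}
    {LA LB : List Msg → Finset Msg} (hA : ∀ t, ∀ p ∈ A t, p.1 ∈ LA t)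
    (hB : ∀ t, ∀ p ∈ B t, p.1 ∈ LB t) (Φ : Observable a b) (t : List Msg)
    (l : Matrix (Fin a) (Fin a) ℂ) (k : Matrix (Fin b) (Fin b) ℂ) :
    Φ.pull A B t (l ⊗ₖ k) = ∑ m ∈ LA t, ∑ m' ∈ LB (t ++ [m]),
      Φ (t ++ [m] ++ [m']) (act (A t) (· = m) l ⊗ₖ act (B (t ++ [m])) (· = m') k) := by
  rw [Observable.pull_apply]
  simp only [onLeft_kronecker, onRight_kronecker]
  have h1 : ∀ p : Msg × Matrix (Fin a) (Fin a) ℂ, ((B (t ++ [p.1])).map fun q =>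
      Φ (t ++ [p.1] ++ [q.1]) (conj p.2 l ⊗ₖ conj q.2 k)).sum =
      ∑ m' ∈ LB (t ++ [p.1]), Φ (t ++ [p.1] ++ [m'])
        (conj p.2 l ⊗ₖ act (B (t ++ [p.1])) (· = m') k) := fun p =>
    sum_ops_eq (B (t ++ [p.1])) (LB (t ++ [p.1])) (hB _)
      (fun m' => (Φ (t ++ [p.1] ++ [m'])).comp (kroneckerLeft (conj p.2 l))) k
  simp only [h1]
  have h2 := sum_ops_eq (A t) (LA t) (hA t) (fun m => ∑ m' ∈ LB (t ++ [m]),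
    (Φ (t ++ [m] ++ [m'])).comp (kroneckerRight (act (B (t ++ [m])) (· = m') k))) l
  simp only [AddMonoidHom.finsetSum_apply] at h2
  exact h2

/-- The continuations of the transcript `t` by `r` rounds with messages in given sets. -/
def transcripts (LA LB : List Msg → Finset Msg) : ℕ → List Msg → Finset (List Msg)
  | 0, _ => {[]}
  | r + 1, t => (LA t).biUnion fun m => (LB (t ++ [m])).biUnion fun m' =>
      (transcripts LA LB r (t ++ [m] ++ [m'])).image fun u => m :: m' :: u

theorem sum_transcripts_succ (LA LB : List Msg → Finset Msg) (r : ℕ) (t : List Msg) {M : Type*}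
    [AddCommMonoid M] (f : List Msg → M) :
    ∑ u ∈ transcripts LA LB (r + 1) t, f u = ∑ m ∈ LA t, ∑ m' ∈ LB (t ++ [m]),
      ∑ u ∈ transcripts LA LB r (t ++ [m] ++ [m']), f (m :: m' :: u) := by
  rw [transcripts, Finset.sum_biUnion]
  · refine Finset.sum_congr rfl fun m _ => ?_
    rw [Finset.sum_biUnion]
    · refine Finset.sum_congr rfl fun m' _ => ?_
      rw [Finset.sum_image]
      intro u _ u' _ h
      simpa using h
    · intro m' _ m'' _ h
      rw [Function.onFun, Finset.disjoint_left]
      intro u hu hu'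
      simp only [Finset.mem_image] at hu hu'
      obtain ⟨v, -, rfl⟩ := hu
      obtain ⟨v', -, hv'⟩ := hu'
      simp only [List.cons.injEq, true_and] at hv'
      exact h hv'.1.symm
  · intro m' _ m'' _ h
    rw [Function.onFun, Finset.disjoint_left]
    intro u hu hu'
    simp only [Finset.mem_image, Finset.mem_biUnion] at hu hu'
    obtain ⟨_, -, v, -, rfl⟩ := hu
    obtain ⟨_, -, v', -, hv'⟩ := hu'
    simp only [List.cons.injEq] at hv'
    exact h hv'.1.symm

theorem length_of_mem_transcripts {LA LB : List Msg → Finset Msg} {r : ℕ} {t u : List Msg}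
    (hu : u ∈ transcripts LA LB r t) : u.length = 2 * r := by
  induction r generalizing t u with
  | zero =>
    simp only [transcripts, Finset.mem_singleton] at hu
    simp [hu]
  | succ r ih =>
    simp only [transcripts, Finset.mem_image, Finset.mem_biUnion] at hu
    obtain ⟨_, -, _, -, v, hv, rfl⟩ := hu
    simp only [List.length_cons, ih hv]
    ring

/-- The state of a party after the continuation `u` of the transcript; `F` describes what the party
does in one round. -/
def run {M : Type*} (F : List Msg → Msg → Msg → M → M) : List Msg → M → List Msg → M
  | t, ρ, m :: m' :: u => run F (t ++ [m] ++ [m']) (F t m m' ρ) u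
  | _, ρ, [] => ρ
  | _, ρ, [_] => ρ

/-- One round, as seen by the left party. -/
def leftRound (A : Behaviour a Msg) (t : List Msg) (m _m' : Msg) (ρ : Matrix (Fin a) (Fin a) ℂ) :
    Matrix (Fin a) (Fin a) ℂ := act (A t) (· = m) ρ

/-- One round, as seen by the right party. -/
def rightRound (B : Behaviour b Msg) (t : List Msg) (m m' : Msg) (ρ : Matrix (Fin b) (Fin b) ℂ) :
    Matrix (Fin b) (Fin b) ℂ := act (B (t ++ [m])) (· = m') ρ

theorem Observable.pull_iterate_kronecker {A : Behaviour a Msg} {B : Behaviour b Msg}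
    {LA LB : List Msg → Finset Msg} (hA : ∀ t, ∀ p ∈ A t, p.1 ∈ LA t)
    (hB : ∀ t, ∀ p ∈ B t, p.1 ∈ LB t) (Φ : Observable a b) (r : ℕ) (t : List Msg)
    (l : Matrix (Fin a) (Fin a) ℂ) (k : Matrix (Fin b) (Fin b) ℂ) :
    (Observable.pull A B)^[r] Φ t (l ⊗ₖ k) = ∑ u ∈ transcripts LA LB r t,
      Φ (t ++ u) (run (leftRound A) t l u ⊗ₖ run (rightRound B) t k u) := by
  induction r generalizing t l k with
  | zero => simp [transcripts, run]
  | succ r ih =>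
    rw [Function.iterate_succ_apply', Observable.pull_kronecker hA hB, sum_transcripts_succ]
    refine Finset.sum_congr rfl fun m _ => Finset.sum_congr rfl fun m' _ => ?_
    rw [ih]
    refine Finset.sum_congr rfl fun u _ => ?_
    simp only [run, leftRound, rightRound, List.append_assoc, List.cons_append, List.nil_append]

/-- Total probability is conserved round by round because each local operation is trace preserving.
The behaviours are arbitrary, so this also covers parties that use different generators. -/
theorem sum_trace_run_mul {A : Behaviour a Msg} {B : Behaviour b Msg}
    {LA LB : List Msg → Finset Msg} (hA : ∀ t, ∀ p ∈ A t, p.1 ∈ LA t)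
    (hB : ∀ t, ∀ p ∈ B t, p.1 ∈ LB t) (hA' : ∀ t, Complete (A t)) (hB' : ∀ t, Complete (B t))
    (r : ℕ) (t : List Msg) (l : Matrix (Fin a) (Fin a) ℂ) (k : Matrix (Fin b) (Fin b) ℂ) :
    ∑ u ∈ transcripts LA LB r t, (run (leftRound A) t l u).trace.re *
      (run (rightRound B) t k u).trace.re = l.trace.re * k.trace.re := by
  induction r generalizing t l k with
  | zero => simp [transcripts, run]
  | succ r ih =>
    rw [sum_transcripts_succ]
    simp only [run, ih, leftRound, rightRound]
    simp only [← Finset.mul_sum, (hB' _).sum_trace_act _ (hB _)]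
    simp only [← Finset.sum_mul, (hA' _).sum_trace_act _ (hA _)]

theorem run_induction {M : Type*} {F : List Msg → Msg → Msg → M → M} {P : M → Prop}
    (hF : ∀ t m m' ρ, P ρ → P (F t m m' ρ)) (t : List Msg) {ρ : M} (hρ : P ρ) (u : List Msg) :
    P (run F t ρ u) := by
  induction t, ρ, u using run.induct F with
  | case1 t ρ m m' u ih => exact ih (hF _ _ _ _ hρ)
  | case2 t ρ => exact hρ
  | case3 t ρ m => exact hρ

theorem run_congr {M : Type*} {F F' : List Msg → Msg → Msg → M → M} (t : List Msg) (ρ : M)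
    (h : ∀ u m m' ρ, F (t ++ u) m m' ρ = F' (t ++ u) m m' ρ) (u : List Msg) :
    run F t ρ u = run F' t ρ u := by
  induction t, ρ, u using run.induct F with
  | case1 t ρ m m' u ih =>
    simp only [run]
    have h0 := h [] m m' ρ
    rw [List.append_nil] at h0
    rw [← h0]
    refine ih fun v m₁ m₂ ρ => ?_
    have := h ([m] ++ ([m'] ++ v)) m₁ m₂ ρ
    simpa only [List.append_assoc] using this
  | case2 t ρ => rfl
  | case3 t ρ m => rfl

theorem run_smul {F : List Msg → Msg → Msg → Matrix (Fin a) (Fin a) ℂ → Matrix (Fin a) (Fin a) ℂ}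
    (hF : ∀ t m m' (c : ℝ) ρ, F t m m' (c • ρ) = c • F t m m' ρ) (t : List Msg) (c : ℝ)
    (ρ : Matrix (Fin a) (Fin a) ℂ) (u : List Msg) : run F t (c • ρ) u = c • run F t ρ u := by
  induction t, ρ, u using run.induct F with
  | case1 t ρ m m' u ih => simp only [run, hF, ih]
  | case2 t ρ => rfl
  | case3 t ρ m => rfl

theorem trace_re_kronecker {l : Matrix (Fin a) (Fin a) ℂ} (hl : l.PosSemidef)
    (k : Matrix (Fin b) (Fin b) ℂ) : (l ⊗ₖ k).trace.re = l.trace.re * k.trace.re := by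
  have h : l.trace.im = 0 := (Complex.nonneg_iff.mp hl.trace_nonneg).2.symm
  rw [Matrix.trace_kronecker, Complex.mul_re, h]
  ring

open Classical in
/-- The observable whose expectation is the probability that the right party outputs `o`. -/
def outObservable (B : Behaviour b O) (o : O) : Observable a b := fun t =>
  ((B t).map fun p => if p.1 = o then
    traceRe.comp (conjHom ((1 : Matrix (Fin a) (Fin a) ℂ) ⊗ₖ p.2)) else 0).sum

theorem expect_outObservable (B : Behaviour b O) (o : O) (σ : Ensemble a b) :
    (outObservable B o).expect σ = probOut B o σ := by
  unfold Observable.expect probOut outObservable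
  congr 1
  refine List.map_congr_left fun t _ => ?_
  rw [list_sum_apply]
  congr 1
  refine List.map_congr_left fun p _ => ?_
  split_ifs <;> rfl

theorem outObservable_kronecker (B : Behaviour b O) (o : O) (t : List Msg)
    {l : Matrix (Fin a) (Fin a) ℂ} (hl : l.PosSemidef) (k : Matrix (Fin b) (Fin b) ℂ) :
    outObservable B o t (l ⊗ₖ k) = l.trace.re * (act (B t) (· = o) k).trace.re := by
  unfold outObservable act
  rw [list_sum_apply]
  generalize B t = K
  induction K with
  | nil => simp
  | cons p K ih =>
    simp only [List.map_cons, List.sum_cons, Matrix.trace_add, Complex.add_re, mul_add] at ih ⊢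
    rw [ih]
    congr 1
    split_ifs
    · have : traceRe.comp (conjHom ((1 : Matrix (Fin a) (Fin a) ℂ) ⊗ₖ p.2)) (l ⊗ₖ k) =
        (onRight p.2 (l ⊗ₖ k)).trace.re := rfl
      rw [this, onRight_kronecker, trace_re_kronecker hl]
    · simp

/-- The state `|0⟩⟨0|`. -/
def zeroState (a : ℕ) : Matrix (Fin (a + 1)) (Fin (a + 1)) ℂ := Matrix.single 0 0 1

theorem zeroState_posSemidef (a : ℕ) : (zeroState a).PosSemidef := by
  have h : zeroState a = (Matrix.single 0 0 1 : Matrix (Fin (a + 1)) (Fin (a + 1)) ℂ)ᴴ *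
      Matrix.single 0 0 1 := by
    simp [zeroState, Matrix.conjTranspose_single]
  rw [h]
  exact Matrix.posSemidef_conjTranspose_mul_self _

theorem trace_zeroState (a : ℕ) : (zeroState a).trace.re = 1 := by
  simp [zeroState]

theorem leftRound_posSemidef (A : Behaviour a Msg) (t : List Msg) (m m' : Msg)
    (ρ : Matrix (Fin a) (Fin a) ℂ) (h : ρ.PosSemidef) : (leftRound A t m m' ρ).PosSemidef :=
  act_posSemidef _ _ h

theorem rightRound_posSemidef (A : Behaviour a Msg) (t : List Msg) (m m' : Msg)
    (ρ : Matrix (Fin a) (Fin a) ℂ) (h : ρ.PosSemidef) : (rightRound A t m m' ρ).PosSemidef :=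
  act_posSemidef _ _ h

/-- Classical communication keeps the state a product for each transcript. This is the only place
where the absence of shared entanglement enters, apart from the two-phase version that follows. -/
theorem probOut_interact {A : Behaviour (a + 1) Msg} {B : Behaviour (b + 1) Msg}
    {LA LB : List Msg → Finset Msg} (hA : ∀ t, ∀ p ∈ A t, p.1 ∈ LA t)
    (hB : ∀ t, ∀ p ∈ B t, p.1 ∈ LB t) (B' : Behaviour (b + 1) O) (o : O) (r : ℕ) :
    probOut B' o (interact A B r (start a b)) = ∑ u ∈ transcripts LA LB r [],
      (run (leftRound A) [] (zeroState a) u).trace.re *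
        (act (B' u) (· = o) (run (rightRound B) [] (zeroState b) u)).trace.re := by
  rw [← expect_outObservable, Observable.expect_interact]
  have hs : (Matrix.single (0, 0) (0, 0) 1 :
      Matrix (Fin (a + 1) × Fin (b + 1)) (Fin (a + 1) × Fin (b + 1)) ℂ) =
      zeroState a ⊗ₖ zeroState b := by
    simp [zeroState, Matrix.single_kronecker_single]
  simp only [Observable.expect, start, List.map_cons, List.map_nil, List.sum_cons, List.sum_nil,
    add_zero]
  rw [hs, Observable.pull_iterate_kronecker hA hB]
  refine Finset.sum_congr rfl fun u _ => ?_
  exact outObservable_kronecker _ _ _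
    (run_induction (leftRound_posSemidef A) _ (zeroState_posSemidef a) _) _

theorem probOut_interact_interact {A A' : Behaviour (a + 1) Msg} {B B' : Behaviour (b + 1) Msg}
    {LA LB LA' LB' : List Msg → Finset Msg} (hA : ∀ t, ∀ p ∈ A t, p.1 ∈ LA t)
    (hB : ∀ t, ∀ p ∈ B t, p.1 ∈ LB t) (hA' : ∀ t, ∀ p ∈ A' t, p.1 ∈ LA' t)
    (hB' : ∀ t, ∀ p ∈ B' t, p.1 ∈ LB' t) (B'' : Behaviour (b + 1) O) (o : O) (r r' : ℕ) :
    probOut B'' o (interact A' B' r' (interact A B r (start a b))) =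
      ∑ u ∈ transcripts LA LB r [], ∑ v ∈ transcripts LA' LB' r' u,
        (run (leftRound A') u (run (leftRound A) [] (zeroState a) u) v).trace.re *
          (act (B'' (u ++ v)) (· = o)
            (run (rightRound B') u (run (rightRound B) [] (zeroState b) u) v)).trace.re := by
  rw [← expect_outObservable, Observable.expect_interact, Observable.expect_interact]
  have hs : (Matrix.single (0, 0) (0, 0) 1 :
      Matrix (Fin (a + 1) × Fin (b + 1)) (Fin (a + 1) × Fin (b + 1)) ℂ) =
      zeroState a ⊗ₖ zeroState b := by
    simp [zeroState, Matrix.single_kronecker_single]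
  simp only [Observable.expect, start, List.map_cons, List.map_nil, List.sum_cons, List.sum_nil,
    add_zero]
  rw [hs, Observable.pull_iterate_kronecker hA hB]
  refine Finset.sum_congr rfl fun u _ => ?_
  rw [List.nil_append, Observable.pull_iterate_kronecker hA' hB']
  refine Finset.sum_congr rfl fun v _ => ?_
  exact outObservable_kronecker _ _ _ (run_induction (leftRound_posSemidef A') _
    (run_induction (leftRound_posSemidef A) _ (zeroState_posSemidef a) _) _) _

end Products

/-! ## The states of the honest parties, given the transcript -/

section Honest

theorem continuous_run {M Y : Type*} [TopologicalSpace M] [TopologicalSpace Y]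
    {F : Y → List Msg → Msg → Msg → M → M}
    (hF : ∀ t m m' (ρ : Y → M), Continuous ρ → Continuous fun y => F y t m m' (ρ y)) (t : List Msg)
    {ρ : Y → M} (hρ : Continuous ρ) (u : List Msg) : Continuous fun y => run (F y) t (ρ y) u := by
  induction hu : u.length using Nat.strong_induction_on generalizing t ρ u with
  | _ k ih =>
    match u, hu with
    | [], _ => simpa only [run] using hρ
    | [_], _ => simpa only [run] using hρ
    | m :: m' :: u, hu =>
      simp only [run]
      exact ih u.length (by simp only [List.length_cons] at hu; omega) _ (hF t m m' ρ hρ) u rfl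

variable {X : ℕ → Type} [∀ l, Fintype (X l)] [∀ l, DecidableEq (X l)] {n : ℕ → ℕ}

/-- The degree is charged once per message, though a party acts only once per pair of messages; the
generous bound avoids halving the length. -/
theorem IsGram.run {N L q q₀ : ℕ} {α : Type} [Fintype α]
    {F : Table X n N → List Msg → Msg → Msg → Matrix α α ℂ → Matrix α α ℂ}
    (hF : ∀ q t m m' (ρ : Table X n N → Matrix α α ℂ), IsGram L q ρ →
      IsGram L (q + q₀) fun y => F y t m m' (ρ y)) (t : List Msg)
    {ρ : Table X n N → Matrix α α ℂ} (hρ : IsGram L q ρ) (u : List Msg) :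
    IsGram L (q + u.length * q₀) fun y => QCCC.run (F y) t (ρ y) u := by
  induction hu : u.length using Nat.strong_induction_on generalizing t ρ u q with
  | _ k ih =>
    subst hu
    match u with
    | [] => exact hρ.mono (Nat.le_add_right _ _)
    | [_] => exact hρ.mono (Nat.le_add_right _ _)
    | m :: m' :: u =>
      simp only [QCCC.run]
      refine (ih u.length (by simp) _ (hF q t m m' ρ hρ) u rfl).mono ?_
      simp only [List.length_cons]
      nlinarith

/-- A finite set that contains all outputs of a computation. -/
def Prog.labels {O : Type} {e d : ℕ} (p : Prog X n O e d) : Finset O := p.exists_labels.choose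

theorem Prog.mem_labels {O : Type} {e d : ℕ} (p : Prog X n O e d) (G : Generator X n) :
    ∀ q ∈ p.kraus G, q.1 ∈ p.labels := p.exists_labels.choose_spec G

namespace CommitmentAt

variable (C : CommitmentAt X n)

/-- The transcripts of the commit phase. -/
def commitTranscripts : Finset (List Msg) :=
  transcripts (fun t => (C.cCommit false t).labels ∪ (C.cCommit true t).labels)
    (fun t => (C.rCommit t).labels) C.commitRounds []

/-- The continuations by the reveal phase of the transcript `u`. -/
def revealTranscripts (u : List Msg) : Finset (List Msg) :=
  transcripts (fun t => (C.cReveal false t).labels ∪ (C.cReveal true t).labels)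
    (fun t => (C.rReveal t).labels) C.revealRounds u

/-- The committer's state after the commit phase. -/
def cState (b : Bool) (G : Generator X n) (u : List Msg) :
    Matrix (Fin (C.cDim + 1)) (Fin (C.cDim + 1)) ℂ :=
  run (leftRound fun t => (C.cCommit b t).kraus G) [] (zeroState C.cDim) u

/-- The committer's state after the reveal phase, if it was `ρ` after the commit phase. -/
def cFinal (b : Bool) (G : Generator X n) (u : List Msg)
    (ρ : Matrix (Fin (C.cDim + 1)) (Fin (C.cDim + 1)) ℂ) (v : List Msg) :
    Matrix (Fin (C.cDim + 1)) (Fin (C.cDim + 1)) ℂ :=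
  run (leftRound fun t => (C.cReveal b t).kraus G) u ρ v

/-- The receiver's state after the commit phase. -/
def rState (G : Generator X n) (u : List Msg) : Matrix (Fin (C.rDim + 1)) (Fin (C.rDim + 1)) ℂ :=
  run (rightRound fun t => (C.rCommit t).kraus G) [] (zeroState C.rDim) u

/-- The receiver's state after the reveal phase. -/
def rFinal (G : Generator X n) (u v : List Msg) : Matrix (Fin (C.rDim + 1)) (Fin (C.rDim + 1)) ℂ :=
  run (rightRound fun t => (C.rReveal t).kraus G) u (C.rState G u) v

/-- The receiver's part of the probability of the transcript and an output in `P`. -/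
def outWeight (P : Option Bool → Prop) (G : Generator X n) (u v : List Msg) : ℝ :=
  (act ((C.rOutput (u ++ v)).kraus G) P (C.rFinal G u v)).trace.re

theorem cState_posSemidef (b : Bool) (G : Generator X n) (u : List Msg) :
    (C.cState b G u).PosSemidef :=
  run_induction (leftRound_posSemidef _) _ (zeroState_posSemidef _) _

theorem cFinal_posSemidef (b : Bool) (G : Generator X n) (u : List Msg)
    {ρ : Matrix (Fin (C.cDim + 1)) (Fin (C.cDim + 1)) ℂ} (hρ : ρ.PosSemidef) (v : List Msg) :
    (C.cFinal b G u ρ v).PosSemidef :=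
  run_induction (leftRound_posSemidef _) _ hρ _

theorem rState_posSemidef (G : Generator X n) (u : List Msg) : (C.rState G u).PosSemidef :=
  run_induction (rightRound_posSemidef _) _ (zeroState_posSemidef _) _

theorem rFinal_posSemidef (G : Generator X n) (u v : List Msg) : (C.rFinal G u v).PosSemidef :=
  run_induction (rightRound_posSemidef _) _ (C.rState_posSemidef G u) _

theorem outWeight_nonneg (P : Option Bool → Prop) (G : Generator X n) (u v : List Msg) :
    0 ≤ C.outWeight P G u v :=
  trace_re_nonneg (act_posSemidef _ _ (C.rFinal_posSemidef G u v))

theorem cFinal_smul (b : Bool) (G : Generator X n) (u : List Msg) (c : ℝ)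
    (ρ : Matrix (Fin (C.cDim + 1)) (Fin (C.cDim + 1)) ℂ) (v : List Msg) :
    C.cFinal b G u (c • ρ) v = c • C.cFinal b G u ρ v :=
  run_smul (F := leftRound fun t => (C.cReveal b t).kraus G) (fun _ _ _ c ρ => act_smul _ _ c ρ)
    _ _ _ _

theorem outWeight_add_outWeight_not (P : Option Bool → Prop) (G : Generator X n) (u v : List Msg) :
    C.outWeight P G u v + C.outWeight (fun o => ¬ P o) G u v = (C.rFinal G u v).trace.re := by
  unfold outWeight
  rw [← Complex.add_re, ← Matrix.trace_add, act_add_act_not,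
    ((C.rOutput (u ++ v)).complete_kraus G).trace_act_true]

theorem cCommit_labels (b : Bool) (G : Generator X n) (t : List Msg) :
    ∀ p ∈ (C.cCommit b t).kraus G, p.1 ∈ (C.cCommit false t).labels ∪ (C.cCommit true t).labels := by
  intro p hp
  cases b
  · exact Finset.mem_union_left _ (Prog.mem_labels _ G p hp)
  · exact Finset.mem_union_right _ (Prog.mem_labels _ G p hp)

theorem cReveal_labels (b : Bool) (G : Generator X n) (t : List Msg) :
    ∀ p ∈ (C.cReveal b t).kraus G, p.1 ∈ (C.cReveal false t).labels ∪ (C.cReveal true t).labels := by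
  intro p hp
  cases b
  · exact Finset.mem_union_left _ (Prog.mem_labels _ G p hp)
  · exact Finset.mem_union_right _ (Prog.mem_labels _ G p hp)

theorem completeness_eq (G : Generator X n) : C.completeness G = (1 / 2) * ∑ b : Bool,
    ∑ u ∈ C.commitTranscripts, ∑ v ∈ C.revealTranscripts u,
      (C.cFinal b G u (C.cState b G u) v).trace.re * C.outWeight (· = some b) G u v := by
  unfold completeness
  congr 1
  refine Finset.sum_congr rfl fun b _ => ?_
  exact probOut_interact_interact (C.cCommit_labels b G) (fun t => (C.rCommit t).mem_labels G)
    (C.cReveal_labels b G) (fun t => (C.rReveal t).mem_labels G) _ _ _ _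

/-- The parties may use different generators. -/
theorem sum_trace_cState_mul (b : Bool) (G G' : Generator X n) :
    ∑ u ∈ C.commitTranscripts, (C.cState b G u).trace.re * (C.rState G' u).trace.re = 1 := by
  refine (sum_trace_run_mul (C.cCommit_labels b G) (fun t => (C.rCommit t).mem_labels G')
    (fun t => (C.cCommit b t).complete_kraus G) (fun t => (C.rCommit t).complete_kraus G')
    _ _ _ _).trans ?_
  rw [trace_zeroState, trace_zeroState, one_mul]

theorem sum_trace_cFinal_mul (b : Bool) (G G' : Generator X n) (u : List Msg)
    (ρ : Matrix (Fin (C.cDim + 1)) (Fin (C.cDim + 1)) ℂ) :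
    ∑ v ∈ C.revealTranscripts u, (C.cFinal b G u ρ v).trace.re * (C.rFinal G' u v).trace.re =
      ρ.trace.re * (C.rState G' u).trace.re :=
  sum_trace_run_mul (C.cReveal_labels b G) (fun t => (C.rReveal t).mem_labels G')
    (fun t => (C.cReveal b t).complete_kraus G) (fun t => (C.rReveal t).complete_kraus G') _ _ _ _

theorem one_sub_completeness_eq (G : Generator X n) : 1 - C.completeness G = (1 / 2) * ∑ b : Bool,
    ∑ u ∈ C.commitTranscripts, ∑ v ∈ C.revealTranscripts u,
      (C.cFinal b G u (C.cState b G u) v).trace.re *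
        C.outWeight (fun o => ¬ o = some b) G u v := by
  have h : ∀ b : Bool, ∑ u ∈ C.commitTranscripts, ∑ v ∈ C.revealTranscripts u,
      (C.cFinal b G u (C.cState b G u) v).trace.re * C.outWeight (· = some b) G u v +
      ∑ u ∈ C.commitTranscripts, ∑ v ∈ C.revealTranscripts u,
      (C.cFinal b G u (C.cState b G u) v).trace.re *
        C.outWeight (fun o => ¬ o = some b) G u v = 1 := by
    intro b
    simp only [← Finset.sum_add_distrib, ← mul_add, C.outWeight_add_outWeight_not,
      C.sum_trace_cFinal_mul, C.sum_trace_cState_mul]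
  rw [completeness_eq]
  simp only [Fintype.sum_bool]
  linarith [h true, h false]

theorem continuous_cState (b : Bool) (u : List Msg) : Continuous fun G => C.cState b G u :=
  continuous_run (F := fun G : Generator X n => leftRound fun t => (C.cCommit b t).kraus G)
    (fun t _ _ _ hρ => (C.cCommit b t).continuous_act _ continuous_id hρ) _ continuous_const _

theorem continuous_cFinal (b : Bool) (u v : List Msg)
    {ρ : Generator X n → Matrix (Fin (C.cDim + 1)) (Fin (C.cDim + 1)) ℂ} (hρ : Continuous ρ) :
    Continuous fun G => C.cFinal b G u (ρ G) v :=
  continuous_run (F := fun G : Generator X n => leftRound fun t => (C.cReveal b t).kraus G)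
    (fun t _ _ _ hρ => (C.cReveal b t).continuous_act _ continuous_id hρ) _ hρ _

theorem continuous_rState (u : List Msg) : Continuous fun G => C.rState G u :=
  continuous_run (F := fun G : Generator X n => rightRound fun t => (C.rCommit t).kraus G)
    (fun t m _ _ hρ => (C.rCommit (t ++ [m])).continuous_act _ continuous_id hρ) _
    continuous_const _

theorem continuous_rFinal (u v : List Msg) : Continuous fun G => C.rFinal G u v :=
  continuous_run (F := fun G : Generator X n => rightRound fun t => (C.rReveal t).kraus G)
    (fun t m _ _ hρ => (C.rReveal (t ++ [m])).continuous_act _ continuous_id hρ) _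
    (C.continuous_rState u) _

theorem continuous_traceRe {α Y : Type} [Fintype α] [TopologicalSpace Y] {ρ : Y → Matrix α α ℂ}
    (hρ : Continuous ρ) : Continuous fun y => (ρ y).trace.re :=
  Complex.continuous_re.comp hρ.matrix_trace

theorem continuous_outWeight (P : Option Bool → Prop) (u v : List Msg) :
    Continuous fun G => C.outWeight P G u v :=
  continuous_traceRe ((C.rOutput (u ++ v)).continuous_act P continuous_id (C.continuous_rFinal u v))

/-- Every local computation makes at most `q` queries, with keys of length at most `N`. -/
structure QueryBound (N q : ℕ) : Prop where
  cCommit : ∀ b t, (C.cCommit b t).Bounded N q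
  cReveal : ∀ b t, (C.cReveal b t).Bounded N q
  rCommit : ∀ t, (C.rCommit t).Bounded N q
  rReveal : ∀ t, (C.rReveal t).Bounded N q
  rOutput : ∀ t, (C.rOutput t).Bounded N q

theorem length_of_mem_commitTranscripts {u : List Msg} (hu : u ∈ C.commitTranscripts) :
    u.length = 2 * C.commitRounds := length_of_mem_transcripts hu

theorem length_of_mem_revealTranscripts {u v : List Msg} (hv : v ∈ C.revealTranscripts u) :
    v.length = 2 * C.revealRounds := length_of_mem_transcripts hv

variable {C}

theorem QueryBound.isGram_cFinal {N q : ℕ} (hC : C.QueryBound N q) (G : Generator X n) (L : ℕ)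
    (b : Bool) {u v : List Msg} (hu : u ∈ C.commitTranscripts) (hv : v ∈ C.revealTranscripts u) :
    IsGram L ((2 * C.commitRounds + 2 * C.revealRounds + 1) * q) fun y : Table X n N =>
      C.cFinal b (overwrite G L N y) u (C.cState b (overwrite G L N y) u) v := by
  have h1 : IsGram L (0 + u.length * q) fun y : Table X n N => C.cState b (overwrite G L N y) u :=
    IsGram.run (F := fun y => leftRound fun t => (C.cCommit b t).kraus (overwrite G L N y))
      (fun q' t m m' ρ h => h.act_kraus G _ (hC.cCommit b t) _) _ (isGram_single L 0 0) _
  have h2 := IsGram.run (F := fun y => leftRound fun t => (C.cReveal b t).kraus (overwrite G L N y))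
      (fun q' t m m' ρ h => h.act_kraus G _ (hC.cReveal b t) _) u h1 v
  rw [C.length_of_mem_commitTranscripts hu, C.length_of_mem_revealTranscripts hv] at h2
  exact h2.mono (by nlinarith)

theorem QueryBound.isGram_rFinal {N q : ℕ} (hC : C.QueryBound N q) (G : Generator X n) (L : ℕ)
    (P : Option Bool → Prop) {u v : List Msg} (hu : u ∈ C.commitTranscripts)
    (hv : v ∈ C.revealTranscripts u) :
    IsGram L ((2 * C.commitRounds + 2 * C.revealRounds + 1) * q) fun y : Table X n N =>
      act ((C.rOutput (u ++ v)).kraus (overwrite G L N y)) P (C.rFinal (overwrite G L N y) u v) := by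
  have h1 : IsGram L (0 + u.length * q) fun y : Table X n N => C.rState (overwrite G L N y) u :=
    IsGram.run (F := fun y => rightRound fun t => (C.rCommit t).kraus (overwrite G L N y))
      (fun q' t m m' ρ h => h.act_kraus G _ (hC.rCommit _) _) _ (isGram_single L 0 0) _
  have h2 := IsGram.run (F := fun y => rightRound fun t => (C.rReveal t).kraus (overwrite G L N y))
      (fun q' t m m' ρ h => h.act_kraus G _ (hC.rReveal _) _) u h1 v
  rw [C.length_of_mem_commitTranscripts hu, C.length_of_mem_revealTranscripts hv] at h2
  exact (h2.act_kraus G _ (hC.rOutput (u ++ v)) P).mono (by nlinarith)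

/-- If the two parties had independent random generators, the commitment would fail at most twice
as often. -/
theorem QueryBound.avg_mul_avg_le {N q L : ℕ} (hC : C.QueryBound N q) (G : Generator X n)
    (hn : ∀ l, L < l →
      2 * ((2 * C.commitRounds + 2 * C.revealRounds + 1) * q) ^ 2 ≤ 2 ^ n l)
    (b : Bool) (P : Option Bool → Prop) {u v : List Msg} (hu : u ∈ C.commitTranscripts)
    (hv : v ∈ C.revealTranscripts u) :
    avg G L N (fun G => (C.cFinal b G u (C.cState b G u) v).trace.re) *
      avg G L N (fun G => C.outWeight P G u v) ≤
      2 * avg G L N (fun G =>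
        (C.cFinal b G u (C.cState b G u) v).trace.re * C.outWeight P G u v) :=
  IsGram.integral_mul_integral_le (hC.isGram_cFinal G L b hu hv) (hC.isGram_rFinal G L P hu hv) hn

end CommitmentAt

end Honest

/-! ## Preparing a state -/

section Prepare

variable {α : Type} [Fintype α] [DecidableEq α]

/-- Discard the memory and prepare the state `Bᴴ B`. -/
def prepareOps (B : Matrix α α ℂ) : List (Unit × Matrix α α ℂ) :=
  (Finset.univ : Finset (α × α)).toList.map fun p => ((), Bᴴ * Matrix.single p.1 p.2 1)

theorem single_mul_mul_single (M : Matrix α α ℂ) (i j k l : α) :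
    Matrix.single i j (1 : ℂ) * M * Matrix.single k l 1 = M j k • Matrix.single i l 1 := by
  ext a b
  simp only [Matrix.mul_apply, Matrix.single_apply, Matrix.smul_apply, ite_and, smul_eq_mul]
  by_cases h1 : i = a <;> by_cases h2 : l = b <;> simp [h1, h2]

/-- The matrix units are Kraus operators of the map that replaces M by its trace times the identity.
Both properties of `prepareOps` reduce to this. -/
theorem sum_single_mul_mul_single (M : Matrix α α ℂ) :
    ∑ p : α × α, Matrix.single p.1 p.2 (1 : ℂ) * M * Matrix.single p.2 p.1 1 =
      M.trace • (1 : Matrix α α ℂ) := by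
  simp only [single_mul_mul_single]
  rw [Fintype.sum_prod_type]
  ext a b
  simp only [Matrix.sum_apply, Matrix.smul_apply, Matrix.single_apply, Matrix.one_apply, ite_and,
    smul_eq_mul, mul_ite, mul_one, mul_zero]
  by_cases h : a = b
  · subst h
    rw [Finset.sum_eq_single a]
    · simp [Matrix.trace]
    · intro c _ hc
      simp [hc]
    · simp
  · simp only [h, if_false]
    refine Finset.sum_eq_zero fun i _ => Finset.sum_eq_zero fun j _ => ?_
    by_cases h1 : i = a
    · subst h1
      simp [h]
    · simp [h1]

theorem complete_prepareOps {B : Matrix α α ℂ} (hB : (Bᴴ * B).trace = 1) :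
    Complete (prepareOps B) := by
  unfold Complete prepareOps
  rw [List.map_map]
  have h : ∀ p : α × α, ((fun q : Unit × Matrix α α ℂ => q.2ᴴ * q.2) ∘
      fun p : α × α => ((), Bᴴ * Matrix.single p.1 p.2 1)) p =
      Matrix.single p.2 p.1 (1 : ℂ) * (B * Bᴴ) * Matrix.single p.1 p.2 1 := by
    intro p
    simp [Matrix.conjTranspose_mul, Matrix.mul_assoc, Matrix.conjTranspose_single]
  rw [List.map_congr_left fun p _ => h p, Finset.sum_map_toList]
  rw [← (Equiv.prodComm α α).sum_comp]
  simp only [Equiv.prodComm_apply, Prod.fst_swap, Prod.snd_swap]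
  rw [sum_single_mul_mul_single, Matrix.trace_mul_comm, hB, one_smul]

theorem sum_conj_prepareOps (B : Matrix α α ℂ) {σ : Matrix α α ℂ} (hσ : σ.PosSemidef) :
    ((prepareOps B).map fun p => conj p.2 σ).sum = σ.trace.re • (Bᴴ * B) := by
  unfold prepareOps
  rw [List.map_map]
  have h : ∀ p : α × α, ((fun q : Unit × Matrix α α ℂ => conj q.2 σ) ∘
      fun p : α × α => ((), Bᴴ * Matrix.single p.1 p.2 1)) p =
      Bᴴ * (Matrix.single p.1 p.2 (1 : ℂ) * σ * Matrix.single p.2 p.1 1) * B := by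
    intro p
    simp [conj, Matrix.conjTranspose_mul, Matrix.mul_assoc, Matrix.conjTranspose_single]
  rw [List.map_congr_left fun p _ => h p, Finset.sum_map_toList, ← Finset.sum_mul,
    ← Finset.mul_sum, sum_single_mul_mul_single]
  have hσ' : σ.trace = (σ.trace.re : ℂ) := by
    refine Complex.ext rfl ?_
    rw [Complex.ofReal_im]
    exact (Complex.nonneg_iff.mp hσ.trace_nonneg).2.symm
  rw [hσ', Matrix.mul_smul, Matrix.mul_one, Matrix.smul_mul, Complex.ofReal_re]
  rfl

theorem act_list_sum {β O : Type} [Fintype β] (K : List (O × Matrix β α ℂ)) (P : O → Prop)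
    (l : List (Matrix α α ℂ)) : act K P l.sum = (l.map (act K P)).sum := by
  induction l with
  | nil => simp [act_zero]
  | cons a l ih => simp [act_add, ih]

theorem act_prepareOps_bind {O : Type} (B : Matrix α α ℂ) (K : List (O × Matrix α α ℂ))
    (P : O → Prop) {σ : Matrix α α ℂ} (hσ : σ.PosSemidef) :
    act ((prepareOps B).flatMap fun p => K.map fun q => (q.1, q.2 * p.2)) P σ =
      σ.trace.re • act K P (Bᴴ * B) := by
  rw [act_bind (prepareOps B) (fun _ => K), ← act_smul, ← sum_conj_prepareOps B hσ, act_list_sum,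
    List.map_map]
  rfl

end Prepare

/-! ## Attacks -/

section Attacks

variable {X : ℕ → Type} [∀ l, Fintype (X l)] [∀ l, DecidableEq (X l)] {n : ℕ → ℕ}

namespace CommitmentAt

variable (C : CommitmentAt X n)

/-- The receiver that behaves honestly with the generator `g` and guesses by the transcript. -/
def guessingReceiver (g : Generator X n) (guess : List Msg → Bool) : MalReceiver where
  dim := C.rDim
  act t := ⟨(C.rCommit t).kraus g, (C.rCommit t).complete_kraus g⟩
  guess t := ⟨[(guess t, 1)], by simp⟩

theorem hidingProb_guessingReceiver (g : Generator X n) (guess : List Msg → Bool)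
    (G : Generator X n) : C.hidingProb G (C.guessingReceiver g guess) =
      (1 / 2) * ∑ u ∈ C.commitTranscripts,
        (C.cState (guess u) G u).trace.re * (C.rState g u).trace.re := by
  unfold hidingProb
  congr 1
  have h : ∀ b : Bool, probOut (fun t => ((C.guessingReceiver g guess).guess t).ops) b
      (interact (fun t => (C.cCommit b t).kraus G)
        (fun t => ((C.guessingReceiver g guess).act t).ops) C.commitRounds
        (start C.cDim (C.guessingReceiver g guess).dim)) = ∑ u ∈ C.commitTranscripts,
        if guess u = b then (C.cState (guess u) G u).trace.re * (C.rState g u).trace.re else 0 := by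
    intro b
    refine (probOut_interact (C.cCommit_labels b G) (fun t => (C.rCommit t).mem_labels g) _ _ _).trans
      (Finset.sum_congr rfl fun u _ => ?_)
    simp only [guessingReceiver, act, List.map_cons, List.map_nil, List.sum_cons, List.sum_nil,
      add_zero]
    split_ifs with hb
    · subst hb
      simp only [conj, Matrix.one_mul, Matrix.conjTranspose_one, Matrix.mul_one]
      rfl
    · simp
  simp only [h]
  rw [Finset.sum_comm]
  refine Finset.sum_congr rfl fun u _ => ?_
  rw [Finset.sum_ite_eq, if_pos (Finset.mem_univ _)]

/-- The operation of an opening that prepares the state `(B u)ᴴ * B u` after the transcript `u` of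
the commit phase and continues honestly with `g₁ u`. -/
def switchingReveal (ch : Bool) (g₁ : List Msg → Generator X n)
    (B : List Msg → Matrix (Fin (C.cDim + 1)) (Fin (C.cDim + 1)) ℂ)
    (hB : ∀ u, ((B u)ᴴ * B u).trace = 1) (t : List Msg) :
    Instr (Fin (C.cDim + 1)) (Fin (C.cDim + 1)) Msg where
  ops :=
    if t.length = 2 * C.commitRounds then
      (prepareOps (B t)).flatMap fun p =>
        ((C.cReveal ch t).kraus (g₁ t)).map fun q => (q.1, q.2 * p.2)
    else (C.cReveal ch t).kraus (g₁ (t.take (2 * C.commitRounds)))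
  complete := by
    split_ifs
    · exact (complete_prepareOps (hB t)).bind fun _ => (C.cReveal ch t).complete_kraus (g₁ t)
    · exact (C.cReveal ch t).complete_kraus _

/-- The committer that commits honestly to `false` with the generator `g₀`, and at the start of the
reveal phase switches to the state `(B ch u)ᴴ * B ch u` and the generator `g₁ ch u`, where `u` is
the transcript and `ch` the challenge. -/
def switchingCommitter (g₀ : Generator X n) (g₁ : Bool → List Msg → Generator X n)
    (B : Bool → List Msg → Matrix (Fin (C.cDim + 1)) (Fin (C.cDim + 1)) ℂ)
    (hB : ∀ ch u, ((B ch u)ᴴ * B ch u).trace = 1) : MalCommitter where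
  dim := C.cDim
  commit t := ⟨(C.cCommit false t).kraus g₀, (C.cCommit false t).complete_kraus g₀⟩
  reveal ch := C.switchingReveal ch (g₁ ch) (B ch) (hB ch)

/-- The preparation discards the old memory, which survives only through its trace. Without any
reveal round nothing is prepared, and the formula still holds because the new state has trace one.
-/
theorem trace_run_switchingReveal (ch : Bool) (g₁ : List Msg → Generator X n)
    (B : List Msg → Matrix (Fin (C.cDim + 1)) (Fin (C.cDim + 1)) ℂ)
    (hB : ∀ u, ((B u)ᴴ * B u).trace = 1) {u : List Msg}
    (hu : u.length = 2 * C.commitRounds) {σ : Matrix (Fin (C.cDim + 1)) (Fin (C.cDim + 1)) ℂ}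
    (hσ : σ.PosSemidef) (v : List Msg) :
    (run (leftRound fun t => (C.switchingReveal ch g₁ B hB t).ops) u σ v).trace.re =
      σ.trace.re * (C.cFinal ch (g₁ u) u ((B u)ᴴ * B u) v).trace.re := by
  have h1 : (((B u)ᴴ * B u).trace).re = 1 := by rw [hB]; rfl
  match v with
  | [] => simp only [cFinal, run, h1, mul_one]
  | [_] => simp only [cFinal, run, h1, mul_one]
  | m :: m' :: v =>
    simp only [cFinal, run]
    have h2 : leftRound (fun t => (C.switchingReveal ch g₁ B hB t).ops) u m m' σ =
        σ.trace.re • leftRound (fun t => (C.cReveal ch t).kraus (g₁ u)) u m m'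
          ((B u)ᴴ * B u) := by
      simp only [leftRound, switchingReveal, if_pos hu]
      exact act_prepareOps_bind _ _ _ hσ
    have h3 : ∀ τ, run (leftRound fun t => (C.switchingReveal ch g₁ B hB t).ops)
        (u ++ [m] ++ [m']) τ v =
        run (leftRound fun t => (C.cReveal ch t).kraus (g₁ u)) (u ++ [m] ++ [m']) τ v := by
      intro τ
      refine run_congr _ _ (fun w m₁ m₂ τ => ?_) v
      simp only [leftRound, switchingReveal]
      -- Later transcripts are longer than the commit phase, so the state is prepared only once;
      -- their first 2 * `commitRounds` messages recover u and with it the generator in use.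
      rw [if_neg (by simp only [List.length_append, List.length_cons]; omega)]
      simp only [List.append_assoc]
      rw [← hu, List.take_left]
    rw [h2, h3, run_smul (F := leftRound fun t => (C.cReveal ch t).kraus (g₁ u))
      (fun _ _ _ c ρ => act_smul _ _ c ρ), Matrix.trace_smul, Complex.real_smul,
      Complex.re_ofReal_mul]

theorem bindingProb_switchingCommitter (g₀ : Generator X n) (g₁ : Bool → List Msg → Generator X n)
    (B : Bool → List Msg → Matrix (Fin (C.cDim + 1)) (Fin (C.cDim + 1)) ℂ)
    (hB : ∀ ch u, ((B ch u)ᴴ * B ch u).trace = 1) (G : Generator X n) :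
    C.bindingProb G (C.switchingCommitter g₀ g₁ B hB) =
      (1 / 2) * ∑ ch : Bool, ∑ u ∈ C.commitTranscripts, (C.cState false g₀ u).trace.re *
        ∑ v ∈ C.revealTranscripts u,
          (C.cFinal ch (g₁ ch u) u ((B ch u)ᴴ * B ch u) v).trace.re *
            C.outWeight (· = some ch) G u v := by
  unfold bindingProb
  congr 1
  refine Finset.sum_congr rfl fun ch _ => ?_
  have hlab : ∀ t, ∀ p ∈ ((C.switchingCommitter g₀ g₁ B hB).reveal ch t).ops,
      p.1 ∈ (C.cReveal false t).labels ∪ (C.cReveal true t).labels := by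
    intro t p hp
    simp only [switchingCommitter, switchingReveal] at hp
    by_cases ht : t.length = 2 * C.commitRounds
    · rw [if_pos ht] at hp
      obtain ⟨_, -, hp⟩ := List.mem_flatMap.mp hp
      obtain ⟨q, hq, rfl⟩ := List.mem_map.mp hp
      exact C.cReveal_labels ch _ t q hq
    · rw [if_neg ht] at hp
      exact C.cReveal_labels ch _ t p hp
  refine (probOut_interact_interact (a := C.cDim) (C.cCommit_labels false g₀)
    (fun t => (C.rCommit t).mem_labels G) hlab (fun t => (C.rReveal t).mem_labels G) _ _ _ _).trans
    (Finset.sum_congr rfl fun u hu => ?_)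
  rw [Finset.mul_sum]
  refine Finset.sum_congr rfl fun v hv => ?_
  rw [← mul_assoc, ← C.trace_run_switchingReveal ch (g₁ ch) (B ch) (hB ch)
    (C.length_of_mem_commitTranscripts hu) (C.cState_posSemidef false g₀ u)]
  rfl

end CommitmentAt

end Attacks

/-! ## Either hiding or binding can be broken -/

section Dichotomy

variable {X : ℕ → Type} [∀ l, Fintype (X l)] [∀ l, DecidableEq (X l)] {n : ℕ → ℕ}

theorem avg_sum_const_mul (G : Generator X n) (L N : ℕ) {ι : Type*} (s : Finset ι) (c : ι → ℝ)
    {f : ι → Generator X n → ℝ} (hf : ∀ i ∈ s, Continuous (f i)) :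
    avg G L N (fun G' => ∑ i ∈ s, c i * f i G') = ∑ i ∈ s, c i * avg G L N (f i) := by
  rw [avg_sum]
  · simp only [avg_const_mul]
  · exact fun i hi => continuous_const.mul (hf i hi)

theorem avg_sum_mul_const (G : Generator X n) (L N : ℕ) {ι : Type*} (s : Finset ι) (c : ι → ℝ)
    {f : ι → Generator X n → ℝ} (hf : ∀ i ∈ s, Continuous (f i)) :
    avg G L N (fun G' => ∑ i ∈ s, f i G' * c i) = ∑ i ∈ s, avg G L N (f i) * c i := by
  rw [avg_sum]
  · simp only [avg_mul_const]
  · exact fun i hi => (hf i hi).mul continuous_const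

open scoped MatrixOrder in
theorem exists_eq_conjTranspose_mul_self {α : Type} [Fintype α] [DecidableEq α]
    {ρ : Matrix α α ℂ} (hρ : ρ.PosSemidef) : ∃ B : Matrix α α ℂ, ρ = Bᴴ * B :=
  CStarAlgebra.nonneg_iff_eq_star_mul_self.mp hρ.nonneg

namespace CommitmentAt

variable (C : CommitmentAt X n) (G : Generator X n) (L N : ℕ)

/-- The mean weight of the committer's state after the commit phase. -/
def cMean (b : Bool) (u : List Msg) : ℝ := avg G L N fun G' => (C.cState b G' u).trace.re

/-- The mean weight of the receiver's state after the commit phase. -/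
def rMean (u : List Msg) : ℝ := avg G L N fun G' => (C.rState G' u).trace.re

/-- The mean weight of the receiver's state at the end, together with the output. -/
def outMean (P : Option Bool → Prop) (u v : List Msg) : ℝ := avg G L N fun G' => C.outWeight P G' u v

/-- The mean probability of the transcript `u` and a wrong output, if the committer and the receiver
use independent generators. -/
def failMean (b : Bool) (u : List Msg) : ℝ := ∑ v ∈ C.revealTranscripts u,
  avg G L N (fun G' => (C.cFinal b G' u (C.cState b G' u) v).trace.re) *
    C.outMean G L N (fun o => ¬ o = some b) u v

theorem continuous_trace_cState (b : Bool) (u : List Msg) :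
    Continuous fun G' => (C.cState b G' u).trace.re := continuous_traceRe (C.continuous_cState b u)

theorem continuous_trace_rState (u : List Msg) :
    Continuous fun G' => (C.rState G' u).trace.re := continuous_traceRe (C.continuous_rState u)

theorem continuous_trace_cFinal (b : Bool) (u v : List Msg) :
    Continuous fun G' => (C.cFinal b G' u (C.cState b G' u) v).trace.re :=
  continuous_traceRe (C.continuous_cFinal b u v (C.continuous_cState b u))

theorem cMean_nonneg (b : Bool) (u : List Msg) : 0 ≤ C.cMean G L N b u :=
  avg_nonneg _ _ _ fun _ => trace_re_nonneg (C.cState_posSemidef b _ u)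

theorem rMean_nonneg (u : List Msg) : 0 ≤ C.rMean G L N u :=
  avg_nonneg _ _ _ fun _ => trace_re_nonneg (C.rState_posSemidef _ u)

theorem outMean_nonneg (P : Option Bool → Prop) (u v : List Msg) : 0 ≤ C.outMean G L N P u v :=
  avg_nonneg _ _ _ fun _ => C.outWeight_nonneg P _ u v

theorem failMean_nonneg (b : Bool) (u : List Msg) : 0 ≤ C.failMean G L N b u :=
  Finset.sum_nonneg fun v _ => mul_nonneg (avg_nonneg _ _ _ fun _ => trace_re_nonneg
    (C.cFinal_posSemidef b _ u (C.cState_posSemidef b _ u) v)) (C.outMean_nonneg G L N _ u v)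

theorem sum_trace_cState_mul_rMean (b : Bool) (G' : Generator X n) :
    ∑ u ∈ C.commitTranscripts, (C.cState b G' u).trace.re * C.rMean G L N u = 1 := by
  have h : avg G L N (fun G'' => ∑ u ∈ C.commitTranscripts,
      (C.cState b G' u).trace.re * (C.rState G'' u).trace.re) = 1 := by
    simp only [C.sum_trace_cState_mul, avg_const]
  rwa [avg_sum_const_mul _ _ _ _ _ fun u _ => C.continuous_trace_rState u] at h

theorem sum_cMean_mul_rMean (b : Bool) :
    ∑ u ∈ C.commitTranscripts, C.cMean G L N b u * C.rMean G L N u = 1 := by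
  have h : avg G L N (fun G' => ∑ u ∈ C.commitTranscripts,
      (C.cState b G' u).trace.re * C.rMean G L N u) = 1 := by
    simp only [C.sum_trace_cState_mul_rMean, avg_const]
  rwa [avg_sum_mul_const _ _ _ _ _ fun u _ => C.continuous_trace_cState b u] at h

theorem sum_trace_cFinal_mul_outMean (b : Bool) (P : Option Bool → Prop) (G' : Generator X n)
    (u : List Msg) (ρ : Matrix (Fin (C.cDim + 1)) (Fin (C.cDim + 1)) ℂ) :
    ∑ v ∈ C.revealTranscripts u, (C.cFinal b G' u ρ v).trace.re * C.outMean G L N P u v +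
      ∑ v ∈ C.revealTranscripts u, (C.cFinal b G' u ρ v).trace.re *
        C.outMean G L N (fun o => ¬ P o) u v = ρ.trace.re * C.rMean G L N u := by
  have hc : ∀ v, Continuous fun G'' =>
      C.outWeight P G'' u v + C.outWeight (fun o => ¬ P o) G'' u v := fun v =>
    (C.continuous_outWeight P u v).add (C.continuous_outWeight _ u v)
  have h : avg G L N (fun G'' => ∑ v ∈ C.revealTranscripts u, (C.cFinal b G' u ρ v).trace.re *
      (C.outWeight P G'' u v + C.outWeight (fun o => ¬ P o) G'' u v)) =
      ρ.trace.re * C.rMean G L N u := by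
    simp only [C.outWeight_add_outWeight_not, C.sum_trace_cFinal_mul, avg_const_mul]
    rfl
  rw [avg_sum_const_mul _ _ _ _ _ fun v _ => hc v] at h
  rw [← h, ← Finset.sum_add_distrib]
  refine Finset.sum_congr rfl fun v _ => ?_
  rw [avg_add _ _ _ (C.continuous_outWeight P u v) (C.continuous_outWeight _ u v)]
  simp only [outMean]
  ring

theorem continuous_completeness : Continuous fun G' => C.completeness G' := by
  simp only [completeness_eq]
  exact continuous_const.mul (continuous_finsetSum _ fun b _ => continuous_finsetSum _ fun u _ =>
    continuous_finsetSum _ fun v _ =>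
      (C.continuous_trace_cFinal b u v).mul (C.continuous_outWeight _ u v))

variable {C L N} in
-- One factor 2 comes from the correlation inequality, the other from the uniform bit in the
-- definition of completeness.
theorem QueryBound.sum_failMean_le {q : ℕ} (hC : C.QueryBound N q)
    (hn : ∀ l, L < l →
      2 * ((2 * C.commitRounds + 2 * C.revealRounds + 1) * q) ^ 2 ≤ 2 ^ n l) :
    ∑ b : Bool, ∑ u ∈ C.commitTranscripts, C.failMean G L N b u ≤
      4 * avg G L N (fun G' => 1 - C.completeness G') := by
  have h : avg G L N (fun G' => 1 - C.completeness G') = (1 / 2) * ∑ b : Bool,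
      ∑ u ∈ C.commitTranscripts, ∑ v ∈ C.revealTranscripts u, avg G L N fun G' =>
        (C.cFinal b G' u (C.cState b G' u) v).trace.re *
          C.outWeight (fun o => ¬ o = some b) G' u v := by
    have hc : ∀ (b : Bool) (u v : List Msg), Continuous fun G' =>
        (C.cFinal b G' u (C.cState b G' u) v).trace.re *
          C.outWeight (fun o => ¬ o = some b) G' u v := fun b u v =>
      (C.continuous_trace_cFinal b u v).mul (C.continuous_outWeight _ u v)
    simp only [one_sub_completeness_eq]
    rw [avg_const_mul, avg_sum _ _ _ _ fun b _ => continuous_finsetSum _ fun u _ =>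
      continuous_finsetSum _ fun v _ => hc b u v]
    congr 1
    refine Finset.sum_congr rfl fun b _ => ?_
    rw [avg_sum _ _ _ _ fun u _ => continuous_finsetSum _ fun v _ => hc b u v]
    refine Finset.sum_congr rfl fun u _ => ?_
    rw [avg_sum _ _ _ _ fun v _ => hc b u v]
  rw [h, ← mul_assoc, Finset.mul_sum]
  refine Finset.sum_le_sum fun b _ => ?_
  rw [Finset.mul_sum]
  refine Finset.sum_le_sum fun u hu => ?_
  rw [Finset.mul_sum]
  refine Finset.sum_le_sum fun v hv => ?_
  refine (hC.avg_mul_avg_le G hn b _ hu hv).trans (le_of_eq ?_)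
  norm_num

/-- Maximum likelihood guessing. The receiver runs the honest program on a generator of its own, and
averaging fixes one that does at least as well as a random one. -/
theorem exists_guessingReceiver : ∃ g guess,
    (1 / 2) * ∑ u ∈ C.commitTranscripts,
      max (C.cMean G L N false u) (C.cMean G L N true u) * C.rMean G L N u ≤
      avg G L N fun G' => C.hidingProb G' (C.guessingReceiver g guess) := by
  set guess : List Msg → Bool := fun u => decide (C.cMean G L N false u ≤ C.cMean G L N true u)
    with hguess
  have hmax : ∀ u, max (C.cMean G L N false u) (C.cMean G L N true u) =
      C.cMean G L N (guess u) u := by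
    intro u
    by_cases h : C.cMean G L N false u ≤ C.cMean G L N true u
    · simp [hguess, h]
    · simp [hguess, h, le_of_not_ge h]
  have hc : Continuous fun g : Generator X n => ∑ u ∈ C.commitTranscripts,
      C.cMean G L N (guess u) u * (C.rState g u).trace.re :=
    continuous_finsetSum _ fun u _ => continuous_const.mul (C.continuous_trace_rState u)
  obtain ⟨y, hy⟩ := exists_avg_le G L N hc
  refine ⟨overwrite G L N y, guess, ?_⟩
  simp only [hidingProb_guessingReceiver]
  rw [avg_const_mul, avg_sum_mul_const _ _ _ _ _ fun u _ => C.continuous_trace_cState (guess u) u]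
  rw [avg_sum_const_mul _ _ _ _ _ fun u _ => C.continuous_trace_rState u] at hy
  simp only [hmax]
  exact mul_le_mul_of_nonneg_left hy (by norm_num)

/-- `failMean` divided by `cMean` is a ratio of two averages, so some generator has a ratio of
failure weight to committer weight that is at most ε larger. Its normalized committer state is the
one to prepare. If `cMean` vanishes, any state will do. -/
theorem exists_state (ch : Bool) (u : List Msg) {ε : ℝ} (hε : 0 < ε) :
    ∃ (g : Generator X n) (B : Matrix (Fin (C.cDim + 1)) (Fin (C.cDim + 1)) ℂ),
      (Bᴴ * B).trace = 1 ∧ C.cMean G L N ch u * (∑ v ∈ C.revealTranscripts u,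
        (C.cFinal ch g u (Bᴴ * B) v).trace.re * C.outMean G L N (fun o => ¬ o = some ch) u v) ≤
        C.failMean G L N ch u + ε * C.cMean G L N ch u := by
  rcases (C.cMean_nonneg G L N ch u).eq_or_lt with h0 | hpos
  · refine ⟨G, Matrix.single 0 0 1, ?_, ?_⟩
    · simp [Matrix.conjTranspose_single]
    · rw [← h0]
      simpa using C.failMean_nonneg G L N ch u
  · set F := C.cMean G L N ch u with hF
    set R := C.failMean G L N ch u / F + ε with hR
    have hc1 : Continuous fun g : Generator X n => ∑ v ∈ C.revealTranscripts u,
        (C.cFinal ch g u (C.cState ch g u) v).trace.re *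
          C.outMean G L N (fun o => ¬ o = some ch) u v :=
      continuous_finsetSum _ fun v _ => (C.continuous_trace_cFinal ch u v).mul continuous_const
    have hc2 : Continuous fun g : Generator X n => R * (C.cState ch g u).trace.re :=
      continuous_const.mul (C.continuous_trace_cState ch u)
    have hF0 : F ≠ 0 := hpos.ne'
    have havg : 0 < avg G L N (fun g => R * (C.cState ch g u).trace.re -
        ∑ v ∈ C.revealTranscripts u, (C.cFinal ch g u (C.cState ch g u) v).trace.re *
          C.outMean G L N (fun o => ¬ o = some ch) u v) := by
      rw [avg_sub _ _ _ hc2 hc1, avg_const_mul,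
        avg_sum_mul_const _ _ _ _ _ fun v _ => C.continuous_trace_cFinal ch u v]
      have h1 : avg G L N (fun g => (C.cState ch g u).trace.re) = F := rfl
      have h2 : ∑ v ∈ C.revealTranscripts u,
          avg G L N (fun g => (C.cFinal ch g u (C.cState ch g u) v).trace.re) *
          C.outMean G L N (fun o => ¬ o = some ch) u v = C.failMean G L N ch u := rfl
      rw [h1, h2, hR, add_mul, div_mul_cancel₀ _ hF0]
      have := mul_pos hε hpos
      linarith
    obtain ⟨y, hy⟩ := exists_avg_le G L N
      (f := fun g => R * (C.cState ch g u).trace.re - ∑ v ∈ C.revealTranscripts u,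
        (C.cFinal ch g u (C.cState ch g u) v).trace.re *
          C.outMean G L N (fun o => ¬ o = some ch) u v) (hc2.sub hc1)
    set g := overwrite G L N y with hg
    have hlt : ∑ v ∈ C.revealTranscripts u, (C.cFinal ch g u (C.cState ch g u) v).trace.re *
          C.outMean G L N (fun o => ¬ o = some ch) u v < R * (C.cState ch g u).trace.re := by
      have := havg.trans_le hy
      linarith
    set α := (C.cState ch g u).trace.re with hα
    have hα0 : 0 ≤ α := trace_re_nonneg (C.cState_posSemidef ch g u)
    -- The slack ε made `hlt` strict, which rules out a generator for which the transcript is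
    -- impossible.
    have hαpos : 0 < α := by
      refine lt_of_le_of_ne hα0 fun h => ?_
      rw [← h, mul_zero] at hlt
      exact absurd hlt (not_lt.mpr (Finset.sum_nonneg fun v _ => mul_nonneg (trace_re_nonneg
        (C.cFinal_posSemidef ch _ u (C.cState_posSemidef ch _ u) v)) (C.outMean_nonneg G L N _ u v)))
    have hρ : (α⁻¹ • C.cState ch g u).PosSemidef :=
      (C.cState_posSemidef ch g u).smul (inv_nonneg.mpr hα0)
    obtain ⟨B, hB⟩ := exists_eq_conjTranspose_mul_self hρ
    have htr : (C.cState ch g u).trace = (α : ℂ) := by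
      refine Complex.ext rfl ?_
      rw [Complex.ofReal_im]
      exact (Complex.nonneg_iff.mp (C.cState_posSemidef ch g u).trace_nonneg).2.symm
    refine ⟨g, B, ?_, ?_⟩
    · rw [← hB, Matrix.trace_smul, htr, Complex.real_smul, ← Complex.ofReal_mul,
        inv_mul_cancel₀ hαpos.ne', Complex.ofReal_one]
    · rw [← hB]
      simp only [cFinal_smul, Matrix.trace_smul, Complex.real_smul, Complex.re_ofReal_mul, mul_assoc]
      rw [← Finset.mul_sum]
      have h3 : α⁻¹ * (∑ v ∈ C.revealTranscripts u,
          (C.cFinal ch g u (C.cState ch g u) v).trace.re *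
            C.outMean G L N (fun o => ¬ o = some ch) u v) ≤ R := by
        rw [inv_mul_le_iff₀ hαpos, mul_comm α]
        exact hlt.le
      calc F * _ ≤ F * R := mul_le_mul_of_nonneg_left h3 hpos.le
        _ = C.failMean G L N ch u + ε * F := by
          rw [hR, mul_add, mul_div_cancel₀ _ hF0, mul_comm ε]

/-- Opening to `false` costs the failure probability for `false`. Opening to `true` costs that for
`true` plus the mass by which the transcripts of a commitment to `false` exceed those of a
commitment to `true`, which is the sum of the maxima minus 1. -/
theorem exists_switchingCommitter {δ : ℝ} (hδ : 0 < δ) : ∃ g₀ g₁ B hB,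
    1 - (1 / 2) * (∑ b : Bool, ∑ u ∈ C.commitTranscripts, C.failMean G L N b u +
      (∑ u ∈ C.commitTranscripts,
        max (C.cMean G L N false u) (C.cMean G L N true u) * C.rMean G L N u - 1) + δ) ≤
      avg G L N fun G' => C.bindingProb G' (C.switchingCommitter g₀ g₁ B hB) := by
  set F := C.cMean G L N with hF
  set H := C.rMean G L N with hH
  set S : ℝ := ∑ u ∈ C.commitTranscripts, F false u + ∑ u ∈ C.commitTranscripts, F true u with hS
  have hF0 : ∀ b u, 0 ≤ F b u := C.cMean_nonneg G L N
  have hH0 : ∀ u, 0 ≤ H u := C.rMean_nonneg G L N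
  have hS0 : 0 ≤ S := add_nonneg (Finset.sum_nonneg fun u _ => hF0 _ u)
    (Finset.sum_nonneg fun u _ => hF0 _ u)
  -- S is the total weight by which the slack of `exists_state` gets multiplied, so all slacks
  -- together stay below δ; the summand 1 avoids a division by zero.
  have hε : 0 < δ / (S + 1) := by positivity
  choose g₁ B hB hK using fun ch u => C.exists_state G L N ch u hε
  set K : Bool → List Msg → ℝ := fun ch u => ∑ v ∈ C.revealTranscripts u,
    (C.cFinal ch (g₁ ch u) u ((B ch u)ᴴ * B ch u) v).trace.re *
      C.outMean G L N (fun o => ¬ o = some ch) u v with hKdef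
  have hpsd : ∀ ch u v, 0 ≤ (C.cFinal ch (g₁ ch u) u ((B ch u)ᴴ * B ch u) v).trace.re :=
    fun ch u v => trace_re_nonneg
      (C.cFinal_posSemidef ch _ u (Matrix.posSemidef_conjTranspose_mul_self _) v)
  have hsum : ∀ ch u, ∑ v ∈ C.revealTranscripts u,
      (C.cFinal ch (g₁ ch u) u ((B ch u)ᴴ * B ch u) v).trace.re *
        C.outMean G L N (· = some ch) u v = H u - K ch u := by
    intro ch u
    have h := C.sum_trace_cFinal_mul_outMean G L N ch (· = some ch) (g₁ ch u) u
      ((B ch u)ᴴ * B ch u)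
    rw [hB ch u, Complex.one_re, one_mul] at h
    exact eq_sub_of_add_eq h
  have hKH : ∀ ch u, K ch u ≤ H u := by
    intro ch u
    have h : 0 ≤ H u - K ch u := by
      rw [← hsum]
      exact Finset.sum_nonneg fun v _ => mul_nonneg (hpsd ch u v) (C.outMean_nonneg G L N _ u v)
    linarith
  have hc : Continuous fun g : Generator X n => ∑ ch : Bool, ∑ u ∈ C.commitTranscripts,
      (C.cState false g u).trace.re * (H u - K ch u) :=
    continuous_finsetSum _ fun ch _ => continuous_finsetSum _ fun u _ =>
      (C.continuous_trace_cState false u).mul continuous_const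
  obtain ⟨y, hy⟩ := exists_avg_le G L N hc
  refine ⟨overwrite G L N y, g₁, B, hB, ?_⟩
  have hbind : avg G L N (fun G' => C.bindingProb G'
      (C.switchingCommitter (overwrite G L N y) g₁ B hB)) = (1 / 2) * ∑ ch : Bool,
      ∑ u ∈ C.commitTranscripts, (C.cState false (overwrite G L N y) u).trace.re *
        (H u - K ch u) := by
    have hc' : ∀ ch u, Continuous fun G' => ∑ v ∈ C.revealTranscripts u,
        (C.cFinal ch (g₁ ch u) u ((B ch u)ᴴ * B ch u) v).trace.re *
          C.outWeight (· = some ch) G' u v := fun ch u =>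
      continuous_finsetSum _ fun v _ => continuous_const.mul (C.continuous_outWeight _ u v)
    simp only [bindingProb_switchingCommitter]
    rw [avg_const_mul, avg_sum]
    · congr 1
      refine Finset.sum_congr rfl fun ch _ => ?_
      rw [avg_sum_const_mul _ _ _ _ _ fun u _ => hc' ch u]
      refine Finset.sum_congr rfl fun u _ => ?_
      rw [avg_sum_const_mul _ _ _ _ _ fun v _ => C.continuous_outWeight _ u v, ← hsum]
      rfl
    · exact fun ch _ => continuous_finsetSum _ fun u _ => continuous_const.mul (hc' ch u)
  rw [hbind]
  have hy' : ∑ ch : Bool, ∑ u ∈ C.commitTranscripts, F false u * (H u - K ch u) ≤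
      ∑ ch : Bool, ∑ u ∈ C.commitTranscripts,
        (C.cState false (overwrite G L N y) u).trace.re * (H u - K ch u) := by
    refine le_trans (le_of_eq ?_) hy
    rw [avg_sum]
    · refine Finset.sum_congr rfl fun ch _ => ?_
      rw [avg_sum_mul_const _ _ _ _ _ fun u _ => C.continuous_trace_cState false u]
      rfl
    · exact fun ch _ => continuous_finsetSum _ fun u _ =>
        (C.continuous_trace_cState false u).mul continuous_const
  refine le_trans ?_ (mul_le_mul_of_nonneg_left hy' (by norm_num))
  have hFH : ∀ b, ∑ u ∈ C.commitTranscripts, F b u * H u = 1 := C.sum_cMean_mul_rMean G L N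
  have hT : ∑ u ∈ C.commitTranscripts, (F false u * K false u + F false u * K true u) ≤
      ∑ u ∈ C.commitTranscripts, (C.failMean G L N false u + C.failMean G L N true u +
        δ / (S + 1) * (F false u + F true u) + (max (F false u) (F true u) * H u -
          F true u * H u)) := by
    refine Finset.sum_le_sum fun u _ => ?_
    have h1 : F false u * K false u ≤ C.failMean G L N false u + δ / (S + 1) * F false u :=
      hK false u
    have h2 : F true u * K true u ≤ C.failMean G L N true u + δ / (S + 1) * F true u :=
      hK true u
    -- The committer's transcripts have weight `F false`, but the state for `true` was chosen
    -- relative to `F true`. On the excess, the failure weight `K` is bounded by the full receiver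
    -- weight `H`.
    have h3 : 0 ≤ (max (F false u) (F true u) - F true u) * (H u - K true u) :=
      mul_nonneg (sub_nonneg.mpr (le_max_right _ _)) (sub_nonneg.mpr (hKH true u))
    have h4 : 0 ≤ K true u := Finset.sum_nonneg fun v _ =>
      mul_nonneg (hpsd true u v) (C.outMean_nonneg G L N _ u v)
    have h5 : 0 ≤ (max (F false u) (F true u) - F false u) * K true u :=
      mul_nonneg (sub_nonneg.mpr (le_max_left _ _)) h4
    nlinarith
  have hδ' : δ / (S + 1) * S ≤ δ := by
    rw [div_mul_eq_mul_div, div_le_iff₀ (by positivity)]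
    nlinarith
  simp only [Finset.sum_add_distrib, Finset.sum_sub_distrib, ← Finset.mul_sum, hFH] at hT
  rw [← hS] at hT
  simp only [Fintype.sum_bool, mul_sub, Finset.sum_sub_distrib, hFH]
  linarith

variable {C L N} in
/-- If the commitment hardly ever fails, then either hiding or binding can be broken by an adversary
that does not depend on the states with long keys. -/
theorem QueryBound.exists_attack {q : ℕ} (hC : C.QueryBound N q)
    (hn : ∀ l, L < l →
      2 * ((2 * C.commitRounds + 2 * C.revealRounds + 1) * q) ^ 2 ≤ 2 ^ n l)
    (h : avg G L N (fun G' => 1 - C.completeness G') ≤ 1 / 50) :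
    (∃ g guess, 7 / 10 ≤ avg G L N fun G' => C.hidingProb G' (C.guessingReceiver g guess)) ∨
    ∃ g₀ g₁ B hB,
      7 / 10 ≤ avg G L N fun G' => C.bindingProb G' (C.switchingCommitter g₀ g₁ B hB) := by
  -- The failure mass is at most 4/50. If the sum of maxima is at least 7/5, hiding fails with
  -- probability 7/10; otherwise binding fails with probability at least 1 - (0.08 + 0.4 + 0.01)/2 >
  -- 7/10.
  have hf := hC.sum_failMean_le G hn
  rcases le_total (7 / 5) (∑ u ∈ C.commitTranscripts,
      max (C.cMean G L N false u) (C.cMean G L N true u) * C.rMean G L N u) with h1 | h1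
  · obtain ⟨g, guess, hg⟩ := C.exists_guessingReceiver G L N
    exact Or.inl ⟨g, guess, by linarith⟩
  · obtain ⟨g₀, g₁, B, hB, hg⟩ := C.exists_switchingCommitter G L N
      (δ := 1 / 100) (by norm_num)
    exact Or.inr ⟨g₀, g₁, B, hB, by linarith⟩

end CommitmentAt

end Dichotomy

/-! ### Failure of completeness, hiding or binding as one bounded continuous quantity -/

section Gain

variable {X : ℕ → Type} [∀ l, Fintype (X l)] [∀ l, DecidableEq (X l)] {n : ℕ → ℕ}

theorem Prog.Bounded.mono {O : Type} {e d L L' N : ℕ} (hL : L ≤ L') {p : Prog X n O e d}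
    (hp : p.Bounded L N) : p.Bounded L' N := by
  induction p generalizing N with
  | ret o => trivial
  | step J next ih => exact fun i => ih i (hp i)
  | query l k x J next ih =>
    obtain ⟨hl, N', rfl, hN⟩ := hp
    exact ⟨hl.trans hL, N', rfl, fun i => ih i (hN i)⟩

namespace CommitmentAt

variable {C : CommitmentAt X n} {N q : ℕ}

theorem QueryBound.mono {N' : ℕ} (hN : N ≤ N') (hC : C.QueryBound N q) : C.QueryBound N' q :=
  ⟨fun b t => (hC.cCommit b t).mono hN, fun b t => (hC.cReveal b t).mono hN,
    fun t => (hC.rCommit t).mono hN, fun t => (hC.rReveal t).mono hN,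
    fun t => (hC.rOutput t).mono hN⟩

theorem QueryBound.completeness_congr (hC : C.QueryBound N q) {G G' : Generator X n}
    (h : ∀ l ≤ N, G l = G' l) : C.completeness G = C.completeness G' := by
  unfold completeness
  simp only [Prog.kraus_congr _ (hC.cCommit _ _) h, Prog.kraus_congr _ (hC.cReveal _ _) h,
    Prog.kraus_congr _ (hC.rCommit _) h, Prog.kraus_congr _ (hC.rReveal _) h,
    Prog.kraus_congr _ (hC.rOutput _) h]

theorem QueryBound.hidingProb_congr (hC : C.QueryBound N q) {G G' : Generator X n}
    (h : ∀ l ≤ N, G l = G' l) (R : MalReceiver) : C.hidingProb G R = C.hidingProb G' R := by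
  unfold hidingProb
  simp only [Prog.kraus_congr _ (hC.cCommit _ _) h]

theorem QueryBound.bindingProb_congr (hC : C.QueryBound N q) {G G' : Generator X n}
    (h : ∀ l ≤ N, G l = G' l) (D : MalCommitter) : C.bindingProb G D = C.bindingProb G' D := by
  unfold bindingProb
  simp only [Prog.kraus_congr _ (hC.rCommit _) h, Prog.kraus_congr _ (hC.rReveal _) h,
    Prog.kraus_congr _ (hC.rOutput _) h]

variable (C)

theorem completeness_nonneg (G : Generator X n) : 0 ≤ C.completeness G := by
  rw [completeness_eq]
  exact mul_nonneg (by norm_num) (Finset.sum_nonneg fun b _ => Finset.sum_nonneg fun u _ =>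
    Finset.sum_nonneg fun v _ => mul_nonneg (trace_re_nonneg
      (C.cFinal_posSemidef b _ u (C.cState_posSemidef b _ u) v)) (C.outWeight_nonneg _ _ u v))

theorem hidingProb_guessingReceiver_le_one (g : Generator X n) (guess : List Msg → Bool)
    (G : Generator X n) : C.hidingProb G (C.guessingReceiver g guess) ≤ 1 := by
  have h : ∑ u ∈ C.commitTranscripts,
      (C.cState (guess u) G u).trace.re * (C.rState g u).trace.re ≤
      ∑ u ∈ C.commitTranscripts, ((C.cState false G u).trace.re * (C.rState g u).trace.re +
        (C.cState true G u).trace.re * (C.rState g u).trace.re) := by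
    refine Finset.sum_le_sum fun u _ => ?_
    have h0 : ∀ b, 0 ≤ (C.cState b G u).trace.re * (C.rState g u).trace.re := fun b =>
      mul_nonneg (trace_re_nonneg (C.cState_posSemidef b G u))
        (trace_re_nonneg (C.rState_posSemidef g u))
    cases guess u
    · linarith [h0 true]
    · linarith [h0 false]
  rw [Finset.sum_add_distrib, C.sum_trace_cState_mul, C.sum_trace_cState_mul] at h
  rw [hidingProb_guessingReceiver]
  linarith

theorem continuous_hidingProb_guessingReceiver (g : Generator X n) (guess : List Msg → Bool) :
    Continuous fun G => C.hidingProb G (C.guessingReceiver g guess) := by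
  simp only [hidingProb_guessingReceiver]
  exact continuous_const.mul (continuous_finsetSum _ fun u _ =>
    (C.continuous_trace_cState _ u).mul continuous_const)

theorem bindingProb_switchingCommitter_le_one (g₀ : Generator X n)
    (g₁ : Bool → List Msg → Generator X n)
    (B : Bool → List Msg → Matrix (Fin (C.cDim + 1)) (Fin (C.cDim + 1)) ℂ)
    (hB : ∀ ch u, ((B ch u)ᴴ * B ch u).trace = 1) (G : Generator X n) :
    C.bindingProb G (C.switchingCommitter g₀ g₁ B hB) ≤ 1 := by
  have h : ∀ ch, ∑ u ∈ C.commitTranscripts, (C.cState false g₀ u).trace.re *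
        ∑ v ∈ C.revealTranscripts u,
          (C.cFinal ch (g₁ ch u) u ((B ch u)ᴴ * B ch u) v).trace.re *
            C.outWeight (· = some ch) G u v ≤ 1 := by
    intro ch
    refine le_trans (Finset.sum_le_sum fun u _ => mul_le_mul_of_nonneg_left (?_ : _ ≤
      (C.rState G u).trace.re) (trace_re_nonneg (C.cState_posSemidef false g₀ u)))
      (C.sum_trace_cState_mul false g₀ G).le
    have h2 := C.sum_trace_cFinal_mul ch (g₁ ch u) G u ((B ch u)ᴴ * B ch u)
    rw [hB, Complex.one_re, one_mul] at h2
    rw [← h2]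
    refine Finset.sum_le_sum fun v _ => mul_le_mul_of_nonneg_left ?_ (trace_re_nonneg
      (C.cFinal_posSemidef ch _ u (Matrix.posSemidef_conjTranspose_mul_self _) v))
    linarith [C.outWeight_add_outWeight_not (· = some ch) G u v,
      C.outWeight_nonneg (fun o => ¬ o = some ch) G u v]
  rw [bindingProb_switchingCommitter, Fintype.sum_bool]
  linarith [h true, h false]

theorem continuous_bindingProb_switchingCommitter (g₀ : Generator X n)
    (g₁ : Bool → List Msg → Generator X n)
    (B : Bool → List Msg → Matrix (Fin (C.cDim + 1)) (Fin (C.cDim + 1)) ℂ)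
    (hB : ∀ ch u, ((B ch u)ᴴ * B ch u).trace = 1) :
    Continuous fun G => C.bindingProb G (C.switchingCommitter g₀ g₁ B hB) := by
  simp only [bindingProb_switchingCommitter]
  exact continuous_const.mul (continuous_finsetSum _ fun ch _ => continuous_finsetSum _ fun u _ =>
    continuous_const.mul (continuous_finsetSum _ fun v _ =>
      continuous_const.mul (C.continuous_outWeight _ u v)))

/-- The excess of the probability of a failure of completeness, hiding or binding over a fixed
threshold. -/
def gain (R : MalReceiver) (D : MalCommitter) (i : Fin 3) (G : Generator X n) : ℝ :=
  ![1 - C.completeness G - 1 / 100, C.hidingProb G R - 3 / 5, C.bindingProb G D - 3 / 5] i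

variable {C}

theorem QueryBound.gain_congr (hC : C.QueryBound N q) {G G' : Generator X n}
    (h : ∀ l ≤ N, G l = G' l) (R : MalReceiver) (D : MalCommitter) (i : Fin 3) :
    C.gain R D i G = C.gain R D i G' := by
  unfold gain
  rw [hC.completeness_congr h, hC.hidingProb_congr h, hC.bindingProb_congr h]

/-- The adversary that does nothing. -/
def idleReceiver : MalReceiver where
  dim := 0
  act _ := ⟨[([], 1)], by simp⟩
  guess _ := ⟨[(false, 1)], by simp⟩

/-- The adversary that does nothing. -/
def idleCommitter : MalCommitter where
  dim := 0
  commit _ := ⟨[([], 1)], by simp⟩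
  reveal _ _ := ⟨[([], 1)], by simp⟩

/-- Completeness, hiding or binding fails on average over the states with long keys. -/
theorem QueryBound.exists_gain {L : ℕ} (hC : C.QueryBound N q) (G : Generator X n)
    (hn : ∀ l, L < l →
      2 * ((2 * C.commitRounds + 2 * C.revealRounds + 1) * q) ^ 2 ≤ 2 ^ n l) :
    ∃ R D i, Continuous (C.gain R D i) ∧ (∀ G', C.gain R D i G' ≤ 1) ∧
      1 / 100 ≤ avg G L N (C.gain R D i) := by
  rcases le_total (avg G L N fun G' => 1 - C.completeness G') (1 / 50) with h | h
  · rcases hC.exists_attack G hn h with ⟨g, guess, hg⟩ | ⟨g₀, g₁, B, hB, hg⟩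
    · have hc := C.continuous_hidingProb_guessingReceiver g guess
      have he : C.gain (C.guessingReceiver g guess) idleCommitter 1 =
        fun G' => C.hidingProb G' (C.guessingReceiver g guess) - 3 / 5 := rfl
      refine ⟨C.guessingReceiver g guess, idleCommitter, 1, ?_, fun G' => ?_, ?_⟩
      · rw [he]
        exact hc.sub continuous_const
      · rw [he]
        linarith [C.hidingProb_guessingReceiver_le_one g guess G']
      · rw [he, avg_sub _ _ _ hc continuous_const, avg_const]
        linarith
    · have hc := C.continuous_bindingProb_switchingCommitter g₀ g₁ B hB
      have he : C.gain idleReceiver (C.switchingCommitter g₀ g₁ B hB) 2 =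
        fun G' => C.bindingProb G' (C.switchingCommitter g₀ g₁ B hB) - 3 / 5 := rfl
      refine ⟨idleReceiver, C.switchingCommitter g₀ g₁ B hB, 2, ?_, fun G' => ?_, ?_⟩
      · rw [he]
        exact hc.sub continuous_const
      · rw [he]
        linarith [C.bindingProb_switchingCommitter_le_one g₀ g₁ B hB G']
      · rw [he, avg_sub _ _ _ hc continuous_const, avg_const]
        linarith
  · have hc : Continuous fun G' => 1 - C.completeness G' :=
      continuous_const.sub C.continuous_completeness
    have he : C.gain idleReceiver idleCommitter 0 =
      fun G' => 1 - C.completeness G' - 1 / 100 := rfl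
    refine ⟨idleReceiver, idleCommitter, 0, ?_, fun G' => ?_, ?_⟩
    · rw [he]
      exact hc.sub continuous_const
    · rw [he]
      linarith [C.completeness_nonneg G']
    · rw [he, avg_sub _ _ _ hc continuous_const, avg_const]
      linarith

end CommitmentAt

end Gain

/-! ## Asymptotics -/

section Asymptotics

theorem polynomial_eval_mono (p : Polynomial ℕ) {a b : ℕ} (h : a ≤ b) : p.eval a ≤ p.eval b := by
  simp only [Polynomial.eval_eq_sum_range]
  exact Finset.sum_le_sum fun i _ => Nat.mul_le_mul_left _ (Nat.pow_le_pow_left h i)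

theorem polynomial_eval_le (p : Polynomial ℕ) {a : ℕ} (h : 1 ≤ a) :
    p.eval a ≤ p.eval 1 * a ^ p.natDegree := by
  simp only [Polynomial.eval_eq_sum_range, Finset.sum_mul, one_pow, mul_one]
  refine Finset.sum_le_sum fun i hi => Nat.mul_le_mul_left _ ?_
  exact Nat.pow_le_pow_right h (Nat.lt_succ_iff.mp (Finset.mem_range.mp hi))

/-- This is what n = ω(log) is needed for: the dimension eventually exceeds every polynomial, in
particular twice the squared query count. -/
theorem SuperLog.eventually_eval_le {n : ℕ → ℕ} (hn : SuperLog n) (p : Polynomial ℕ) :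
    ∀ᶠ l : ℕ in atTop, p.eval l ≤ 2 ^ n l := by
  have hlog2 : 0 < Real.log 2 := Real.log_pos (by norm_num)
  have hd : 0 < Real.log 2 / (p.natDegree + 1) := by positivity
  filter_upwards [hn.bound hd, eventually_ge_atTop (p.eval 1), eventually_ge_atTop 1]
    with l h1 h2 h3
  have hl : (1 : ℝ) ≤ l := by exact_mod_cast h3
  rw [Real.norm_of_nonneg (Real.log_nonneg hl), Real.norm_of_nonneg (Nat.cast_nonneg _)] at h1
  have h4 : p.eval l ≤ l ^ (p.natDegree + 1) := by
    rw [pow_succ']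
    exact (polynomial_eval_le p h3).trans (Nat.mul_le_mul_right _ h2)
  have h5 : (l : ℝ) ^ (p.natDegree + 1) ≤ 2 ^ n l := by
    rw [← Real.log_le_log_iff (by positivity) (by positivity), Real.log_pow, Real.log_pow]
    push_cast
    calc ((p.natDegree : ℝ) + 1) * Real.log l
        ≤ ((p.natDegree : ℝ) + 1) * (Real.log 2 / (p.natDegree + 1) * n l) := by gcongr
      _ = n l * Real.log 2 := by field_simp
  have h6 : l ^ (p.natDegree + 1) ≤ 2 ^ n l := by exact_mod_cast h5
  exact h4.trans h6

theorem summable_eval_mul_geometric (p : Polynomial ℕ) {r : ℝ} (hr0 : 0 ≤ r) (hr1 : r < 1) :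
    Summable fun l : ℕ => ((p.eval l : ℕ) : ℝ) * r ^ l := by
  have h : ∀ l : ℕ, ((p.eval l : ℕ) : ℝ) * r ^ l =
      ∑ i ∈ Finset.range (p.natDegree + 1), (p.coeff i : ℝ) * ((l : ℝ) ^ i * r ^ l) := by
    intro l
    rw [Polynomial.eval_eq_sum_range]
    push_cast
    rw [Finset.sum_mul]
    exact Finset.sum_congr rfl fun i _ => by ring
  simp only [h]
  refine summable_sum fun i _ => Summable.mul_left _ ?_
  exact summable_pow_mul_geometric_of_norm_lt_one i (by rwa [Real.norm_of_nonneg hr0])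

theorem negligible_of_sq_le {f : ℕ → ℝ} {K r : ℝ} (hr0 : 0 ≤ r) (hr1 : r < 1) (hK : 0 ≤ K)
    (hf0 : ∀ l, 0 ≤ f l) (hf : ∀ᶠ l in atTop, f l ^ 2 ≤ K * r ^ l) : Negligible f := by
  intro k
  have hs : Real.sqrt r < 1 := by
    rw [Real.sqrt_lt' one_pos]
    simpa using hr1
  have h1 := tendsto_pow_const_mul_const_pow_of_abs_lt_one k
    (r := Real.sqrt r) (by rwa [abs_of_nonneg (Real.sqrt_nonneg r)])
  have h2 := h1.const_mul (Real.sqrt K)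
  rw [mul_zero] at h2
  refine squeeze_zero' (Eventually.of_forall fun l => mul_nonneg (by positivity) (hf0 l)) ?_ h2
  filter_upwards [hf] with l hl
  have h3 : f l ≤ Real.sqrt K * Real.sqrt r ^ l := by
    refine abs_le_of_sq_le_sq' ?_ (by positivity) |>.2
    rw [mul_pow, ← pow_mul, mul_comm l 2, pow_mul, Real.sq_sqrt hK, Real.sq_sqrt hr0]
    exact hl
  calc (l : ℝ) ^ k * f l ≤ (l : ℝ) ^ k * (Real.sqrt K * Real.sqrt r ^ l) := by gcongr
    _ = Real.sqrt K * ((l : ℝ) ^ k * Real.sqrt r ^ l) := by ring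

theorem Negligible.eventually_lt {ε : ℕ → ℝ} (h : Negligible ε) {δ : ℝ} (hδ : 0 < δ) :
    ∀ᶠ s in atTop, ε s < δ := by
  have h0 := h 0
  simp only [pow_zero, one_mul] at h0
  exact h0.eventually_lt_const hδ

end Asymptotics

/-! ## The oracle and the adversaries -/

section Stages

variable {X : ℕ → Type} [∀ l, Fintype (X l)] [∀ l, DecidableEq (X l)] {n : ℕ → ℕ}

/-- A generator and a pair of adversaries. -/
structure World (X : ℕ → Type) (n : ℕ → ℕ) where
  gen : Generator X n
  receiver : ℕ → MalReceiver
  committer : ℕ → MalCommitter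

/-- The sum of the squared advantages of the reduction with either adversary. -/
def sqAdvantage (S : SecurityReduction X n) (R : ℕ → MalReceiver) (D : ℕ → MalCommitter) (l : ℕ)
    (G : Generator X n) : ℝ :=
  (S l (.receiver R)).advantage G ^ 2 + (S l (.committer D)).advantage G ^ 2

/-- The weighted squared advantages for the security parameters in `(L, N]`. -/
def potential (S : SecurityReduction X n) (R : ℕ → MalReceiver) (D : ℕ → MalCommitter) (L N : ℕ)
    (G : Generator X n) : ℝ :=
  ∑ l ∈ Finset.Ioc L N, (11 / 10) ^ l * sqAdvantage S R D l G

theorem sqAdvantage_nonneg (S : SecurityReduction X n) (R : ℕ → MalReceiver)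
    (D : ℕ → MalCommitter) (l : ℕ) (G : Generator X n) : 0 ≤ sqAdvantage S R D l G :=
  add_nonneg (sq_nonneg _) (sq_nonneg _)

theorem potential_nonneg (S : SecurityReduction X n) (R : ℕ → MalReceiver)
    (D : ℕ → MalCommitter) (L N : ℕ) (G : Generator X n) : 0 ≤ potential S R D L N G :=
  Finset.sum_nonneg fun l _ => mul_nonneg (by positivity) (sqAdvantage_nonneg S R D l G)

theorem continuous_sqAdvantage (S : SecurityReduction X n) (R : ℕ → MalReceiver)
    (D : ℕ → MalCommitter) (l : ℕ) : Continuous (sqAdvantage S R D l) :=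
  ((S l _).continuous_advantage.pow 2).add ((S l _).continuous_advantage.pow 2)

theorem continuous_potential (S : SecurityReduction X n) (R : ℕ → MalReceiver)
    (D : ℕ → MalCommitter) (L N : ℕ) : Continuous (potential S R D L N) :=
  continuous_finsetSum _ fun l _ => continuous_const.mul (continuous_sqAdvantage S R D l)

/-- A summable bound for the mean of the terms of the potential. -/
def potentialBound (pS : Polynomial ℕ) (l : ℕ) : ℝ :=
  (11 / 10) ^ l * (2 * (1 / 2 ^ l + 72 * (pS.eval l : ℕ) * (1 / Real.sqrt 2) ^ l))

/-- The weight 11/10 is below √2, so it is outweighed by the decay 2^(-l/2) of the mean squared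
advantage. Being above 1, it turns a bounded potential into exponentially small advantages. -/
theorem summable_potentialBound (pS : Polynomial ℕ) : Summable (potentialBound pS) := by
  have h2 : (11 / 10 : ℝ) * (1 / Real.sqrt 2) < 1 := by
    have h : (11 / 10 : ℝ) < Real.sqrt 2 := Real.lt_sqrt_of_sq_lt (by norm_num)
    rw [mul_one_div, div_lt_one (by positivity)]
    exact h
  have h : ∀ l, potentialBound pS l = 2 * (11 / 20 : ℝ) ^ l +
      144 * ((pS.eval l : ℕ) * (11 / 10 * (1 / Real.sqrt 2)) ^ l) := by
    intro l
    unfold potentialBound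
    have h3 : (11 / 20 : ℝ) ^ l = (11 / 10) ^ l * (1 / 2 ^ l) := by
      rw [← one_div_pow, ← mul_pow]
      norm_num
    rw [h3, mul_pow (11 / 10 : ℝ)]
    ring
  refine Summable.congr ?_ fun l => (h l).symm
  exact (Summable.mul_left _ (summable_geometric_of_lt_one (by norm_num) (by norm_num))).add
    (Summable.mul_left _ (summable_eval_mul_geometric pS (by positivity) h2))

theorem avg_potential_le {S : SecurityReduction X n} {pS : Polynomial ℕ}
    (hS : ∀ l A, (S l A).Bounded (pS.eval l) (pS.eval l)) (R : ℕ → MalReceiver)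
    (D : ℕ → MalCommitter) (L N : ℕ) (G : Generator X n) :
    avg G L N (potential S R D L N) ≤ ∑ l ∈ Finset.Ioc L N, potentialBound pS l := by
  have h : avg G L N (potential S R D L N) =
      ∑ l ∈ Finset.Ioc L N, (11 / 10) ^ l * avg G L N (sqAdvantage S R D l) :=
    avg_sum_const_mul G L N _ _ fun l _ => continuous_sqAdvantage S R D l
  rw [h]
  refine Finset.sum_le_sum fun l hl => mul_le_mul_of_nonneg_left ?_ (by positivity)
  have hl' := Finset.mem_Ioc.mp hl
  have h1 := (S l (.receiver R)).avg_advantage_sq_le (hS l _) G hl'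
  have h2 := (S l (.committer D)).avg_advantage_sq_le (hS l _) G hl'
  have h3 : avg G L N (sqAdvantage S R D l) = avg G L N (fun G' =>
      (S l (.receiver R)).advantage G' ^ 2) + avg G L N (fun G' =>
      (S l (.committer D)).advantage G' ^ 2) :=
    avg_add G L N ((S l _).continuous_advantage.pow 2) ((S l _).continuous_advantage.pow 2)
  rw [h3]
  linarith

/-- Changing an adversary at parameters beyond `pS.eval N` is invisible to the distinguishers up to
N. -/
theorem potential_congr {S : SecurityReduction X n} {pS : Polynomial ℕ}
    (hS : ∀ l A A', Adversary.AgreeUpTo (pS.eval l) A A' → S l A = S l A')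
    {R R' : ℕ → MalReceiver} {D D' : ℕ → MalCommitter} {L N : ℕ}
    (hR : ∀ s ≤ pS.eval N, R s = R' s) (hD : ∀ s ≤ pS.eval N, D s = D' s) (G : Generator X n) :
    potential S R D L N G = potential S R' D' L N G := by
  refine Finset.sum_congr rfl fun l hl => ?_
  have hl' : pS.eval l ≤ pS.eval N := polynomial_eval_mono pS (Finset.mem_Ioc.mp hl).2
  unfold sqAdvantage
  rw [hS l (.receiver R) (.receiver R') fun s hs => hR s (hs.trans hl'),
    hS l (.committer D) (.committer D') fun s hs => hD s (hs.trans hl')]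

/-- The security parameter that is attacked when the states of the keys of length at most `L` have
been fixed. -/
def attackParam (pS : Polynomial ℕ) (L : ℕ) : ℕ := pS.eval L + L + 1

/-- The length of the keys whose states are fixed next. -/
def nextLevel (pC pS : Polynomial ℕ) (L : ℕ) : ℕ :=
  pC.eval (attackParam pS L) + pS.eval L + L + 1

/-- Completeness, hiding or binding can be broken at one more security parameter, without breaking
the generator. -/
theorem exists_step {C : Commitment X n} {S : SecurityReduction X n} {pC pS : Polynomial ℕ}
    (hC : ∀ s, (C s).commitRounds ≤ pC.eval s ∧ (C s).revealRounds ≤ pC.eval s ∧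
      (C s).QueryBound (pC.eval s) (pC.eval s))
    (hS : ∀ l A, (S l A).Bounded (pS.eval l) (pS.eval l))
    (hSA : ∀ l A A', Adversary.AgreeUpTo (pS.eval l) A A' → S l A = S l A') {L₀ L : ℕ}
    (hn : ∀ l, L < l → 2 * ((4 * pC.eval (attackParam pS L) + 1) *
      pC.eval (attackParam pS L)) ^ 2 ≤ 2 ^ n l)
    (hsum : ∀ N, ∑ l ∈ Finset.Ioc L N, potentialBound pS l ≤ 1 / 300) (W : World X n)
    (hW : avg W.gen L (nextLevel pC pS L) (potential S W.receiver W.committer L₀ L) ≤ 1) :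
    ∃ (W' : World X n) (i : Fin 3), (∀ l ≤ L, W'.gen l = W.gen l) ∧
      (∀ s < attackParam pS L, W'.receiver s = W.receiver s ∧ W'.committer s = W.committer s) ∧
      0 < (C (attackParam pS L)).gain (W'.receiver (attackParam pS L))
        (W'.committer (attackParam pS L)) i W'.gen ∧
      potential S W'.receiver W'.committer L₀ L W'.gen ≤ 300 ∧
      avg W'.gen (nextLevel pC pS L) (nextLevel pC pS (nextLevel pC pS L))
        (potential S W'.receiver W'.committer L (nextLevel pC pS L)) ≤ 1 := by
  set s := attackParam pS L with hs
  set N := nextLevel pC pS L with hN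
  set N' := nextLevel pC pS N with hN'
  -- N is at least `pC.eval s`, so everything the commitment at s reads is fixed after this stage.
  have hbound : (C s).QueryBound N (pC.eval s) := (hC s).2.2.mono (by
    rw [hN, nextLevel, ← hs]
    omega)
  obtain ⟨R, D, i, hcont, hle, havg⟩ := hbound.exists_gain (L := L) W.gen fun l hl =>
    le_trans (by
      have h1 := (hC s).1
      have h2 := (hC s).2.1
      gcongr
      omega) (hn l hl)
  set R' := Function.update W.receiver s R with hR'
  set D' := Function.update W.committer s D with hD'
  have hlt : ∀ t < s, R' t = W.receiver t ∧ D' t = W.committer t := fun t ht =>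
    ⟨Function.update_of_ne ht.ne _ _, Function.update_of_ne ht.ne _ _⟩
  -- Since s > `pS.eval L`, the new attack does not affect the distinguishers for parameters up to
  -- L.
  have hpot : ∀ G, potential S R' D' L₀ L G = potential S W.receiver W.committer L₀ L G :=
    potential_congr hSA (fun t ht => (hlt t (by rw [hs, attackParam]; omega)).1)
      (fun t ht => (hlt t (by rw [hs, attackParam]; omega)).2)
  have hc1 := continuous_potential S R' D' L₀ L
  have hc2 := continuous_potential S R' D' L N
  have hc3 : Continuous fun G => avg G N N' (potential S R' D' L N) := continuous_avg hc2
  have hA1 : avg W.gen L N (potential S R' D' L₀ L) ≤ 1 := by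
    have : potential S R' D' L₀ L = potential S W.receiver W.committer L₀ L := funext hpot
    rw [this]
    exact hW
  -- The new adversaries were chosen before the states of lengths in (L, N], so those states are
  -- still random for the distinguishers at these parameters. The inner average anticipates their
  -- queries to keys of lengths in (N, N'].
  have hA2 : avg W.gen L N (fun G => avg G N N' (potential S R' D' L N)) ≤ 1 / 300 :=
    avg_avg_le W.gen L N N' hc2 fun G => (avg_potential_le hS R' D' L N G).trans (hsum N)
  have hc4 : Continuous fun G => (1 / 300 : ℝ) * potential S R' D' L₀ L G :=
    continuous_const.mul hc1
  have hc5 : Continuous fun G => (C s).gain R D i G - (1 / 300 : ℝ) * potential S R' D' L₀ L G :=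
    hcont.sub hc4
  have hc6 : Continuous fun G => (C s).gain R D i G - (1 / 300 : ℝ) * potential S R' D' L₀ L G -
    avg G N N' (potential S R' D' L N) := hc5.sub hc3
  -- On average the gain is at least 1/100, while the old potential over 300 and the new averaged
  -- potential cost at most 1/300 each. A choice of states with positive value meets all
  -- requirements at once: the gain is positive, and since it is at most 1 the old potential is
  -- below 300 and the new average below 1.
  have htot : 0 < avg W.gen L N (fun G => (C s).gain R D i G -
      (1 / 300 : ℝ) * potential S R' D' L₀ L G - avg G N N' (potential S R' D' L N)) := by
    rw [avg_sub _ _ _ hc5 hc3, avg_sub _ _ _ hcont hc4, avg_const_mul]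
    linarith
  obtain ⟨y, hy⟩ := exists_avg_le W.gen L N hc6
  have hpos := htot.trans_le hy
  set G' := overwrite W.gen L N y with hG'
  have h1 := potential_nonneg S R' D' L₀ L G'
  have h2 : 0 ≤ avg G' N N' (potential S R' D' L N) :=
    avg_nonneg _ _ _ fun G => potential_nonneg S R' D' L N G
  have h3 := hle G'
  refine ⟨⟨G', R', D'⟩, i, fun l hl => overwrite_of_not y (by omega), hlt, ?_, ?_, ?_⟩
  · simp only [hR', hD', Function.update_self]
    linarith
  · linarith
  · linarith

end Stages

/-! ### The limit of the stages and the contradiction -/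

section Limit

variable {X : ℕ → Type} [∀ l, Fintype (X l)] [∀ l, DecidableEq (X l)] {n : ℕ → ℕ}

theorem exists_levels (hn : SuperLog n) (pC pS : Polynomial ℕ) : ∃ L₀ : ℕ, ∀ L ≥ L₀,
    (∀ l, L < l → 2 * ((4 * pC.eval (attackParam pS L) + 1) *
      pC.eval (attackParam pS L)) ^ 2 ≤ 2 ^ n l) ∧
    ∀ N, ∑ l ∈ Finset.Ioc L N, potentialBound pS l ≤ 1 / 300 := by
  set Q : Polynomial ℕ := 2 * ((4 * pC.comp (pS + Polynomial.X + 1) + 1) *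
    pC.comp (pS + Polynomial.X + 1)) ^ 2 with hQ
  have hQe : ∀ l, Q.eval l = 2 * ((4 * pC.eval (attackParam pS l) + 1) *
      pC.eval (attackParam pS l)) ^ 2 := by
    intro l
    simp [hQ, attackParam, Polynomial.eval_comp]
  obtain ⟨a, ha⟩ := eventually_atTop.mp (hn.eventually_eval_le Q)
  obtain ⟨t, ht⟩ := summable_iff_vanishing_norm.mp (summable_potentialBound pS) (1 / 300)
    (by norm_num)
  refine ⟨max a (t.sup id), fun L hL => ⟨fun l hl => ?_, fun N => ?_⟩⟩
  · rw [← hQe]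
    exact (polynomial_eval_mono Q hl.le).trans
      (ha l (((le_max_left _ _).trans hL).trans hl.le))
  · refine (le_abs_self _).trans (ht _ ?_).le
    rw [Finset.disjoint_left]
    intro l hl hlt
    have h1 : l ≤ t.sup id := Finset.le_sup (f := id) hlt
    have h2 := (le_max_right a (t.sup id)).trans hL
    have h3 := (Finset.mem_Ioc.mp hl).1
    omega

/-- There are a generator and adversaries that break the commitment at infinitely many security
parameters, while the advantage of the reduction is exponentially small. -/
theorem exists_world (hn : SuperLog n) {C : Commitment X n} {S : SecurityReduction X n}
    {pC pS : Polynomial ℕ}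
    (hC : ∀ s, (C s).commitRounds ≤ pC.eval s ∧ (C s).revealRounds ≤ pC.eval s ∧
      (C s).QueryBound (pC.eval s) (pC.eval s))
    (hS : ∀ l A, (S l A).Bounded (pS.eval l) (pS.eval l))
    (hSA : ∀ l A A', Adversary.AgreeUpTo (pS.eval l) A A' → S l A = S l A') :
    ∃ (W : World X n) (t : ℕ → ℕ) (ι : ℕ → Fin 3), StrictMono t ∧
      (∀ j, 0 < (C (t j)).gain (W.receiver (t j)) (W.committer (t j)) (ι j) W.gen) ∧
      ∀ᶠ l in atTop, (11 / 10) ^ l * sqAdvantage S W.receiver W.committer l W.gen ≤ 300 := by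
  obtain ⟨L₀, hL₀⟩ := exists_levels hn pC pS
  set lev : ℕ → ℕ := fun j => (nextLevel pC pS)^[j] L₀ with hlev
  have hsucc : ∀ j, lev (j + 1) = nextLevel pC pS (lev j) := fun j =>
    Function.iterate_succ_apply' _ _ _
  have hmono : StrictMono lev := strictMono_nat_of_lt_succ fun j => by
    rw [hsucc, nextLevel]
    omega
  have hge : ∀ j, L₀ ≤ lev j := fun j => hmono.monotone (Nat.zero_le j)
  have hid : ∀ j, j ≤ lev j := fun j => hmono.id_le j
  have hap : StrictMono fun j => attackParam pS (lev j) := fun i j hij => by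
    have h1 := hmono hij
    have h2 := polynomial_eval_mono pS h1.le
    simp only [attackParam]
    omega
  -- The invariant concerns parameters in (`lev (j - 1)`, `lev j`], whose distinguishers may still
  -- query keys of lengths up to `lev (j + 1)`. For j = 0 truncated subtraction makes this range
  -- empty, so the invariant holds at the start.
  set Good : ℕ → World X n → Prop := fun j W =>
    avg W.gen (lev j) (lev (j + 1)) (potential S W.receiver W.committer (lev (j - 1)) (lev j)) ≤ 1
    with hGood
  have step : ∀ j W, Good j W → ∃ (W' : World X n) (i : Fin 3), Good (j + 1) W' ∧
      (∀ l ≤ lev j, W'.gen l = W.gen l) ∧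
      (∀ s < attackParam pS (lev j),
        W'.receiver s = W.receiver s ∧ W'.committer s = W.committer s) ∧
      0 < (C (attackParam pS (lev j))).gain (W'.receiver (attackParam pS (lev j)))
        (W'.committer (attackParam pS (lev j))) i W'.gen ∧
      potential S W'.receiver W'.committer (lev (j - 1)) (lev j) W'.gen ≤ 300 := by
    intro j W hW
    simp only [hGood, hsucc] at hW
    obtain ⟨W', i, h1, h2, h3, h4, h5⟩ := exists_step hC hS hSA (hL₀ _ (hge j)).1
      (hL₀ _ (hge j)).2 W hW
    refine ⟨W', i, ?_, h1, h2, h3, h4⟩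
    simp only [hGood, hsucc, Nat.add_sub_cancel]
    exact h5
  choose next ι' hnext using step
  have hne : ∀ m, Nonempty (PureState m) := fun m => nonempty_of_isProbabilityMeasure (haarState m)
  set W₀ : World X n := ⟨fun l _ _ => (hne (n l)).some, fun _ => CommitmentAt.idleReceiver,
    fun _ => CommitmentAt.idleCommitter⟩ with hW₀
  have hGood₀ : Good 0 W₀ := by
    have h : potential S W₀.receiver W₀.committer (lev (0 - 1)) (lev 0) = fun _ => 0 := by
      funext G
      simp [potential]
    simp only [hGood]
    rw [h, avg_const]
    norm_num
  let seq : (j : ℕ) → {W // Good j W} := fun j =>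
    Nat.rec ⟨W₀, hGood₀⟩ (fun j W => ⟨next j W.1 W.2, (hnext j W.1 W.2).1⟩) j
  set V : ℕ → World X n := fun j => (seq j).1 with hV
  set ι : ℕ → Fin 3 := fun j => ι' j (seq j).1 (seq j).2 with hι
  have hstep : ∀ j, (∀ l ≤ lev j, (V (j + 1)).gen l = (V j).gen l) ∧
      (∀ s < attackParam pS (lev j), (V (j + 1)).receiver s = (V j).receiver s ∧
        (V (j + 1)).committer s = (V j).committer s) ∧
      0 < (C (attackParam pS (lev j))).gain ((V (j + 1)).receiver (attackParam pS (lev j)))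
        ((V (j + 1)).committer (attackParam pS (lev j))) (ι j) (V (j + 1)).gen ∧
      potential S (V (j + 1)).receiver (V (j + 1)).committer (lev (j - 1)) (lev j)
        (V (j + 1)).gen ≤ 300 := fun j => (hnext j (seq j).1 (seq j).2).2
  have hgen : ∀ i j, i ≤ j → ∀ l ≤ lev i, (V j).gen l = (V i).gen l := by
    intro i j hij
    induction j, hij using Nat.le_induction with
    | base => exact fun _ _ => rfl
    | succ j hij ih =>
      exact fun l hl => ((hstep j).1 l (hl.trans (hmono.monotone hij))).trans (ih l hl)
  have hadv : ∀ i j, i ≤ j → ∀ s < attackParam pS (lev i),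
      (V j).receiver s = (V i).receiver s ∧ (V j).committer s = (V i).committer s := by
    intro i j hij
    induction j, hij using Nat.le_induction with
    | base => exact fun _ _ => ⟨rfl, rfl⟩
    | succ j hij ih =>
      intro s hs
      have h := (hstep j).2.1 s (hs.trans_le (hap.monotone hij))
      exact ⟨h.1.trans (ih s hs).1, h.2.trans (ih s hs).2⟩
  -- Stage j already has the final states of keys of length up to `lev j`, and j ≤ `lev j`, so the
  -- diagonal is the limit of the stages; likewise for the adversaries.
  set W : World X n := ⟨fun l => (V l).gen l, fun s => (V s).receiver s,
    fun s => (V s).committer s⟩ with hWdef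
  have hWgen : ∀ j, ∀ l ≤ lev j, W.gen l = (V j).gen l := by
    intro j l hl
    rcases le_total j l with h | h
    · exact hgen j l h l hl
    · exact (hgen l j h l (hid l)).symm
  have hWadv : ∀ j, ∀ s < attackParam pS (lev j),
      W.receiver s = (V j).receiver s ∧ W.committer s = (V j).committer s := by
    intro j s hs
    rcases le_total j s with h | h
    · exact hadv j s h s hs
    · have hs' : s < attackParam pS (lev s) := by
        have := hid s
        rw [attackParam]
        omega
      exact ⟨(hadv s j h s hs').1.symm, (hadv s j h s hs').2.symm⟩
  refine ⟨W, fun j => attackParam pS (lev j), ι, hap, fun j => ?_, ?_⟩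
  · have h := (hstep j).2.2.1
    have hs := hWadv (j + 1) (attackParam pS (lev j)) (hap (Nat.lt_succ_self j))
    have hb : (C (attackParam pS (lev j))).QueryBound (lev (j + 1))
        (pC.eval (attackParam pS (lev j))) := (hC _).2.2.mono (by
      rw [hsucc, nextLevel]
      omega)
    rw [hs.1, hs.2, hb.gain_congr (hWgen (j + 1))]
    exact h
  · filter_upwards [eventually_gt_atTop L₀] with l hl
    have hex : ∃ j, l ≤ lev j := ⟨l, hid l⟩
    -- The stage whose range (`lev (j - 1)`, `lev j`] contains l. Stage j + 1 agrees with the limit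
    -- on everything the distinguisher at l uses, and its potential bounds the term of l.
    set j := Nat.find hex with hj
    have hj1 : l ≤ lev j := Nat.find_spec hex
    have hj0 : j ≠ 0 := by
      intro h0
      rw [h0] at hj1
      exact absurd hl (not_lt.mpr hj1)
    have hj2 : lev (j - 1) < l := not_le.mp (Nat.find_min hex (Nat.sub_one_lt hj0))
    have hlS : pS.eval l ≤ pS.eval (lev j) := polynomial_eval_mono pS hj1
    have hle : (11 / 10) ^ l * sqAdvantage S (V (j + 1)).receiver (V (j + 1)).committer l
        (V (j + 1)).gen ≤ 300 := by
      refine le_trans ?_ (hstep j).2.2.2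
      exact Finset.single_le_sum (f := fun l => (11 / 10) ^ l * sqAdvantage S (V (j + 1)).receiver
        (V (j + 1)).committer l (V (j + 1)).gen) (fun i _ => mul_nonneg (by positivity)
        (sqAdvantage_nonneg S _ _ i _)) (Finset.mem_Ioc.mpr ⟨hj2, hj1⟩)
    have hag : ∀ s ≤ pS.eval l, W.receiver s = (V (j + 1)).receiver s ∧
        W.committer s = (V (j + 1)).committer s := fun s hs =>
      hWadv (j + 1) s (lt_trans (b := attackParam pS (lev j)) (by rw [attackParam]; omega)
        (hap (Nat.lt_succ_self j)))
    have hG : ∀ l' ≤ pS.eval l, W.gen l' = (V (j + 1)).gen l' := fun l' hl' =>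
      hWgen (j + 1) l' (by rw [hsucc, nextLevel]; omega)
    have hGl : W.gen l = (V (j + 1)).gen l :=
      hWgen (j + 1) l (hj1.trans (hmono.monotone (Nat.le_succ j)))
    have heq : sqAdvantage S W.receiver W.committer l W.gen =
        sqAdvantage S (V (j + 1)).receiver (V (j + 1)).committer l (V (j + 1)).gen := by
      unfold sqAdvantage
      rw [hSA l (.receiver W.receiver) (.receiver (V (j + 1)).receiver) fun s hs => (hag s hs).1,
        hSA l (.committer W.committer) (.committer (V (j + 1)).committer)
          fun s hs => (hag s hs).2,
        (S l _).advantage_congr (hS l _) hG hGl, (S l _).advantage_congr (hS l _) hG hGl]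
    rw [heq]
    exact hle

theorem not_isFullyBlackBoxReduction (hn : SuperLog n) (C : Commitment X n)
    (S : SecurityReduction X n) : ¬ IsFullyBlackBoxReduction C S := by
  rintro ⟨⟨pC, hpC⟩, ⟨pS, hpS⟩, hcorrect, hsecure⟩
  obtain ⟨W, t, ι, ht, hgain, hadv⟩ := exists_world (C := C) (S := S) hn
    (fun s => ⟨(hpC s).1, (hpC s).2.1, ⟨(hpC s).2.2.1, (hpC s).2.2.2.1, (hpC s).2.2.2.2.1,
      (hpC s).2.2.2.2.2.1, (hpC s).2.2.2.2.2.2⟩⟩)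
    (fun l A => (hpS l).1 A) (fun l A A' => (hpS l).2 A A')
  have hneg : ∀ A : Adversary, (A = .receiver W.receiver ∨ A = .committer W.committer) →
      ¬ Generator.BrokenBy W.gen fun s => S s A := by
    intro A hA hb
    -- The advantage itself serves as the negligible bound: its square is eventually at most 300 ·
    -- (10/11)^l.
    refine hb ⟨fun s => (S s A).advantage W.gen, ?_, fun s => le_rfl⟩
    refine negligible_of_sq_le (K := 300) (r := 10 / 11) (by norm_num) (by norm_num) (by norm_num)
      (fun l => abs_nonneg _) ?_
    filter_upwards [hadv] with l hl
    have h1 : (S l A).advantage W.gen ^ 2 ≤ sqAdvantage S W.receiver W.committer l W.gen := by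
      rcases hA with rfl | rfl
      · exact le_add_of_nonneg_right (sq_nonneg _)
      · exact le_add_of_nonneg_left (sq_nonneg _)
    have h2 : (300 : ℝ) * (10 / 11) ^ l = 300 / (11 / 10) ^ l := by
      rw [div_eq_mul_inv 300, ← inv_pow]
      norm_num
    rw [h2, le_div_iff₀ (by positivity), mul_comm]
    exact (mul_le_mul_of_nonneg_left h1 (by positivity)).trans hl
  -- Pigeonhole over completeness, hiding and binding. A failure by a constant at infinitely many
  -- parameters is not negligible.
  obtain ⟨i, hi⟩ : ∃ i, ∃ᶠ j in atTop, ι j = i := by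
    by_contra hno
    have : ∀ᶠ j in atTop, ∀ i, ι j ≠ i :=
      eventually_all.mpr fun i => not_frequently.mp fun h => hno ⟨i, h⟩
    obtain ⟨j, hj⟩ := this.exists
    exact hj _ rfl
  have hfreq : ∃ᶠ s in atTop, 0 < (C s).gain (W.receiver s) (W.committer s) i W.gen :=
    ht.tendsto_atTop.frequently (hi.mono fun j hj => hj ▸ hgain j)
  have hcontra : ∀ ε : ℕ → ℝ, Negligible ε →
      (∀ s, 0 < (C s).gain (W.receiver s) (W.committer s) i W.gen → 1 / 100 ≤ ε s) → False := by
    intro ε hε h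
    obtain ⟨s, h1, h2⟩ := (hfreq.and_eventually
      (hε.eventually_lt (show (0 : ℝ) < 1 / 100 by norm_num))).exists
    exact absurd (h s h1) (not_le.mpr h2)
  fin_cases i
  · obtain ⟨ε, hε, h⟩ := hcorrect W.gen
    refine hcontra ε hε fun s hs => ?_
    have hs' : 0 < 1 - (C s).completeness W.gen - 1 / 100 := hs
    linarith [h s]
  · refine hneg (.receiver W.receiver) (Or.inl rfl) (hsecure W.gen _ ?_)
    rintro ⟨ε, hε, h⟩
    refine hcontra ε hε fun s hs => ?_
    have hs' : 0 < (C s).hidingProb W.gen (W.receiver s) - 3 / 5 := hs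
    linarith [h s]
  · refine hneg (.committer W.committer) (Or.inr rfl) (hsecure W.gen _ ?_)
    rintro ⟨ε, hε, h⟩
    refine hcontra ε hε fun s hs => ?_
    have hs' : 0 < (C s).bindingProb W.gen (W.committer s) - 3 / 5 := hs
    linarith [h s]

end Limit

end QCCC

end

open QCCC in
/-- For every `n = ω(log)`: there is no quantum fully black-box reduction with classical queries of
the construction from statistically hiding and statistically binding QCCC interactive commitments
to pseudorandom state generators with `n`-qubit outputs (no input), nor to classically accessible
pseudorandom function-like state generators with inputs of arbitrary length `m`. -/
theorem mainTheorem5 (n : ℕ → ℕ) (hn : SuperLog n) :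
    (¬ ∃ (C : Commitment (fun _ => Unit) n) (S : SecurityReduction (fun _ => Unit) n),
        IsFullyBlackBoxReduction C S) ∧
    (∀ m : ℕ → ℕ,
      ¬ ∃ (C : Commitment (fun l => Bits (m l)) n) (S : SecurityReduction (fun l => Bits (m l)) n),
        IsFullyBlackBoxReduction C S) := by
  exact ⟨fun ⟨C, S, h⟩ => not_isFullyBlackBoxReduction hn C S h,
    fun _ ⟨C, S, h⟩ => not_isFullyBlackBoxReduction hn C S h⟩
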